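/- Let $\mathbb{D}$ be the open unit disk in $\mathbb{C}$, $\mathbb{T}$ the unit circle, $H(\mathbb{D})$ the space of analytic functions on $\mathbb{D}$, and $dA=\frac1\pi\,dx\,dy$. Fix $\zeta>\frac12$ and, for $\eta\in\mathbb{T}$, put $\Gamma(\eta)=\{z\in\mathbb{D}:|z-\eta|<\zeta(1-|z|^2)\}$. Let $S(0)=\mathbb{D}$ and, for $u=re^{i\theta}\in\mathbb{D}\setminus\{0\}$, let $S(u)=\{\lambda e^{it}\in\mathbb{D}: |t-\theta|\le \frac{1-r}{2},\ 1-\lambda\le 1-r\}$. For $1\le p<\infty$ and $\alpha>-2$, let $AT_p^\infty(\alpha)$ be the normed space of all $f\in H(\mathbb{D})$ with $$\|f\|_{AT_p^\infty(\alpha)}^p=\operatorname*{ess\,sup}_{\eta\in\mathbb{T}}\ \sup_{u\in\Gamma(\eta)}\frac{1}{1-|u|^2}\int_{S(u)}|f(z)|^p(1-|z|^2)^{\alpha+1}\,dA(z)<\infty .$$ For a finite positive Borel measure $\mu$ on $[0,1)$, let $\mathcal{C}_\mu$ be the Cesàro-like operator $$\mathcal{C}_\mu(f)(z)=\int_0^1\frac{f(tz)}{1-tz}\,d\mu(t),\qquad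 f\in H(\mathbb{D}),\ z\in\mathbb{D}.$$ **Theorem.** Let $1\le p<\infty$, $\alpha>-2$, and let $\mu$ be a finite positive Borel measure on $[0,1)$. Then $\mathcal{C}_\mu$ is compact on $AT_p^\infty(\alpha)$ (that is, it maps $AT_p^\infty(\alpha)$ into itself and is a compact bounded linear operator there) if and only if $\mu$ is a vanishing Carleson measure, i.e. $$\lim_{t\to1^-}\frac{\mu([t,1))}{1-t}=0 .$$ -/

import Mathlib

open MeasureTheory Set Filter Topology Metric
open scoped ENNReal

noncomputable section

namespace TentSpace

/-- The normalized area measure `dA = π⁻¹ dx dy`. -/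
def area : Measure ℂ := ENNReal.ofReal (Real.pi)⁻¹ • volume

/-- The non-tangential approach region `Γ_ζ(η)` in the open unit disk. -/
def approachRegion (ζ : ℝ) (η : ℂ) : Set ℂ :=
  {z | ‖z‖ < 1 ∧ ‖z - η‖ < ζ * (1 - ‖z‖ ^ 2)}

/-- The Carleson box `S(u)`: all of the disk for `u = 0`; for `u = r e^{iθ} ≠ 0` the set of those
`ρ e^{it}` in the disk with `|t - θ| ≤ (1 - r) / 2` and `1 - ρ ≤ 1 - r`. -/
def carlesonBox (u : ℂ) : Set ℂ :=
  {z | ‖z‖ < 1 ∧ (u = 0 ∨ ∃ θ t : ℝ,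
    u = ‖u‖ * Complex.exp (θ * Complex.I) ∧ z = ‖z‖ * Complex.exp (t * Complex.I) ∧
    |t - θ| ≤ (1 - ‖u‖) / 2 ∧ 1 - ‖z‖ ≤ 1 - ‖u‖)}

/-- The average `(1 - |u|²)⁻¹ ∫_{S(u)} |f(z)|^p (1 - |z|²)^(α+1) dA(z)`. -/
def boxAverage (p α : ℝ) (f : ℂ → ℂ) (u : ℂ) : ℝ≥0∞ :=
  (ENNReal.ofReal (1 - ‖u‖ ^ 2))⁻¹ *
    ∫⁻ z in carlesonBox u, ‖f z‖ₑ ^ p * ENNReal.ofReal ((1 - ‖z‖ ^ 2) ^ (α + 1)) ∂area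

/-- The `[0, ∞]`-valued expression `‖f‖_{T_p^∞(α)}`; the essential supremum over the unit circle
is taken over `η = e^{iθ}`, `θ ∈ (-π, π]`, with respect to Lebesgue measure. -/
def tentENorm (p α ζ : ℝ) (f : ℂ → ℂ) : ℝ≥0∞ :=
  (essSup (fun θ : ℝ => ⨆ u ∈ approachRegion ζ (Complex.exp (θ * Complex.I)), boxAverage p α f u)
    (volume.restrict (Ioc (-Real.pi) Real.pi))) ^ (1 / p)

lemma boxAverage_rpow (p α : ℝ) (hp : 1 ≤ p) (f : ℂ → ℂ) (u : ℂ) :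
    boxAverage p α f u ^ (1 / p) = (ENNReal.ofReal (1 - ‖u‖ ^ 2))⁻¹ ^ (1 / p) *
      (∫⁻ z in carlesonBox u,
        (‖f z‖ₑ * ENNReal.ofReal ((1 - ‖z‖ ^ 2) ^ (α + 1)) ^ (1 / p)) ^ p ∂area) ^ (1 / p) := by
  have hp0 : 0 < p := by linarith
  rw [boxAverage, ENNReal.mul_rpow_of_nonneg _ _ (by positivity)]
  congr 3
  ext z
  rw [ENNReal.mul_rpow_of_nonneg _ _ hp0.le, ← ENNReal.rpow_mul, one_div, inv_mul_cancel₀ hp0.ne',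
    ENNReal.rpow_one]

lemma carlesonBox_subset (u : ℂ) : carlesonBox u ⊆ ball 0 1 := by
  intro z hz
  simpa using hz.1

lemma boxAverage_add_le (p α : ℝ) (hp : 1 ≤ p) {f g : ℂ → ℂ}
    (hf : DifferentiableOn ℂ f (ball 0 1)) (hg : DifferentiableOn ℂ g (ball 0 1)) (u : ℂ) :
    boxAverage p α (f + g) u ^ (1 / p) ≤
      boxAverage p α f u ^ (1 / p) + boxAverage p α g u ^ (1 / p) := by
  have hp0 : 0 < p := by linarith
  have hm : ∀ h : ℂ → ℂ, DifferentiableOn ℂ h (ball 0 1) →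
      AEMeasurable h (area.restrict (carlesonBox u)) := by
    intro h hh
    refine AEMeasurable.mono_measure ?_ (Measure.restrict_mono (carlesonBox_subset u) le_rfl)
    exact hh.continuousOn.aemeasurable measurableSet_ball
  have hfm := hm f hf
  have hgm := hm g hg
  have hw : Measurable fun z : ℂ => ENNReal.ofReal ((1 - ‖z‖ ^ 2) ^ (α + 1)) ^ (1 / p) := by
    fun_prop
  rw [boxAverage_rpow p α hp, boxAverage_rpow p α hp, boxAverage_rpow p α hp, ← mul_add]
  gcongr
  refine le_trans ?_ (ENNReal.lintegral_Lp_add_le (hfm.enorm.mul hw.aemeasurable)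
    (hgm.enorm.mul hw.aemeasurable) hp)
  gcongr with z
  simp only [Pi.add_apply]
  rw [← add_mul]
  gcongr
  exact enorm_add_le _ _

lemma boxAverage_smul (p α : ℝ) (hp : 1 ≤ p) (c : ℂ) (f : ℂ → ℂ) (u : ℂ) :
    boxAverage p α (c • f) u = ‖c‖ₑ ^ p * boxAverage p α f u := by
  have hp0 : 0 < p := by linarith
  have hc : ‖c‖ₑ ^ p ≠ ∞ := ENNReal.rpow_ne_top_of_nonneg hp0.le enorm_ne_top
  simp only [boxAverage, Pi.smul_apply, enorm_smul, ENNReal.mul_rpow_of_nonneg _ _ hp0.le,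
    mul_assoc]
  rw [lintegral_const_mul' _ _ hc, ← mul_assoc, ← mul_assoc, mul_comm (‖c‖ₑ ^ p)]

lemma tentENorm_add_le (p α ζ : ℝ) (hp : 1 ≤ p) {f g : ℂ → ℂ}
    (hf : DifferentiableOn ℂ f (ball 0 1)) (hg : DifferentiableOn ℂ g (ball 0 1)) :
    tentENorm p α ζ (f + g) ≤ tentENorm p α ζ f + tentENorm p α ζ g := by
  have hp0 : 0 < p := by linarith
  have hq : 0 < 1 / p := by positivity
  rw [tentENorm, one_div, ENNReal.rpow_inv_le_iff hp0]
  refine essSup_le_of_ae_le _ ?_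
  have key : ∀ h : ℂ → ℂ, ∀ᵐ θ : ℝ ∂(volume.restrict (Ioc (-Real.pi) Real.pi)),
      ∀ u ∈ approachRegion ζ (Complex.exp (θ * Complex.I)),
        boxAverage p α h u ^ (1 / p) ≤ tentENorm p α ζ h := by
    intro h
    filter_upwards [ENNReal.ae_le_essSup (μ := volume.restrict (Ioc (-Real.pi) Real.pi))
      (fun θ : ℝ => ⨆ u ∈ approachRegion ζ (Complex.exp (θ * Complex.I)), boxAverage p α h u)]
      with θ hθ u hu
    refine ENNReal.rpow_le_rpow (le_trans ?_ hθ) hq.le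
    exact le_iSup₂_of_le u hu le_rfl
  filter_upwards [key f, key g] with θ h1 h2
  refine iSup₂_le fun u hu => ?_
  rw [← ENNReal.rpow_inv_le_iff hp0, ← one_div]
  exact (boxAverage_add_le p α hp hf hg u).trans (add_le_add (h1 u hu) (h2 u hu))

lemma tentENorm_smul (p α ζ : ℝ) (hp : 1 ≤ p) (c : ℂ) (f : ℂ → ℂ) :
    tentENorm p α ζ (c • f) = ‖c‖ₑ * tentENorm p α ζ f := by
  have hp0 : 0 < p := by linarith
  simp only [tentENorm, boxAverage_smul p α hp, ← ENNReal.mul_iSup]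
  rw [ENNReal.essSup_const_mul, ENNReal.mul_rpow_of_nonneg _ _ (by positivity), ← ENNReal.rpow_mul,
    mul_one_div_cancel hp0.ne', ENNReal.rpow_one]

lemma tentENorm_zero (p α ζ : ℝ) (hp : 1 ≤ p) : tentENorm p α ζ 0 = 0 := by
  simpa using tentENorm_smul p α ζ hp 0 0

lemma carlesonBox_mem_nhds (θ r s : ℝ) (hr : 0 < r) (hrs : r < s) (hs : s < 1) :
    carlesonBox (r * Complex.exp (θ * Complex.I)) ∈ 𝓝 ((s : ℂ) * Complex.exp (θ * Complex.I)) := by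
  have hu : ‖(r : ℂ) * Complex.exp (θ * Complex.I)‖ = r := by
    simp [Complex.norm_exp_ofReal_mul_I, abs_of_pos hr]
  have hv : ‖(s : ℂ) * Complex.exp (θ * Complex.I)‖ = s := by
    simp [Complex.norm_exp_ofReal_mul_I, abs_of_pos (hr.trans hrs)]
  have hcn : ContinuousAt (fun z : ℂ => ‖z‖) ((s : ℂ) * Complex.exp (θ * Complex.I)) :=
    continuous_norm.continuousAt
  have hval : ((s : ℂ) * Complex.exp (θ * Complex.I)) * Complex.exp (-(θ * Complex.I)) = s := by
    rw [mul_assoc, ← Complex.exp_add]; simp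
  have hca : ContinuousAt (fun z : ℂ => |Complex.arg (z * Complex.exp (-(θ * Complex.I)))|)
      ((s : ℂ) * Complex.exp (θ * Complex.I)) := by
    refine ContinuousAt.abs (ContinuousAt.comp (g := Complex.arg) ?_ (by fun_prop))
    rw [hval]
    exact Complex.continuousAt_arg (Complex.ofReal_mem_slitPlane.2 (hr.trans hrs))
  have e1 : ∀ᶠ z in 𝓝 ((s : ℂ) * Complex.exp (θ * Complex.I)), r < ‖z‖ :=
    hcn.eventually_const_lt (by simpa only [hv] using hrs)
  have e2 : ∀ᶠ z in 𝓝 ((s : ℂ) * Complex.exp (θ * Complex.I)), ‖z‖ < 1 :=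
    hcn.eventually_lt_const (by simpa only [hv] using hs)
  have e3 : ∀ᶠ z in 𝓝 ((s : ℂ) * Complex.exp (θ * Complex.I)),
      |Complex.arg (z * Complex.exp (-(θ * Complex.I)))| < (1 - r) / 2 := by
    refine hca.eventually_lt_const ?_
    beta_reduce
    rw [hval, Complex.arg_ofReal_of_nonneg (hr.trans hrs).le]
    simp only [abs_zero]
    linarith
  filter_upwards [e1, e2, e3] with z h1 h2 h3
  refine ⟨h2, Or.inr ⟨θ, θ + Complex.arg (z * Complex.exp (-(θ * Complex.I))), ?_, ?_, ?_, ?_⟩⟩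
  · rw [hu]
  · have h := Complex.norm_mul_exp_arg_mul_I (z * Complex.exp (-(θ * Complex.I)))
    have hn : ‖z * Complex.exp (-(θ * Complex.I))‖ = ‖z‖ := by
      rw [norm_mul, ← neg_mul, ← Complex.ofReal_neg, Complex.norm_exp_ofReal_mul_I, mul_one]
    rw [hn] at h
    push_cast
    rw [add_mul, Complex.exp_add, mul_left_comm, h, mul_left_comm, ← Complex.exp_add]
    simp
  · rw [hu]
    simpa using h3.le
  · rw [hu]
    linarith

lemma eqOn_zero_of_tentENorm_eq_zero (p α ζ : ℝ) (hp : 1 ≤ p) (hζ : 1 / 2 < ζ) {f : ℂ → ℂ}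
    (hf : DifferentiableOn ℂ f (ball 0 1)) (h : tentENorm p α ζ f = 0) :
    ∀ z ∈ ball (0 : ℂ) 1, f z = 0 := by
  have hp0 : 0 < p := by linarith
  rw [tentENorm, ENNReal.rpow_eq_zero_iff_of_pos (by positivity), ENNReal.essSup_eq_zero_iff] at h
  have hne : (volume.restrict (Ioc (-Real.pi) Real.pi)) ≠ 0 := by
    rw [Ne, Measure.restrict_eq_zero, Real.volume_Ioc]
    simp [Real.pi_pos]
  have : (ae (volume.restrict (Ioc (-Real.pi) Real.pi))).NeBot := ae_neBot.2 hne
  obtain ⟨θ, hθ⟩ := h.exists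
  obtain ⟨r, hr0, hr1, hr2⟩ : ∃ r : ℝ, 0 < r ∧ r < 1 ∧ 1 < ζ * (1 + r) := by
    have hc : ContinuousAt (fun r : ℝ => ζ * (1 + r)) 1 := by fun_prop
    have h1 : ∀ᶠ r in 𝓝[<] (1 : ℝ), 1 < ζ * (1 + r) :=
      (hc.eventually_const_lt (show (1 : ℝ) < ζ * (1 + 1) by linarith)).filter_mono
        nhdsWithin_le_nhds
    have h2 : ∀ᶠ r in 𝓝[<] (1 : ℝ), 0 < r :=
      (eventually_gt_nhds one_pos).filter_mono nhdsWithin_le_nhds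
    obtain ⟨r, h1, h2, h3⟩ := (h1.and (h2.and self_mem_nhdsWithin)).exists
    exact ⟨r, h2, h3, h1⟩
  set η := Complex.exp (θ * Complex.I) with hη
  have hηn : ‖η‖ = 1 := Complex.norm_exp_ofReal_mul_I θ
  have hun : ‖(r : ℂ) * η‖ = r := by rw [norm_mul, hηn]; simp [abs_of_pos hr0]
  have hu : (r : ℂ) * η ∈ approachRegion ζ η := by
    refine ⟨by rw [hun]; exact hr1, ?_⟩
    have : (r : ℂ) * η - η = ((r - 1 : ℝ) : ℂ) * η := by push_cast; ring
    rw [hun, this, norm_mul, hηn, mul_one, Complex.norm_real, Real.norm_eq_abs,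
      abs_of_neg (by linarith)]
    nlinarith
  have hz : boxAverage p α f (r * η) = 0 := by
    have := hθ
    simp only [Pi.zero_apply, ENNReal.iSup_eq_zero] at this
    exact this _ hu
  have hint := (mul_eq_zero.1 hz).resolve_left (by simp)
  set s := (r + 1) / 2 with hs
  have hnhds : carlesonBox (r * η) ∈ 𝓝 ((s : ℂ) * η) :=
    carlesonBox_mem_nhds θ r s hr0 (by linarith) (by linarith)
  obtain ⟨ε, hε, hball⟩ := Metric.mem_nhds_iff.1 hnhds
  have hsub : ball ((s : ℂ) * η) ε ⊆ ball 0 1 := hball.trans (carlesonBox_subset _)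
  have hint2 : ∫⁻ z in ball ((s : ℂ) * η) ε,
      ‖f z‖ₑ ^ p * ENNReal.ofReal ((1 - ‖z‖ ^ 2) ^ (α + 1)) ∂area = 0 :=
    le_antisymm ((lintegral_mono_set hball).trans hint.le) bot_le
  have hfm : AEMeasurable f (area.restrict (ball ((s : ℂ) * η) ε)) :=
    (hf.mono hsub).continuousOn.aemeasurable measurableSet_ball
  have hw : Measurable fun z : ℂ => ENNReal.ofReal ((1 - ‖z‖ ^ 2) ^ (α + 1)) := by fun_prop
  replace hint2 := (lintegral_eq_zero_iff' ((hfm.enorm.pow_const p).mul hw.aemeasurable)).1 hint2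
  have hfa : f =ᵐ[volume.restrict (ball ((s : ℂ) * η) ε)] fun _ => 0 := by
    have hac : (volume.restrict (ball ((s : ℂ) * η) ε)) ≪
        (area.restrict (ball ((s : ℂ) * η) ε)) := by
      refine Measure.AbsolutelyContinuous.restrict ?_ _
      exact Measure.absolutelyContinuous_smul (by simp [Real.pi_pos])
    filter_upwards [hac.ae_le hint2, ae_restrict_mem measurableSet_ball] with z hz1 hz2
    have hz3 : ‖z‖ < 1 := by simpa using hsub hz2
    have hpos : 0 < (1 - ‖z‖ ^ 2) ^ (α + 1) :=
      Real.rpow_pos_of_pos (by nlinarith [norm_nonneg z]) _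
    have := (mul_eq_zero.1 hz1).resolve_right (by simpa using hpos)
    rw [ENNReal.rpow_eq_zero_iff_of_pos hp0] at this
    simpa using this
  have hEq := Measure.eqOn_open_of_ae_eq hfa isOpen_ball (hf.mono hsub).continuousOn
    continuousOn_const
  have han : AnalyticOnNhd ℂ f (ball 0 1) := hf.analyticOnNhd isOpen_ball
  have hev : f =ᶠ[𝓝 ((s : ℂ) * η)] 0 :=
    hEq.eventuallyEq_of_mem (ball_mem_nhds _ hε)
  exact fun z hz => han.eqOn_zero_of_preconnected_of_eventuallyEq_zero
    (convex_ball 0 1).isPreconnected (hsub (mem_ball_self hε)) hev hz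

/-- The complex vector space of analytic functions `f` on the open unit disk with
`‖f‖_{T_p^∞(α)} < ∞`. A function on the disk is represented by its extension by zero to `ℂ`;
measurability on the disk is automatic for analytic functions. -/
def atSubmodule (p α ζ : ℝ) [hp : Fact (1 ≤ p)] : Submodule ℂ (ℂ → ℂ) where
  carrier := {f | DifferentiableOn ℂ f (ball 0 1) ∧ (∀ z ∉ ball (0 : ℂ) 1, f z = 0) ∧
    tentENorm p α ζ f < ∞}
  add_mem' := by
    rintro f g ⟨hf, hf0, hfn⟩ ⟨hg, hg0, hgn⟩
    refine ⟨hf.add hg, fun z hz => by simp [hf0 z hz, hg0 z hz], ?_⟩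
    exact (tentENorm_add_le p α ζ hp.out hf hg).trans_lt (ENNReal.add_lt_top.2 ⟨hfn, hgn⟩)
  zero_mem' := ⟨differentiableOn_const 0, fun _ _ => rfl, by
    rw [tentENorm_zero p α ζ hp.out]; exact ENNReal.zero_lt_top⟩
  smul_mem' := by
    rintro c f ⟨hf, hf0, hfn⟩
    refine ⟨hf.const_smul c, fun z hz => by simp [hf0 z hz], ?_⟩
    rw [tentENorm_smul p α ζ hp.out]
    exact ENNReal.mul_lt_top enorm_lt_top hfn

/-- The Hardy-Carleson type analytic tent space `AT_p^∞(α)`. It is a type of its own so that its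
topology is the one of the norm below, not that of pointwise convergence. -/
def AT (p α ζ : ℝ) [Fact (1 ≤ p)] : Type := atSubmodule p α ζ

namespace AT

variable {p α ζ : ℝ} [hp : Fact (1 ≤ p)]

instance : AddCommGroup (AT p α ζ) := inferInstanceAs (AddCommGroup (atSubmodule p α ζ))

instance : Module ℂ (AT p α ζ) := inferInstanceAs (Module ℂ (atSubmodule p α ζ))

/-- The underlying function (zero off the disk) of an element of `AT_p^∞(α)`. -/
def toFun (f : AT p α ζ) : ℂ → ℂ := f.1

instance : CoeFun (AT p α ζ) (fun _ => ℂ → ℂ) := ⟨toFun⟩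

instance : Norm (AT p α ζ) := ⟨fun f => (tentENorm p α ζ f).toReal⟩

lemma core [hζ : Fact (1 / 2 < ζ)] : NormedSpace.Core ℂ (AT p α ζ) where
  norm_nonneg _ := ENNReal.toReal_nonneg
  norm_smul c f := by
    change (tentENorm p α ζ (c • f.1)).toReal = ‖c‖ * (tentENorm p α ζ f.1).toReal
    rw [tentENorm_smul p α ζ hp.out, ENNReal.toReal_mul, toReal_enorm]
  norm_triangle f g := by
    change (tentENorm p α ζ (f.1 + g.1)).toReal ≤
      (tentENorm p α ζ f.1).toReal + (tentENorm p α ζ g.1).toReal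
    rw [← ENNReal.toReal_add f.2.2.2.ne g.2.2.2.ne]
    exact ENNReal.toReal_mono (ENNReal.add_ne_top.2 ⟨f.2.2.2.ne, g.2.2.2.ne⟩)
      (tentENorm_add_le p α ζ hp.out f.2.1 g.2.1)
  norm_eq_zero_iff f := by
    change (tentENorm p α ζ f.1).toReal = 0 ↔ f = 0
    constructor
    · intro h
      have h0 : tentENorm p α ζ f.1 = 0 :=
        ((ENNReal.toReal_eq_zero_iff _).1 h).resolve_right f.2.2.2.ne
      refine Subtype.ext (funext fun z => ?_)
      by_cases hz : z ∈ ball (0 : ℂ) 1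
      · exact eqOn_zero_of_tentENorm_eq_zero p α ζ hp.out hζ.out f.2.1 h0 z hz
      · exact f.2.2.1 z hz
    · rintro rfl
      change (tentENorm p α ζ 0).toReal = 0
      rw [tentENorm_zero p α ζ hp.out, ENNReal.toReal_zero]

instance [Fact (1 / 2 < ζ)] : NormedAddCommGroup (AT p α ζ) := NormedAddCommGroup.ofCore core

instance [Fact (1 / 2 < ζ)] : NormedSpace ℂ (AT p α ζ) := NormedSpace.ofCore core

end AT

open Classical in
/-- The Cesàro-like operator `C_μ(f)(z) = ∫ f(tz) / (1 - tz) dμ(t)`, for `z` in the open unit disk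
(and zero off the disk). -/
def cesaro (μ : Measure ℝ) (f : ℂ → ℂ) (z : ℂ) : ℂ :=
  if z ∈ ball (0 : ℂ) 1 then ∫ t in Ico (0 : ℝ) 1, f (t * z) / (1 - t * z) ∂μ else 0

/-- `C_μ` is a compact operator on `AT_p^∞(α)`: it maps the space to itself, and the resulting
bounded linear operator is compact. -/
def CesaroCompactOn (p α ζ : ℝ) [Fact (1 ≤ p)] [Fact (1 / 2 < ζ)] (μ : Measure ℝ) : Prop :=
  ∃ T : AT p α ζ →L[ℂ] AT p α ζ, (∀ f : AT p α ζ, (T f : ℂ → ℂ) = cesaro μ f) ∧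
    IsCompactOperator T

/-- A vanishing Carleson measure on `[0, 1)`: `μ([t, 1)) / (1 - t) → 0` as `t → 1`. -/
def IsVanishingCarleson (μ : Measure ℝ) : Prop :=
  Tendsto (fun t : ℝ => μ.real (Ico t 1) / (1 - t)) (𝓝[<] 1) (𝓝 0)

end TentSpace

end

/-! ### Measure estimates: arcs, boundary windows, negative moments, Jensen. -/

namespace TentSpace

/-! The norm is first traded for a Carleson condition that is easier to handle: `HasTentBound p α f
M` bounds the mass of |f|^p (1-|z|)^(α+1) in every disc of radius R about a boundary point by MR. By
`exists_hasTentBound` and `HasTentBound.tentENorm_rpow_le`, the best M is comparable to the p-th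
power of the norm. The sub-mean value property then gives |f(z)|^p ≲ M (1-|z|)^(-(α+2)).

The core is `exists_hasTentBound_cesaro`: if μ([1-s,1)) ≤ κs for all s > 0, then C_μ has norm at
most Cκ, with C independent of μ. In a window of radius R the integral over t is cut at 1-t = R. The
far part is estimated by pointwise growth. For the near part, a weighted Jensen inequality moves the
p-th power inside, |f(tz)|^p is replaced by an area mean, and two applications of Fubini return the
mass of |f|^p in the window of radius 3R.

Sufficiency: split μ at a radius r' close to 1. The tail has a small Carleson constant, hence a
small operator norm. The part below r' sees f only on |w| ≤ r', so it sends bounded sequences that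
tend to zero locally uniformly to null sequences. Montel's theorem and Fatou's lemma supply
subsequences whose limit stays in the unit ball (`AT.exists_subseq_tendsto`), and so the image of
the closed unit ball is compact.

Necessity: the functions F_a(z) = (1-a)^b/(1-az)^n, with b = n-(α+2)/p, are bounded in norm, while
C_μ F_a → 0 pointwise as a → 1. Compactness upgrades this to norm convergence. At z = a the
integrand defining C_μ F_a is positive, so |C_μ F_a(a)| is at least a constant times
(1-a)^(-(α+2)/p) μ([a,1))/(1-a). The growth estimate bounds the same value by a constant times
(1-a)^(-(α+2)/p) ‖C_μ F_a‖, and the powers cancel. -/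

lemma ofReal_mul_volume_arc_le {ρ R : ℝ} (hρ : 0 < ρ) (hR : 0 < R) (w : ℂ) :
    ENNReal.ofReal ρ * volume {φ : ℝ | φ ∈ Ioo (-Real.pi) Real.pi ∧
      ‖Complex.polarCoord.symm (ρ, φ) - w‖ < R} ≤ ENNReal.ofReal (6 * Real.pi * R) := by
  have hπ := Real.pi_pos
  set A : Set ℝ := {φ : ℝ | φ ∈ Ioo (-Real.pi) Real.pi ∧
      ‖Complex.polarCoord.symm (ρ, φ) - w‖ < R} with hA
  rcases A.eq_empty_or_nonempty with hE | ⟨ψ, hψ⟩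
  · simp [hE]
  set δ : ℝ := Real.pi * R / ρ with hδ
  -- Two points of the arc are less than 2R apart, and their chord is 2ρ|sin((φ-ψ)/2)|. Jordan's
  -- inequality turns this into |φ-ψ| < δ modulo 2π; the two translates cover an arc that crosses
  -- the cut at ±π.
  have hsub : A ⊆ ball ψ δ ∪ ball (ψ + 2 * Real.pi) δ ∪ ball (ψ - 2 * Real.pi) δ := by
    intro φ hφ
    have h1 : ‖Complex.polarCoord.symm (ρ, φ) - Complex.polarCoord.symm (ρ, ψ)‖ < 2 * R := by
      have := norm_sub_le (Complex.polarCoord.symm (ρ, φ) - w)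
        (Complex.polarCoord.symm (ρ, ψ) - w)
      rw [sub_sub_sub_cancel_right] at this
      linarith [hφ.2, hψ.2]
    have h2 : Complex.polarCoord.symm (ρ, φ) - Complex.polarCoord.symm (ρ, ψ) =
        ρ * (Complex.exp (ψ * Complex.I) * (Complex.exp (Complex.I * (φ - ψ : ℝ)) - 1)) := by
      have e : Complex.exp (φ * Complex.I) =
          Complex.exp (ψ * Complex.I) * Complex.exp (Complex.I * (φ - ψ : ℝ)) := by
        rw [← Complex.exp_add]; congr 1; push_cast; ring
      rw [mul_sub, ← e, Complex.exp_mul_I, Complex.exp_mul_I]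
      simp only [Complex.polarCoord_symm_apply, Complex.ofReal_cos, Complex.ofReal_sin]
      ring
    rw [h2, norm_mul, norm_mul, Complex.norm_exp_ofReal_mul_I,
      Complex.norm_exp_I_mul_ofReal_sub_one, Complex.norm_real, Real.norm_eq_abs, abs_of_pos hρ,
      one_mul, norm_mul, Real.norm_eq_abs, Real.norm_eq_abs, abs_two] at h1
    have h3 : |Real.sin ((φ - ψ) / 2)| < R / ρ := by
      rw [lt_div_iff₀ hρ]; linarith
    have key : ∀ x : ℝ, |x| ≤ Real.pi / 2 → |Real.sin x| = |Real.sin ((φ - ψ) / 2)| →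
        |2 * x| < δ := by
      intro x hx hs
      have := Real.mul_abs_le_abs_sin hx
      rw [hs] at this
      have h4 := this.trans_lt h3
      rw [abs_mul, abs_two]
      have h5 : 2 / Real.pi * |x| * Real.pi < R / ρ * Real.pi := by gcongr
      have h6 : 2 / Real.pi * |x| * Real.pi = 2 * |x| := by field_simp
      rw [h6] at h5
      calc _ < _ := h5
        _ = δ := by rw [hδ]; ring
    obtain ⟨h7, h8⟩ := hφ.1
    obtain ⟨h9, h10⟩ := hψ.1
    simp only [mem_union, mem_ball, Real.dist_eq]
    by_cases hc : |(φ - ψ) / 2| ≤ Real.pi / 2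
    · left; left
      convert key _ hc rfl using 2; ring
    · rw [abs_le, not_and_or, not_le, not_le] at hc
      rcases hc with hc | hc
      · right
        convert key ((φ - ψ) / 2 + Real.pi) (by rw [abs_le]; constructor <;> linarith)
          (by rw [Real.sin_add_pi, abs_neg]) using 2
        ring
      · left; right
        convert key ((φ - ψ) / 2 - Real.pi) (by rw [abs_le]; constructor <;> linarith)
          (by rw [Real.sin_sub_pi, abs_neg]) using 2
        ring
  have hδ0 : 0 < δ := by positivity
  calc _ ≤ ENNReal.ofReal ρ * (ENNReal.ofReal (2 * δ) + ENNReal.ofReal (2 * δ)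
        + ENNReal.ofReal (2 * δ)) := by
        gcongr
        refine (measure_mono hsub).trans ((measure_union_le _ _).trans ?_)
        gcongr
        · refine (measure_union_le _ _).trans ?_
          rw [Real.volume_ball, Real.volume_ball]
        · rw [Real.volume_ball]
    _ = ENNReal.ofReal (6 * Real.pi * R) := by
        rw [← ENNReal.ofReal_add (by positivity) (by positivity),
          ← ENNReal.ofReal_add (by positivity) (by positivity), ← ENNReal.ofReal_mul hρ.le]
        congr 1
        rw [hδ]; field_simp; ring

lemma setLIntegral_rpow_one_sub {γ R : ℝ} (hγ : -1 < γ) (hR : 0 < R) :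
    ∫⁻ ρ in Ioo (1 - R) 1, ENNReal.ofReal ((1 - ρ) ^ γ) =
      ENNReal.ofReal (R ^ (γ + 1) / (γ + 1)) := by
  have hi : IntervalIntegrable (fun x : ℝ => (1 - x) ^ γ) volume (1 - R) 1 := by
    have := (intervalIntegral.intervalIntegrable_rpow' (a := 0) (b := R) hγ).comp_sub_left 1
    simpa using this.symm
  have h1 : (1 - R) ≤ 1 := by linarith
  rw [← Measure.restrict_congr_set Ioo_ae_eq_Ioc.symm, ← ofReal_integral_eq_lintegral_ofReal]
  · rw [← intervalIntegral.integral_of_le h1,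
      intervalIntegral.integral_comp_sub_left (fun x : ℝ => x ^ γ) 1, sub_self, sub_sub_cancel,
      integral_rpow (Or.inl hγ), Real.zero_rpow (by linarith), sub_zero]
  · exact (intervalIntegrable_iff_integrableOn_Ioc_of_le h1).1 hi
  · filter_upwards [ae_restrict_mem measurableSet_Ioc] with x hx
    exact Real.rpow_nonneg (by linarith [hx.2]) _

/-- The mass that a power of the distance to the unit circle gives to a disk that meets the circle
up to a distance comparable to its radius. -/
lemma setLIntegral_one_sub_norm_rpow_le {γ R : ℝ} (hγ : -1 < γ) (hR : 0 < R) (w : ℂ) :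
    ∫⁻ z in {z : ℂ | ‖z‖ < 1 ∧ 1 - ‖z‖ < R ∧ ‖z - w‖ < R}, ENNReal.ofReal ((1 - ‖z‖) ^ γ) ≤
      ENNReal.ofReal (6 * Real.pi / (γ + 1) * R ^ (γ + 2)) := by
  have hms : MeasurableSet {z : ℂ | ‖z‖ < 1 ∧ 1 - ‖z‖ < R ∧ ‖z - w‖ < R} := by
    simp only [ofPred_and]
    exact (measurableSet_lt (by fun_prop) (by fun_prop)).inter
      ((measurableSet_lt (by fun_prop) (by fun_prop)).inter
        (measurableSet_lt (by fun_prop) (by fun_prop)))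
  have hF : Measurable ({z : ℂ | ‖z‖ < 1 ∧ 1 - ‖z‖ < R ∧ ‖z - w‖ < R}.indicator
      fun z => ENNReal.ofReal ((1 - ‖z‖) ^ γ)) := Measurable.indicator (by fun_prop) hms
  have hP : Measurable fun q : ℝ × ℝ => Complex.polarCoord.symm q := by
    simp only [Complex.polarCoord_symm_apply]
    fun_prop
  -- In polar coordinates only radii in (1-R, 1) contribute, and each circle meets the disc about w
  -- in length at most 6πR.
  rw [← lintegral_indicator hms, ← Complex.lintegral_comp_polarCoord_symm,
    polarCoord_target, Measure.volume_eq_prod, setLIntegral_prod]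
  · calc
      _ ≤ ∫⁻ ρ in Ioi (0 : ℝ), (Ioo (1 - R) 1).indicator
          (fun ρ => ENNReal.ofReal ((1 - ρ) ^ γ)) ρ * ENNReal.ofReal (6 * Real.pi * R) := by
        refine setLIntegral_mono' measurableSet_Ioi fun ρ hρ => ?_
        replace hρ : 0 < ρ := hρ
        by_cases hm : ρ ∈ Ioo (1 - R) 1
        · rw [indicator_of_mem hm]
          calc _ ≤ ∫⁻ φ in Ioo (-Real.pi) Real.pi,
                {φ : ℝ | ‖Complex.polarCoord.symm (ρ, φ) - w‖ < R}.indicator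
                  (fun _ => ENNReal.ofReal ((1 - ρ) ^ γ) * ENNReal.ofReal ρ) φ := by
                refine lintegral_mono fun φ => ?_
                by_cases hφ : ‖Complex.polarCoord.symm (ρ, φ) - w‖ < R
                · rw [indicator_of_mem (show φ ∈ {φ : ℝ |
                    ‖Complex.polarCoord.symm (ρ, φ) - w‖ < R} from hφ), smul_eq_mul, mul_comm]
                  gcongr
                  refine (indicator_le_self' (fun _ _ => zero_le) _).trans ?_
                  rw [Complex.norm_polarCoord_symm, abs_of_pos hρ]
                · rw [indicator_of_notMem (fun h => hφ h.2.2), smul_zero]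
                  exact zero_le
            _ = ENNReal.ofReal ((1 - ρ) ^ γ) * (ENNReal.ofReal ρ *
                volume {φ : ℝ | φ ∈ Ioo (-Real.pi) Real.pi ∧
                  ‖Complex.polarCoord.symm (ρ, φ) - w‖ < R}) := by
                have hm2 : MeasurableSet {φ : ℝ | ‖Complex.polarCoord.symm (ρ, φ) - w‖ < R} := by
                  refine (isOpen_lt ?_ continuous_const).measurableSet
                  simp only [Complex.polarCoord_symm_apply]
                  fun_prop
                rw [lintegral_indicator_const hm2, Measure.restrict_apply hm2, mul_assoc]
                congr 3
                ext φ
                simp only [mem_inter_iff, mem_ofPred_eq]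
                tauto
            _ ≤ _ := by
                gcongr
                exact ofReal_mul_volume_arc_le hρ hR w
        · rw [indicator_of_notMem hm, zero_mul, nonpos_iff_eq_zero, lintegral_eq_zero_iff']
          · refine ae_of_all _ fun φ => ?_
            beta_reduce
            rw [indicator_of_notMem, smul_zero]
            · rfl
            · intro h
              simp only [mem_ofPred_eq, Complex.norm_polarCoord_symm, abs_of_pos hρ] at h
              exact hm ⟨by linarith [h.2.1], h.1⟩
          · exact ((by fun_prop : Measurable fun φ : ℝ => ENNReal.ofReal (ρ, φ).1).smul
              (hF.comp (hP.comp measurable_prodMk_left))).aemeasurable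
      _ ≤ (∫⁻ ρ in Ioo (1 - R) 1, ENNReal.ofReal ((1 - ρ) ^ γ)) * ENNReal.ofReal (6 * Real.pi * R) := by
        rw [lintegral_mul_const _ (by
          refine Measurable.indicator (by fun_prop) measurableSet_Ioo)]
        refine mul_le_mul_left ?_ _
        rw [← lintegral_indicator measurableSet_Ioo]
        exact setLIntegral_le_lintegral _ _
      _ = _ := by
        rw [setLIntegral_rpow_one_sub hγ hR, ← ENNReal.ofReal_mul (by
          have : 0 < γ + 1 := by linarith
          positivity)]
        congr 1
        rw [show γ + 2 = γ + 1 + 1 by ring, Real.rpow_add_one hR.ne' (γ + 1)]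
        ring
  · exact ((by fun_prop : Measurable fun q : ℝ × ℝ => ENNReal.ofReal q.1).smul
      (hF.comp hP)).aemeasurable

lemma lintegral_Ioi_mul_rpow {c a : ℝ} (hc : 0 < c) (ha : 0 < a) :
    ∫⁻ s in Ioi a, ENNReal.ofReal (s ^ (-c - 1)) = ENNReal.ofReal (a ^ (-c) / c) := by
  rw [← ofReal_integral_eq_lintegral_ofReal (integrableOn_Ioi_rpow_of_lt (by linarith) ha),
    integral_Ioi_rpow_of_lt (by linarith) ha]
  · congr 1
    rw [sub_add_cancel, neg_div_neg_eq]
  · filter_upwards [ae_restrict_mem measurableSet_Ioi] with s hs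
    exact Real.rpow_nonneg (ha.trans hs).le _

/-- A polynomial bound for the distribution function of `ρ` gives a bound for the negative moments
of `ε + ρ`. -/
lemma lintegral_add_rpow_neg_le {X : Type*} [MeasurableSpace X] {ν : Measure X} [SFinite ν]
    {ρ : X → ℝ} (hρ : Measurable ρ) (hρ0 : ∀ᵐ x ∂ν, 0 ≤ ρ x) {K : ℝ≥0∞} {c d ε : ℝ}
    (hd : 0 ≤ d) (hc : d < c) (hε : 0 < ε)
    (hν : ∀ s : ℝ, 0 < s → ν {x | ρ x < s} ≤ K * ENNReal.ofReal (s ^ d)) :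
    ∫⁻ x, ENNReal.ofReal ((ε + ρ x) ^ (-c)) ∂ν ≤
      K * ENNReal.ofReal (c / (c - d) * ε ^ (d - c)) := by
  have hc0 : 0 < c := by linarith
  have hcd : 0 < c - d := by linarith
  have hm : Measurable (Function.uncurry fun (x : X) (s : ℝ) =>
      {q : X × ℝ | ρ q.1 < q.2 - ε}.indicator
        (fun q : X × ℝ => ENNReal.ofReal (c * q.2 ^ (-c - 1))) (x, s)) := by
    refine Measurable.indicator (by fun_prop) ?_
    exact measurableSet_lt (by fun_prop) (by fun_prop)
  calc _ ≤ ∫⁻ x, (∫⁻ s in Ioi ε, {q : X × ℝ | ρ q.1 < q.2 - ε}.indicator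
        (fun q : X × ℝ => ENNReal.ofReal (c * q.2 ^ (-c - 1))) (x, s)) ∂ν := by
        refine lintegral_mono_ae ?_
        filter_upwards [hρ0] with x hx
        -- Layer cake: the negative power is the integral of c s^(-c-1) over s > ε + ρ(x), so after
        -- the swap only the distribution function of ρ enters.
        have h1 : ENNReal.ofReal ((ε + ρ x) ^ (-c)) =
            ∫⁻ s in Ioi (ε + ρ x), ENNReal.ofReal (c * s ^ (-c - 1)) := by
          simp_rw [ENNReal.ofReal_mul hc0.le]
          rw [lintegral_const_mul _ (by fun_prop), lintegral_Ioi_mul_rpow hc0 (by linarith),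
            ← ENNReal.ofReal_mul hc0.le]
          congr 1
          field_simp
        rw [h1, ← lintegral_indicator measurableSet_Ioi, ← lintegral_indicator measurableSet_Ioi]
        refine lintegral_mono fun s => ?_
        by_cases hs : ε + ρ x < s
        · rw [indicator_of_mem (show s ∈ Ioi (ε + ρ x) from hs), indicator_of_mem
            (show s ∈ Ioi ε from lt_of_le_of_lt (by linarith) hs), indicator_of_mem]
          show ρ x < s - ε
          linarith
        · rw [indicator_of_notMem (show s ∉ Ioi (ε + ρ x) from hs)]
          exact zero_le
    _ = ∫⁻ s in Ioi ε, ENNReal.ofReal (c * s ^ (-c - 1)) * ν {x | ρ x < s - ε} := by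
        rw [lintegral_lintegral_swap hm.aemeasurable]
        refine lintegral_congr fun s => ?_
        rw [← lintegral_indicator_const (measurableSet_lt hρ measurable_const)]
        rfl
    _ ≤ ∫⁻ s in Ioi ε, K * (ENNReal.ofReal c * ENNReal.ofReal (s ^ (-(c - d) - 1))) := by
        refine setLIntegral_mono' measurableSet_Ioi fun s hs => ?_
        replace hs : ε < s := hs
        have hs0 : 0 < s := hε.trans hs
        calc _ ≤ ENNReal.ofReal (c * s ^ (-c - 1)) * (K * ENNReal.ofReal (s ^ d)) := by
              gcongr
              refine (measure_mono ?_).trans (hν s hs0)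
              intro x hx
              exact lt_trans (show ρ x < s - ε from hx) (by linarith)
          _ = _ := by
              rw [mul_left_comm, ENNReal.ofReal_mul hc0.le, mul_assoc,
                ← ENNReal.ofReal_mul (by positivity), ← Real.rpow_add hs0]
              congr 4; ring_nf
    _ = _ := by
        rw [lintegral_const_mul _ (by fun_prop), lintegral_const_mul _ (by fun_prop),
          lintegral_Ioi_mul_rpow hcd hε, ← ENNReal.ofReal_mul hc0.le]
        congr 2
        rw [neg_sub]; ring

/-- Jensen's inequality for powers. -/
lemma lintegral_rpow_le_measure_univ_mul {X : Type*} [MeasurableSpace X] (ν : Measure X)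
    {p : ℝ} (hp : 1 ≤ p) {g : X → ℝ≥0∞} (hg : AEMeasurable g ν) :
    (∫⁻ x, g x ∂ν) ^ p ≤ ν univ ^ (p - 1) * ∫⁻ x, g x ^ p ∂ν := by
  have hp0 : 0 < p := by linarith
  have h := eLpNorm'_le_eLpNorm'_mul_rpow_measure_univ (μ := ν) one_pos hp hg.aestronglyMeasurable
  simp only [eLpNorm', enorm_eq_self, ENNReal.rpow_one, one_div, inv_one] at h
  calc _ ≤ ((∫⁻ x, g x ^ p ∂ν) ^ p⁻¹ * ν univ ^ (1 - p⁻¹)) ^ p := by gcongr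
    _ = _ := by
        rw [ENNReal.mul_rpow_of_nonneg _ _ hp0.le, ← ENNReal.rpow_mul, ← ENNReal.rpow_mul,
          inv_mul_cancel₀ hp0.ne', ENNReal.rpow_one, mul_comm, sub_mul, inv_mul_cancel₀ hp0.ne',
          one_mul]

end TentSpace

/-! ### Sub-mean value inequalities and Montel's theorem. -/

namespace TentSpace

/-- Cauchy's mean value formula, with the angles moved to (-π, π) to match the target of polar
coordinates. -/
lemma enorm_mul_two_pi_le_lintegral_circle {f : ℂ → ℂ} {c : ℂ} {R r : ℝ} (hr : 0 < r) (hrR : r < R)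
    (hf : DifferentiableOn ℂ f (ball c R)) :
    ‖f c‖ₑ * ENNReal.ofReal (2 * Real.pi) ≤
      ∫⁻ φ in Ioo (-Real.pi) Real.pi, ‖f (c + Complex.polarCoord.symm (r, φ))‖ₑ := by
  have hπ := Real.pi_pos
  have hsub : closedBall c |r| ⊆ ball c R := by
    rw [abs_of_pos hr]; exact closedBall_subset_ball hrR
  have hd : DiffContOnCl ℂ f (ball c |r|) :=
    (hf.mono ((closure_ball_subset_closedBall).trans hsub)).diffContOnCl
  have h := hd.circleAverage
  rw [Real.circleAverage_eq_integral_add (-Real.pi)] at h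
  have h2 : ∫ θ in (0 : ℝ)..2 * Real.pi, f (circleMap c r (θ + -Real.pi)) =
      ∫ θ in (-Real.pi)..Real.pi, f (circleMap c r θ) := by
    rw [intervalIntegral.integral_comp_add_right (fun θ => f (circleMap c r θ))]
    congr 1 <;> ring
  rw [h2, intervalIntegral.integral_of_le (by linarith)] at h
  have h3 : ((2 * Real.pi : ℝ)) • f c = ∫ θ in Ioc (-Real.pi) Real.pi, f (circleMap c r θ) := by
    rw [← h, smul_smul, mul_inv_cancel₀ (by positivity), one_smul]
  have h4 : ‖f c‖ₑ * ENNReal.ofReal (2 * Real.pi) = ‖(2 * Real.pi : ℝ) • f c‖ₑ := by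
    rw [enorm_smul, mul_comm, Real.enorm_of_nonneg (by positivity)]
  rw [h4, h3, Measure.restrict_congr_set (Ioo_ae_eq_Ioc (a := -Real.pi) (b := Real.pi)).symm]
  refine (enorm_integral_le_lintegral_enorm _).trans (le_of_eq ?_)
  refine lintegral_congr fun φ => ?_
  congr 3
  rw [circleMap, Complex.exp_mul_I]
  simp

lemma volume_ball_complex (c : ℂ) {R : ℝ} (hR : 0 ≤ R) :
    volume (ball c R) = ENNReal.ofReal (Real.pi * R ^ 2) := by
  rw [Complex.volume_ball, mul_comm, ENNReal.ofReal_mul Real.pi_pos.le, ENNReal.ofReal_pow hR]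
  congr 1
  rw [← ENNReal.ofReal_coe_nnreal, NNReal.coe_real_pi]

lemma measurable_indicator_of_continuousOn {g : ℂ → ℝ≥0∞} {s : Set ℂ} (hs : MeasurableSet s)
    (hg : ContinuousOn g s) : Measurable (s.indicator g) := by
  classical
  rw [← piecewise_eq_indicator]
  exact hg.measurable_piecewise continuousOn_const hs

/-- The circle inequality is integrated against r dr over 0 < r < R. -/
lemma enorm_mul_volume_le_lintegral {f : ℂ → ℂ} {c : ℂ} {R : ℝ} (hR : 0 < R)
    (hf : DifferentiableOn ℂ f (ball c R)) :
    ‖f c‖ₑ * ENNReal.ofReal (Real.pi * R ^ 2) ≤ ∫⁻ z in ball c R, ‖f z‖ₑ := by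
  have hm : Measurable ((ball c R).indicator fun z => ‖f z‖ₑ) :=
    measurable_indicator_of_continuousOn measurableSet_ball hf.continuousOn.enorm
  have hP : Measurable fun q : ℝ × ℝ => c + Complex.polarCoord.symm q := by
    simp only [Complex.polarCoord_symm_apply]
    fun_prop
  rw [← lintegral_indicator measurableSet_ball, ← lintegral_add_left_eq_self _ c,
    ← Complex.lintegral_comp_polarCoord_symm, polarCoord_target, Measure.volume_eq_prod,
    setLIntegral_prod]
  · calc
      _ = ∫⁻ r in Ioo 0 R, ENNReal.ofReal r * (‖f c‖ₑ * ENNReal.ofReal (2 * Real.pi)) := by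
        rw [lintegral_mul_const _ (by fun_prop), ← Measure.restrict_congr_set Ioo_ae_eq_Ioc.symm,
          ← ofReal_integral_eq_lintegral_ofReal, ← intervalIntegral.integral_of_le hR.le,
          integral_id, mul_left_comm, ← ENNReal.ofReal_mul]
        · congr 2; ring
        · nlinarith
        · exact (intervalIntegrable_iff_integrableOn_Ioc_of_le hR.le).1
            intervalIntegral.intervalIntegrable_id
        · filter_upwards [ae_restrict_mem measurableSet_Ioc] with x hx using hx.1.le
      _ ≤ ∫⁻ r in Ioo 0 R, ∫⁻ φ in Ioo (-Real.pi) Real.pi, ENNReal.ofReal (r, φ).1 •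
          (ball c R).indicator (fun z => ‖f z‖ₑ) (c + Complex.polarCoord.symm (r, φ)) := by
        refine setLIntegral_mono' measurableSet_Ioo fun r hr => ?_
        simp only [smul_eq_mul]
        rw [lintegral_const_mul' _ _ ENNReal.ofReal_ne_top]
        gcongr
        refine (enorm_mul_two_pi_le_lintegral_circle hr.1 hr.2 hf).trans (le_of_eq ?_)
        refine lintegral_congr fun φ => ?_
        rw [indicator_of_mem]
        rw [mem_ball, dist_eq_norm, add_sub_cancel_left, Complex.norm_polarCoord_symm]
        simpa [abs_of_pos hr.1] using hr.2
      _ ≤ _ := lintegral_mono_set Ioo_subset_Ioi_self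
  · exact ((by fun_prop : Measurable fun q : ℝ × ℝ => ENNReal.ofReal q.1).smul
      (hm.comp hP)).aemeasurable

/-- The sub-mean value property of `|f|^p`. -/
lemma enorm_rpow_mul_volume_le_lintegral {f : ℂ → ℂ} {c : ℂ} {R p : ℝ} (hp : 1 ≤ p) (hR : 0 < R)
    (hf : DifferentiableOn ℂ f (ball c R)) :
    ‖f c‖ₑ ^ p * ENNReal.ofReal (Real.pi * R ^ 2) ≤ ∫⁻ z in ball c R, ‖f z‖ₑ ^ p := by
  have hp0 : 0 < p := by linarith
  have hV : 0 < Real.pi * R ^ 2 := by positivity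
  set V := ENNReal.ofReal (Real.pi * R ^ 2) with hVdef
  have hV0 : V ≠ 0 := by simpa [hVdef] using hV
  have hVt : V ≠ ∞ := ENNReal.ofReal_ne_top
  have h1 := enorm_mul_volume_le_lintegral hR hf
  have h2 := lintegral_rpow_le_measure_univ_mul (volume.restrict (ball c R)) hp
    (hf.continuousOn.enorm.aemeasurable measurableSet_ball)
  rw [Measure.restrict_apply_univ, volume_ball_complex c hR.le] at h2
  have h3 : ‖f c‖ₑ ^ p * V ^ p ≤ V ^ (p - 1) * ∫⁻ z in ball c R, ‖f z‖ₑ ^ p := by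
    rw [← ENNReal.mul_rpow_of_nonneg _ _ hp0.le]
    exact (ENNReal.rpow_le_rpow h1 hp0.le).trans h2
  have h4 : V ^ p = V ^ (p - 1) * V := by
    have := ENNReal.rpow_add (p - 1) 1 hV0 hVt
    rwa [sub_add_cancel, ENNReal.rpow_one] at this
  rw [h4, mul_left_comm] at h3
  exact (ENNReal.mul_le_mul_iff_right (ENNReal.rpow_pos (pos_iff_ne_zero.2 hV0) hVt).ne'
    (ENNReal.rpow_ne_top_of_nonneg (by linarith) hVt)).1 h3

/-- Cauchy's estimates on the circle of radius 1/2 place the coefficient sequences in a product of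
closed discs. Sequential compactness of this product takes the place of a diagonal argument. -/
lemma exists_taylor_subseq {f : ℕ → ℂ → ℂ} {B : ℝ → ℝ}
    (hf : ∀ n, DifferentiableOn ℂ (f n) (ball 0 1))
    (hB : ∀ r : ℝ, 0 < r → r < 1 → ∀ n, ∀ z : ℂ, ‖z‖ ≤ r → ‖f n z‖ ≤ B r) :
    ∃ φ : ℕ → ℕ, StrictMono φ ∧ ∃ a : ℕ → ℂ, ∀ k, Tendsto
      (fun n => (k.factorial : ℂ)⁻¹ * iteratedDeriv k (f (φ n)) 0) atTop (𝓝 (a k)) := by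
  have hbd : ∀ n k, ‖(k.factorial : ℂ)⁻¹ * iteratedDeriv k (f n) 0‖ ≤ B (1 / 2) / (1 / 2) ^ k := by
    intro n k
    have hd : DiffContOnCl ℂ (f n) (ball 0 (1 / 2)) :=
      ((hf n).mono (closure_ball_subset_closedBall.trans
        (closedBall_subset_ball (by norm_num)))).diffContOnCl
    have h := Complex.norm_iteratedDeriv_le_of_forall_mem_sphere_norm_le k (by norm_num) hd
      (C := B (1 / 2)) fun z hz => hB _ (by norm_num) (by norm_num) n z (by simpa using hz.le)
    rw [norm_mul, norm_inv, Complex.norm_natCast]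
    have hk : (0 : ℝ) < k.factorial := by positivity
    calc _ ≤ (k.factorial : ℝ)⁻¹ * (k.factorial * B (1 / 2) / (1 / 2) ^ k) := by gcongr
      _ = _ := by field_simp
  have hc : IsCompact (univ.pi fun k : ℕ => closedBall (0 : ℂ) (B (1 / 2) / (1 / 2) ^ k)) :=
    isCompact_univ_pi fun k => isCompact_closedBall _ _
  obtain ⟨a, -, φ, hφ, ha⟩ := hc.tendsto_subseq
    (x := fun n k => (k.factorial : ℂ)⁻¹ * iteratedDeriv k (f n) 0)
    (fun n k _ => by simpa using hbd n k)
  exact ⟨φ, hφ, a, fun k => (tendsto_pi_nhds.1 ha) k⟩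

/-- Montel's theorem in the unit disk. -/
lemma exists_subseq_tendstoUniformlyOn_closedBall {f : ℕ → ℂ → ℂ} {B : ℝ → ℝ}
    (hf : ∀ n, DifferentiableOn ℂ (f n) (ball 0 1))
    (hB : ∀ r : ℝ, 0 < r → r < 1 → ∀ n, ∀ z : ℂ, ‖z‖ ≤ r → ‖f n z‖ ≤ B r) :
    ∃ φ : ℕ → ℕ, StrictMono φ ∧ ∃ g : ℂ → ℂ, DifferentiableOn ℂ g (ball 0 1) ∧
      ∀ r < 1, TendstoUniformlyOn (fun n => f (φ n)) g atTop (closedBall 0 r) := by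
  obtain ⟨φ, hφ, a, ha⟩ := exists_taylor_subseq hf hB
  refine ⟨φ, hφ, fun z => ∑' k, a k * z ^ k, ?_⟩
  have hU : ∀ r < 1, TendstoUniformlyOn (fun n => f (φ n)) (fun z => ∑' k, a k * z ^ k) atTop
      (closedBall 0 r) := by
    intro r hr
    wlog hr0 : 0 < r generalizing r
    · exact (this (1 / 2) (by norm_num) (by norm_num)).mono
        (closedBall_subset_closedBall (by linarith))
    obtain ⟨s, hrs, hs1⟩ := exists_between hr
    have hs0 : 0 < s := by linarith
    set c : ℕ → ℕ → ℂ := fun n k => (k.factorial : ℂ)⁻¹ * iteratedDeriv k (f (φ n)) 0 with hcdef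
    have hbd : ∀ n k, ‖c n k‖ ≤ B s / s ^ k := by
      intro n k
      have hd : DiffContOnCl ℂ (f (φ n)) (ball 0 s) :=
        ((hf (φ n)).mono (closure_ball_subset_closedBall.trans
          (closedBall_subset_ball hs1))).diffContOnCl
      have h := Complex.norm_iteratedDeriv_le_of_forall_mem_sphere_norm_le k hs0 hd
        (C := B s) fun z hz => hB _ hs0 hs1 _ z (by simpa using hz.le)
      rw [norm_mul, norm_inv, Complex.norm_natCast]
      have hk : (0 : ℝ) < k.factorial := by positivity
      calc _ ≤ (k.factorial : ℝ)⁻¹ * (k.factorial * B s / s ^ k) := by gcongr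
        _ = _ := by field_simp
    have hbda : ∀ k, ‖a k‖ ≤ B s / s ^ k := fun k =>
      le_of_tendsto (ha k).norm (Eventually.of_forall fun n => hbd n k)
    -- Cauchy's estimates at a radius s with r < s < 1 give a geometric majorant independent of n.
    -- Dominated convergence for series then turns convergence of each coefficient into uniform
    -- convergence on |z| ≤ r.
    have hgeo : Summable fun k : ℕ => (2 * B s) * (r / s) ^ k :=
      (summable_geometric_of_lt_one (by positivity) ((div_lt_one hs0).2 hrs)).mul_left _
    have hle : ∀ n k, ‖c n k - a k‖ * r ^ k ≤ (2 * B s) * (r / s) ^ k := by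
      intro n k
      calc _ ≤ (B s / s ^ k + B s / s ^ k) * r ^ k := by
            gcongr
            exact (norm_sub_le _ _).trans (add_le_add (hbd n k) (hbda k))
        _ = _ := by rw [div_pow]; ring
    have hsum : ∀ n, Summable fun k => ‖c n k - a k‖ * r ^ k := fun n =>
      Summable.of_nonneg_of_le (fun k => by positivity) (hle n) hgeo
    have htan : Tendsto (fun n => ∑' k, ‖c n k - a k‖ * r ^ k) atTop (𝓝 (∑' _ : ℕ, (0 : ℝ))) := by
      refine tendsto_tsum_of_dominated_convergence hgeo (fun k => ?_)
        (Eventually.of_forall fun n k => ?_)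
      · have := ((ha k).sub_const (a k)).norm.mul_const (r ^ k)
        simpa using this
      · rw [Real.norm_of_nonneg (by positivity)]
        exact hle n k
    rw [tsum_zero] at htan
    rw [Metric.tendstoUniformlyOn_iff]
    intro ε hε
    filter_upwards [htan.eventually_lt_const hε] with n hn z hz
    have hz' : ‖z‖ ≤ r := by simpa using hz
    have h1 : HasSum (fun k => c n k * z ^ k) (f (φ n) z) := by
      have e : (fun k => c n k * z ^ k) = fun k : ℕ =>
          (k.factorial : ℂ)⁻¹ • (z - 0) ^ k • iteratedDeriv k (f (φ n)) 0 := by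
        funext k
        simp only [hcdef, sub_zero, smul_eq_mul]
        ring
      rw [e]
      exact Complex.hasSum_taylorSeries_on_ball (hf (φ n))
        (show z ∈ ball (0 : ℂ) 1 by simpa using hz'.trans_lt hr)
    have h2 : Summable fun k => a k * z ^ k := by
      refine Summable.of_norm_bounded (g := fun k : ℕ => B s * (r / s) ^ k)
        ((summable_geometric_of_lt_one (by positivity) ((div_lt_one hs0).2 hrs)).mul_left _)
        fun k => ?_
      rw [norm_mul, norm_pow]
      calc _ ≤ B s / s ^ k * r ^ k := by
            exact mul_le_mul (hbda k) (by gcongr) (by positivity)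
              ((norm_nonneg _).trans (hbda k))
        _ = _ := by rw [div_pow]; ring
    rw [dist_comm, dist_eq_norm, ← h1.tsum_eq, ← h1.summable.tsum_sub h2]
    refine lt_of_le_of_lt ?_ hn
    refine tsum_of_norm_bounded (hsum n).hasSum fun k => ?_
    rw [← sub_mul, norm_mul, norm_pow]
    gcongr
  refine ⟨?_, hU⟩
  refine TendstoLocallyUniformlyOn.differentiableOn (F := fun n => f (φ n)) (φ := atTop) ?_
    (Eventually.of_forall fun n => hf (φ n)) isOpen_ball
  rw [tendstoLocallyUniformlyOn_iff_forall_isCompact isOpen_ball]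
  intro K hK hKc
  rcases K.eq_empty_or_nonempty with rfl | hne
  · exact tendstoUniformlyOn_empty
  obtain ⟨w, hw, hmax⟩ := hKc.exists_isMaxOn hne continuous_norm.continuousOn
  refine (hU ‖w‖ (by simpa using hK hw)).mono fun z hz => ?_
  simpa using hmax hz

end TentSpace

/-! ### Windows at the boundary: pointwise growth and box averages. -/

namespace TentSpace

lemma rpow_le_two_rpow_abs_mul {x v a : ℝ} (hx : 0 < x) (h1 : x / 2 ≤ v) (h2 : v ≤ 2 * x) :
    v ^ a ≤ 2 ^ |a| * x ^ a := by
  have hv : 0 < v := by linarith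
  rcases le_total 0 a with ha | ha
  · rw [abs_of_nonneg ha, ← Real.mul_rpow (by norm_num) hx.le]
    exact Real.rpow_le_rpow hv.le h2 ha
  · rw [abs_of_nonpos ha, Real.rpow_neg (by norm_num), ← Real.inv_rpow (by norm_num),
      ← Real.mul_rpow (by norm_num) hx.le]
    exact Real.rpow_le_rpow_of_nonpos (by positivity) (by linarith) ha

/-- The measure with density `(1 - |z|)^γ` on the unit disk has growth `M` for `|f|^p` on disks
centred on the unit circle. -/
def HasTentBound (p α : ℝ) (f : ℂ → ℂ) (M : ℝ≥0∞) : Prop :=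
  ∀ ω : ℂ, ‖ω‖ = 1 → ∀ R : ℝ, 0 < R →
    ∫⁻ z in ball 0 1 ∩ ball ω R, ‖f z‖ₑ ^ p * ENNReal.ofReal ((1 - ‖z‖) ^ (α + 1)) ≤
      M * ENNReal.ofReal R

lemma one_sub_norm_comparable {z w : ℂ} (hw : w ∈ ball z ((1 - ‖z‖) / 2)) :
    (1 - ‖z‖) / 2 ≤ 1 - ‖w‖ ∧ 1 - ‖w‖ ≤ 3 / 2 * (1 - ‖z‖) := by
  rw [mem_ball, dist_eq_norm] at hw
  have h := abs_le.1 (abs_norm_sub_norm_le w z)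
  constructor <;> linarith [h.1, h.2]

/-- Sub-mean value inequality on the disc of radius (1-|z|)/2, where the weight (1-|w|)^a varies by
a bounded factor. The exponent a is left free: it is α+1 for the growth estimate and α-1-β in the
Fubini argument. -/
lemma enorm_rpow_le_mul_setLIntegral {p a : ℝ} (hp : 1 ≤ p) {f : ℂ → ℂ}
    (hf : DifferentiableOn ℂ f (ball 0 1)) {z : ℂ} (hz : ‖z‖ < 1) :
    ‖f z‖ₑ ^ p ≤ ENNReal.ofReal (4 / Real.pi * 2 ^ |a| * (1 - ‖z‖) ^ (-a - 2)) *
      ∫⁻ w in ball z ((1 - ‖z‖) / 2), ‖f w‖ₑ ^ p * ENNReal.ofReal ((1 - ‖w‖) ^ a) := by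
  have hπ := Real.pi_pos
  set x := 1 - ‖z‖ with hx
  have hx0 : 0 < x := by linarith
  have hsub : ball z (x / 2) ⊆ ball 0 1 := by
    intro w hw
    have := (one_sub_norm_comparable hw).1
    rw [mem_ball_zero_iff]; linarith
  have h1 := enorm_rpow_mul_volume_le_lintegral hp (by positivity) (hf.mono hsub)
  have h2 : ∫⁻ w in ball z (x / 2), ‖f w‖ₑ ^ p ≤ ENNReal.ofReal (2 ^ |a| * x ^ (-a)) *
      ∫⁻ w in ball z (x / 2), ‖f w‖ₑ ^ p * ENNReal.ofReal ((1 - ‖w‖) ^ a) := by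
    rw [← lintegral_const_mul' _ _ ENNReal.ofReal_ne_top]
    refine setLIntegral_mono' measurableSet_ball fun w hw => ?_
    obtain ⟨h3, h4⟩ := one_sub_norm_comparable hw
    rw [mul_left_comm, ← ENNReal.ofReal_mul (by positivity)]
    refine le_mul_of_one_le_right' ?_
    rw [ENNReal.one_le_ofReal]
    have hv : 0 < 1 - ‖w‖ := by linarith
    have h5 := rpow_le_two_rpow_abs_mul (a := a) hv (v := x) (by linarith) (by linarith)
    rw [Real.rpow_neg hx0.le]
    have : 0 < x ^ a := by positivity
    calc (1 : ℝ) = (x ^ a)⁻¹ * x ^ a := by field_simp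
      _ ≤ (x ^ a)⁻¹ * (2 ^ |a| * (1 - ‖w‖) ^ a) := by gcongr
      _ = _ := by ring
  have h3 := h1.trans h2
  have hV : 0 < Real.pi * (x / 2) ^ 2 := by positivity
  calc ‖f z‖ₑ ^ p = ENNReal.ofReal ((Real.pi * (x / 2) ^ 2)⁻¹) *
        (‖f z‖ₑ ^ p * ENNReal.ofReal (Real.pi * (x / 2) ^ 2)) := by
        rw [mul_left_comm, ← ENNReal.ofReal_mul (by positivity), inv_mul_cancel₀ hV.ne',
          ENNReal.ofReal_one, mul_one]
    _ ≤ ENNReal.ofReal ((Real.pi * (x / 2) ^ 2)⁻¹) * (ENNReal.ofReal (2 ^ |a| * x ^ (-a)) *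
        ∫⁻ w in ball z (x / 2), ‖f w‖ₑ ^ p * ENNReal.ofReal ((1 - ‖w‖) ^ a)) := by
        gcongr ENNReal.ofReal _ * ?_
    _ = _ := by
        rw [← mul_assoc, ← ENNReal.ofReal_mul (by positivity)]
        congr 2
        rw [Real.rpow_sub hx0, Real.rpow_two]
        field_simp
        norm_num

/-- The disc of radius (1-|z|)/2 about z lies within 2(1-|z|) of a nearest boundary point, so its
mass is at most 2M(1-|z|). -/
lemma HasTentBound.enorm_rpow_le {p α : ℝ} (hp : 1 ≤ p) {f : ℂ → ℂ} {M : ℝ≥0∞}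
    (hM : HasTentBound p α f M) (hf : DifferentiableOn ℂ f (ball 0 1)) {z : ℂ} (hz : ‖z‖ < 1) :
    ‖f z‖ₑ ^ p ≤
      M * ENNReal.ofReal (8 / Real.pi * 2 ^ |α + 1| * (1 - ‖z‖) ^ (-(α + 2))) := by
  have hπ := Real.pi_pos
  have h := enorm_rpow_le_mul_setLIntegral (a := α + 1) hp hf hz
  set x := 1 - ‖z‖ with hx
  have hx0 : 0 < x := by linarith
  obtain ⟨ω, hω, hzω⟩ : ∃ ω : ℂ, ‖ω‖ = 1 ∧ ‖z - ω‖ ≤ x := by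
    refine ⟨Complex.exp (z.arg * Complex.I), Complex.norm_exp_ofReal_mul_I _, ?_⟩
    have e : z - Complex.exp (z.arg * Complex.I) =
        ((‖z‖ - 1 : ℝ) : ℂ) * Complex.exp (z.arg * Complex.I) := by
      nth_rewrite 1 [← Complex.norm_mul_exp_arg_mul_I z]
      push_cast; ring
    rw [e, norm_mul, Complex.norm_exp_ofReal_mul_I, Complex.norm_real, Real.norm_eq_abs,
      abs_sub_comm, mul_one, abs_of_pos hx0]
  refine h.trans ?_
  calc _ ≤ ENNReal.ofReal (4 / Real.pi * 2 ^ |α + 1| * x ^ (-(α + 1) - 2)) *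
        (M * ENNReal.ofReal (2 * x)) := by
        gcongr
        refine (lintegral_mono_set ?_).trans (hM ω hω (2 * x) (by positivity))
        intro w hw
        have h1 := (one_sub_norm_comparable hw).1
        refine ⟨by rw [mem_ball_zero_iff]; linarith, ?_⟩
        rw [mem_ball, dist_eq_norm] at hw ⊢
        have := norm_sub_le_norm_sub_add_norm_sub w z ω
        linarith
    _ = _ := by
        rw [mul_left_comm, ← ENNReal.ofReal_mul (by positivity)]
        congr 2
        rw [show -(α + 1) - 2 = -(α + 2) - 1 by ring, Real.rpow_sub_one hx0.ne']
        field_simp; ring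

/-- The norm uses the weight 1-|z|², the window bounds use 1-|z|; the two differ by a factor between
1 and 2. -/
lemma one_sub_sq_rpow_le {r a : ℝ} (h0 : 0 ≤ r) (h1 : r < 1) :
    (1 - r ^ 2) ^ a ≤ 2 ^ |a| * (1 - r) ^ a :=
  rpow_le_two_rpow_abs_mul (by linarith) (by nlinarith) (by nlinarith)

lemma one_sub_rpow_le {r a : ℝ} (h0 : 0 ≤ r) (h1 : r < 1) :
    (1 - r) ^ a ≤ 2 ^ |a| * (1 - r ^ 2) ^ a :=
  rpow_le_two_rpow_abs_mul (by nlinarith) (by nlinarith) (by nlinarith)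

lemma setLIntegral_area (s : Set ℂ) (F : ℂ → ℝ≥0∞) :
    ∫⁻ z in s, F z ∂area = ENNReal.ofReal Real.pi⁻¹ * ∫⁻ z in s, F z := by
  rw [area, Measure.restrict_smul, lintegral_smul_measure, smul_eq_mul]

/-- A point of S(u) differs from u/|u| by at most 1-|u| radially and by at most half of that along
the circle. The factor 3 also covers u = 0, where the disc lies within 2 of the point 1. -/
lemma carlesonBox_subset_ball (u : ℂ) (hu : ‖u‖ < 1) :
    ∃ ω : ℂ, ‖ω‖ = 1 ∧ carlesonBox u ⊆ ball 0 1 ∩ ball ω (3 * (1 - ‖u‖)) := by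
  rcases eq_or_ne u 0 with rfl | hu0
  · refine ⟨1, by simp, fun z hz => ⟨carlesonBox_subset _ hz, ?_⟩⟩
    rw [mem_ball, dist_eq_norm]
    have := norm_sub_le z 1
    simp only [norm_one, norm_zero] at *
    linarith [hz.1]
  · have hun : 0 < ‖u‖ := norm_pos_iff.2 hu0
    refine ⟨u / ‖u‖, by simp [hun.ne'], fun z hz => ⟨carlesonBox_subset _ hz, ?_⟩⟩
    obtain ⟨hz1, h | ⟨θ, t, h1, h2, h3, h4⟩⟩ := hz
    · exact absurd h hu0
    have e1 : u / ‖u‖ = Complex.exp (θ * Complex.I) := by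
      rw [div_eq_iff (by exact_mod_cast hun.ne'), mul_comm]; exact h1
    have e2 : z - u / ‖u‖ = ((‖z‖ - 1 : ℝ) : ℂ) * Complex.exp (t * Complex.I) +
        Complex.exp (θ * Complex.I) * (Complex.exp (Complex.I * (t - θ : ℝ)) - 1) := by
      rw [e1, mul_sub, ← Complex.exp_add]
      conv_lhs => rw [h2]
      push_cast
      rw [show θ * Complex.I + Complex.I * (t - θ) = t * Complex.I by ring]
      ring
    rw [mem_ball, dist_eq_norm, e2]
    refine (norm_add_le _ _).trans_lt ?_
    rw [norm_mul, norm_mul, Complex.norm_exp_ofReal_mul_I, Complex.norm_exp_ofReal_mul_I,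
      Complex.norm_real, Real.norm_eq_abs, abs_sub_comm, abs_of_pos (by linarith : 0 < 1 - ‖z‖)]
    have := Real.norm_exp_I_mul_ofReal_sub_one_le (x := t - θ)
    rw [Real.norm_eq_abs] at this
    linarith

lemma HasTentBound.boxAverage_le {p α : ℝ} {f : ℂ → ℂ} {M : ℝ≥0∞}
    (hM : HasTentBound p α f M) {u : ℂ} (hu : ‖u‖ < 1) :
    boxAverage p α f u ≤ ENNReal.ofReal (3 * 2 ^ |α + 1|) * M := by
  have hπ := Real.pi_pos
  obtain ⟨ω, hω, hsub⟩ := carlesonBox_subset_ball u hu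
  have hh : 0 < 1 - ‖u‖ := by linarith
  rw [boxAverage, ENNReal.inv_mul_le_iff (by
    rw [Ne, ENNReal.ofReal_eq_zero, not_le]; nlinarith [norm_nonneg u]) ENNReal.ofReal_ne_top]
  calc _ ≤ ∫⁻ z in ball 0 1 ∩ ball ω (3 * (1 - ‖u‖)),
        ‖f z‖ₑ ^ p * ENNReal.ofReal ((1 - ‖z‖ ^ 2) ^ (α + 1)) ∂area := lintegral_mono_set hsub
    _ ≤ 1 * ∫⁻ z in ball 0 1 ∩ ball ω (3 * (1 - ‖u‖)), ENNReal.ofReal (2 ^ |α + 1|) *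
        (‖f z‖ₑ ^ p * ENNReal.ofReal ((1 - ‖z‖) ^ (α + 1))) := by
        rw [setLIntegral_area]
        gcongr ?_ * ?_
        · rw [ENNReal.ofReal_le_one]
          exact inv_le_one_of_one_le₀ (by linarith [Real.pi_gt_three])
        · refine setLIntegral_mono' (measurableSet_ball.inter measurableSet_ball) fun z hz => ?_
          rw [mul_left_comm, ← ENNReal.ofReal_mul (by positivity)]
          gcongr
          exact one_sub_sq_rpow_le (norm_nonneg z) (by simpa using hz.1)
    _ ≤ ENNReal.ofReal (2 ^ |α + 1|) * (M * ENNReal.ofReal (3 * (1 - ‖u‖))) := by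
        rw [one_mul, lintegral_const_mul' _ _ ENNReal.ofReal_ne_top]
        gcongr
        exact hM ω hω _ (by positivity)
    _ ≤ _ := by
        rw [mul_comm M, ← mul_assoc, ← mul_assoc, ← ENNReal.ofReal_mul (by positivity),
          ← ENNReal.ofReal_mul (by nlinarith [norm_nonneg u])]
        gcongr ENNReal.ofReal ?_ * M
        have : 0 < (2 : ℝ) ^ |α + 1| := by positivity
        nlinarith [mul_nonneg (norm_nonneg u) hh.le, mul_nonneg this.le
          (mul_nonneg (norm_nonneg u) hh.le)]

lemma HasTentBound.tentENorm_rpow_le {p α : ℝ} (ζ : ℝ) (hp : 1 ≤ p) {f : ℂ → ℂ} {M : ℝ≥0∞}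
    (hM : HasTentBound p α f M) :
    tentENorm p α ζ f ^ p ≤ ENNReal.ofReal (3 * 2 ^ |α + 1|) * M := by
  have hp0 : 0 < p := by linarith
  rw [tentENorm, ← ENNReal.rpow_mul, one_div, inv_mul_cancel₀ hp0.ne', ENNReal.rpow_one]
  refine essSup_le_of_ae_le _ (ae_of_all _ fun θ => ?_)
  exact iSup₂_le fun u hu => hM.boxAverage_le hu.1

end TentSpace

/-! ### The tent norm controls all windows at the boundary. -/

namespace TentSpace

/-- The hypothesis on ζ says that u lies in the approach region at u/|u|. This is an open condition
on the boundary point, so it also holds at some boundary point outside the null set ignored by the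
essential supremum. -/
lemma boxAverage_le_tentENorm_rpow {p α ζ : ℝ} (hp : 1 ≤ p) (f : ℂ → ℂ) {u : ℂ} (hu : ‖u‖ < 1)
    (hζ : 1 < ζ * (1 + ‖u‖)) : boxAverage p α f u ≤ tentENorm p α ζ f ^ p := by
  have hp0 : 0 < p := by linarith
  have hπ := Real.pi_pos
  rw [tentENorm, ← ENNReal.rpow_mul, one_div, inv_mul_cancel₀ hp0.ne', ENNReal.rpow_one]
  set O : Set ℝ := {θ | ‖u - Complex.exp (θ * Complex.I)‖ < ζ * (1 - ‖u‖ ^ 2)} with hO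
  have hOo : IsOpen O := isOpen_lt (by fun_prop) continuous_const
  have hmem : u.arg ∈ O := by
    have e : u - Complex.exp (u.arg * Complex.I) =
        ((‖u‖ - 1 : ℝ) : ℂ) * Complex.exp (u.arg * Complex.I) := by
      nth_rewrite 1 [← Complex.norm_mul_exp_arg_mul_I u]
      push_cast; ring
    rw [hO, mem_ofPred_eq, e, norm_mul, Complex.norm_exp_ofReal_mul_I, Complex.norm_real,
      Real.norm_eq_abs, abs_sub_comm, mul_one, abs_of_pos (by linarith)]
    nlinarith
  -- The argument of u may be the endpoint π, so a point of the open interval is found by closure.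
  have hne : (O ∩ Ioo (-Real.pi) Real.pi).Nonempty := by
    refine mem_closure_iff.1 ?_ O hOo hmem
    rw [closure_Ioo (by linarith)]
    exact ⟨(Complex.neg_pi_lt_arg u).le, Complex.arg_le_pi u⟩
  have hae := ENNReal.ae_le_essSup (μ := volume.restrict (Ioc (-Real.pi) Real.pi))
    (fun θ : ℝ => ⨆ v ∈ approachRegion ζ (Complex.exp (θ * Complex.I)), boxAverage p α f v)
  rw [ae_restrict_iff' measurableSet_Ioc] at hae
  obtain ⟨θ, hθ, hθ2⟩ := (Measure.dense_of_ae hae).inter_open_nonempty _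
    (hOo.inter isOpen_Ioo) hne
  refine le_trans ?_ (hθ2 (Ioo_subset_Ioc_self hθ.2))
  exact le_iSup₂_of_le (f := fun v _ => boxAverage p α f v) u ⟨hu, hθ.1⟩ le_rfl

lemma setLIntegral_carlesonBox_le {p α ζ : ℝ} (hp : 1 ≤ p) (f : ℂ → ℂ) {u : ℂ} (hu : ‖u‖ < 1)
    (hζ : 1 < ζ * (1 + ‖u‖)) :
    ∫⁻ z in carlesonBox u, ‖f z‖ₑ ^ p * ENNReal.ofReal ((1 - ‖z‖) ^ (α + 1)) ≤
      tentENorm p α ζ f ^ p * ENNReal.ofReal (2 * Real.pi * 2 ^ |α + 1| * (1 - ‖u‖)) := by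
  have hπ := Real.pi_pos
  have h := boxAverage_le_tentENorm_rpow (α := α) hp f hu hζ
  rw [boxAverage, ENNReal.inv_mul_le_iff (by
    rw [Ne, ENNReal.ofReal_eq_zero, not_le]; nlinarith [norm_nonneg u]) ENNReal.ofReal_ne_top,
    setLIntegral_area] at h
  calc _ ≤ ∫⁻ z in carlesonBox u, ENNReal.ofReal (2 ^ |α + 1|) *
        (‖f z‖ₑ ^ p * ENNReal.ofReal ((1 - ‖z‖ ^ 2) ^ (α + 1))) := by
        refine lintegral_mono_ae ?_
        have hae : ∀ᵐ z ∂(volume.restrict (carlesonBox u)), z ∈ ball (0 : ℂ) 1 :=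
          ae_mono (Measure.restrict_mono (carlesonBox_subset u) le_rfl)
            (ae_restrict_mem measurableSet_ball)
        filter_upwards [hae] with z hz
        rw [mul_left_comm, ← ENNReal.ofReal_mul (by positivity)]
        gcongr
        exact one_sub_rpow_le (norm_nonneg z) (by simpa using hz)
    _ = ENNReal.ofReal (2 ^ |α + 1| * Real.pi) * (ENNReal.ofReal Real.pi⁻¹ *
        ∫⁻ z in carlesonBox u, ‖f z‖ₑ ^ p * ENNReal.ofReal ((1 - ‖z‖ ^ 2) ^ (α + 1))) := by
        rw [lintegral_const_mul' _ _ ENNReal.ofReal_ne_top, ← mul_assoc,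
          ← ENNReal.ofReal_mul (by positivity), mul_assoc, mul_inv_cancel₀ hπ.ne', mul_one]
    _ ≤ ENNReal.ofReal (2 ^ |α + 1| * Real.pi) *
        (ENNReal.ofReal (1 - ‖u‖ ^ 2) * tentENorm p α ζ f ^ p) := by gcongr
    _ ≤ _ := by
        rw [← mul_assoc, mul_comm, ← ENNReal.ofReal_mul (by positivity)]
        gcongr _ * ENNReal.ofReal ?_
        have : 0 < 2 ^ |α + 1| * Real.pi := by positivity
        nlinarith [mul_nonneg this.le (sq_nonneg (1 - ‖u‖))]

lemma mem_carlesonBox {θ t h : ℝ} {z : ℂ} (h1 : h < 1) (hz : ‖z‖ < 1)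
    (hzh : 1 - ‖z‖ ≤ h) (hzt : z = ‖z‖ * Complex.exp (t * Complex.I)) (ht : |t - θ| ≤ h / 2) :
    z ∈ carlesonBox (((1 - h : ℝ) : ℂ) * Complex.exp (θ * Complex.I)) := by
  have hu : ‖((1 - h : ℝ) : ℂ) * Complex.exp (θ * Complex.I)‖ = 1 - h := by
    rw [norm_mul, Complex.norm_exp_ofReal_mul_I, Complex.norm_real, Real.norm_eq_abs, mul_one,
      abs_of_pos (by linarith)]
  refine ⟨hz, Or.inr ⟨θ, t, ?_, hzt, ?_, ?_⟩⟩ <;> rw [hu]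
  · simpa using ht
  · simpa using hzh

lemma norm_one_sub_mul_exp {θ h : ℝ} (h1 : h < 1) :
    ‖((1 - h : ℝ) : ℂ) * Complex.exp (θ * Complex.I)‖ = 1 - h := by
  rw [norm_mul, Complex.norm_exp_ofReal_mul_I, Complex.norm_real, Real.norm_eq_abs, mul_one,
      abs_of_pos (by linarith)]

/-- Jordan's inequality applied to sin(arg x) = Im x/|x|, with |x| > 7/8. -/
lemma abs_arg_le_of_norm_sub_one_lt {x : ℂ} {R : ℝ} (hR : R ≤ 1 / 8) (hx : ‖x - 1‖ < R) :
    |x.arg| ≤ 4 * R := by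
  have hR0 : 0 < R := (norm_nonneg _).trans_lt hx
  have hre : |x.re - 1| < R := by
    have := Complex.abs_re_le_norm (x - 1)
    simp only [Complex.sub_re, Complex.one_re] at this
    linarith
  have him : |x.im| < R := by
    have := Complex.abs_im_le_norm (x - 1)
    simp only [Complex.sub_im, Complex.one_im, sub_zero] at this
    linarith
  have hre0 : 7 / 8 < x.re := by linarith [(abs_lt.1 hre).1]
  have hn : 7 / 8 < ‖x‖ := hre0.trans_le (Complex.re_le_norm x)
  have hx0 : x ≠ 0 := by rintro rfl; norm_num at hn
  have h1 := Real.mul_abs_le_abs_sin (Complex.abs_arg_le_pi_div_two_iff.2 (by linarith : 0 ≤ x.re))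
  rw [Complex.sin_arg, abs_div, abs_norm] at h1
  have h2 : |x.im| / ‖x‖ ≤ R / (7 / 8) := by gcongr
  have h3 : 2 / Real.pi * |x.arg| ≤ R / (7 / 8) := h1.trans h2
  rw [div_mul_eq_mul_div, div_le_iff₀ Real.pi_pos] at h3
  nlinarith [Real.pi_lt_d2]

/-- The box of size h = 8R has angular half-width h/2 = 4R, which is the bound of
`abs_arg_le_of_norm_sub_one_lt` after rotating the centre to 1. -/
lemma ball_inter_ball_subset_carlesonBox {θ R : ℝ} (hR1 : 8 * R < 1) :
    ball 0 1 ∩ ball (Complex.exp (θ * Complex.I)) R ⊆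
      carlesonBox (((1 - 8 * R : ℝ) : ℂ) * Complex.exp (θ * Complex.I)) := by
  rintro z ⟨hz, hzR⟩
  rw [mem_ball_zero_iff] at hz
  rw [mem_ball, dist_eq_norm] at hzR
  have hzn : 1 - ‖z‖ < R := by
    have := norm_sub_norm_le (Complex.exp (θ * Complex.I)) z
    rw [Complex.norm_exp_ofReal_mul_I, norm_sub_rev] at this
    linarith
  set x := z * Complex.exp (-(θ * Complex.I)) with hx
  have hxz : x * Complex.exp (θ * Complex.I) = z := by
    rw [hx, mul_assoc, ← Complex.exp_add]; simp
  clear_value x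
  have hxn : ‖x‖ = ‖z‖ := by
    rw [← hxz, norm_mul, Complex.norm_exp_ofReal_mul_I, mul_one]
  have hx1 : ‖x - 1‖ < R := by
    have : z - Complex.exp (θ * Complex.I) = (x - 1) * Complex.exp (θ * Complex.I) := by
      rw [sub_mul, hxz, one_mul]
    rwa [this, norm_mul, Complex.norm_exp_ofReal_mul_I, mul_one] at hzR
  refine mem_carlesonBox (t := x.arg + θ) hR1 hz (by linarith) ?_ ?_
  · push_cast
    rw [add_mul, Complex.exp_add, ← mul_assoc, ← hxn, Complex.norm_mul_exp_arg_mul_I, hxz]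
  · rw [add_sub_cancel_right]
    exact (abs_arg_le_of_norm_sub_one_lt (by linarith) hx1).trans (by linarith)

/-- Boxes centred at the angles jh suffice: rounding arg(z)/h to an integer costs at most 1/2, hence
an angle at most h/2. -/
lemma exists_annulus_subset_biUnion_carlesonBox {h : ℝ} (h0 : 0 < h) (h1 : h < 1) :
    ∃ s : Finset ℝ, {z : ℂ | ‖z‖ < 1 ∧ 1 - ‖z‖ ≤ h} ⊆
      ⋃ θ ∈ s, carlesonBox (((1 - h : ℝ) : ℂ) * Complex.exp (θ * Complex.I)) := by
  refine ⟨(Finset.Icc (-⌈Real.pi / h + 1⌉) ⌈Real.pi / h + 1⌉).image fun j : ℤ => (j : ℝ) * h,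
    fun z hz => ?_⟩
  simp only [Finset.mem_image, Finset.mem_Icc, mem_iUnion, exists_prop]
  have hj := abs_sub_round (z.arg / h)
  set j := round (z.arg / h) with hjdef
  have ha : |z.arg / h| ≤ Real.pi / h := by
    rw [abs_div, abs_of_pos h0]
    gcongr
    exact Complex.abs_arg_le_pi z
  have hc := Int.le_ceil (Real.pi / h + 1)
  rw [abs_le] at hj ha
  refine ⟨j * h, ⟨j, ⟨?_, ?_⟩, rfl⟩, ?_⟩
  · have : (-(⌈Real.pi / h + 1⌉ : ℤ) : ℝ) ≤ (j : ℝ) := by linarith [hj.2, ha.1]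
    exact_mod_cast this
  · have : (j : ℝ) ≤ (⌈Real.pi / h + 1⌉ : ℤ) := by linarith [hj.1, ha.2]
    exact_mod_cast this
  · refine mem_carlesonBox (t := z.arg) h1 hz.1 hz.2
      (Complex.norm_mul_exp_arg_mul_I z).symm ?_
    have e : z.arg - j * h = (z.arg / h - j) * h := by field_simp
    rw [e, abs_mul, abs_of_pos h0]
    have : |z.arg / h - j| ≤ 1 / 2 := abs_le.2 hj
    nlinarith

lemma exists_setLIntegral_annulus_le (α ζ : ℝ) {p h : ℝ} (hp : 1 ≤ p) (h0 : 0 < h) (h1 : h < 1)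
    (hζ : 1 < ζ * (2 - h)) : ∃ C : ℝ, 0 < C ∧ ∀ f : ℂ → ℂ,
      ∫⁻ z in {z : ℂ | ‖z‖ < 1 ∧ 1 - ‖z‖ ≤ h}, ‖f z‖ₑ ^ p * ENNReal.ofReal ((1 - ‖z‖) ^ (α + 1)) ≤
        tentENorm p α ζ f ^ p * ENNReal.ofReal C := by
  have hπ := Real.pi_pos
  obtain ⟨s, hs⟩ := exists_annulus_subset_biUnion_carlesonBox h0 h1
  set K : ℝ := 2 * Real.pi * 2 ^ |α + 1| * h with hK
  have hK0 : 0 < K := by positivity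
  -- The summand 1 keeps the constant positive without having to show that the cover is nonempty.
  refine ⟨(s.card + 1) * K, by positivity, fun f => ?_⟩
  set F : ℂ → ℝ≥0∞ := fun z => ‖f z‖ₑ ^ p * ENNReal.ofReal ((1 - ‖z‖) ^ (α + 1)) with hF
  -- Passing to a measure with density F gives finite subadditivity although f is not assumed
  -- measurable.
  calc _ = volume.withDensity F {z : ℂ | ‖z‖ < 1 ∧ 1 - ‖z‖ ≤ h} := (withDensity_apply' _ _).symm
    _ ≤ ∑ θ ∈ s, volume.withDensity F
        (carlesonBox (((1 - h : ℝ) : ℂ) * Complex.exp (θ * Complex.I))) :=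
        (measure_mono hs).trans (measure_biUnion_finset_le _ _)
    _ ≤ ∑ θ ∈ s, tentENorm p α ζ f ^ p * ENNReal.ofReal K := by
        refine Finset.sum_le_sum fun θ _ => ?_
        rw [withDensity_apply']
        refine (setLIntegral_carlesonBox_le (ζ := ζ) hp f ?_ ?_).trans ?_
        · rw [norm_one_sub_mul_exp h1]; linarith
        · rw [norm_one_sub_mul_exp h1]; linarith
        · rw [norm_one_sub_mul_exp h1, sub_sub_cancel]
    _ ≤ _ := by
        rw [Finset.sum_const, nsmul_eq_mul, mul_left_comm, ← ENNReal.ofReal_natCast,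
          ← ENNReal.ofReal_mul (by positivity)]
        gcongr _ * ?_
        exact ENNReal.ofReal_le_ofReal (by nlinarith)

/-- For ζ ≤ 1 the origin lies in no approach region, so the box S(0) says nothing about the total
mass. The annulus 1-|z| ≤ h is covered by accessible boxes, and the maximum principle carries the
bound to the interior. -/
lemma exists_setLIntegral_ball_le (ζ : ℝ) {α p h : ℝ} (hα : -2 < α) (hp : 1 ≤ p) (h0 : 0 < h)
    (h1 : h < 1) (hζ : 1 < ζ * (2 - h)) : ∃ C : ℝ, 0 < C ∧ ∀ f : ℂ → ℂ,
      DifferentiableOn ℂ f (ball 0 1) →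
      ∫⁻ z in ball (0 : ℂ) 1, ‖f z‖ₑ ^ p * ENNReal.ofReal ((1 - ‖z‖) ^ (α + 1)) ≤
        tentENorm p α ζ f ^ p * ENNReal.ofReal C := by
  have hp0 : 0 < p := by linarith
  have hπ := Real.pi_pos
  obtain ⟨C, hC, hCf⟩ := exists_setLIntegral_annulus_le α ζ hp h0 h1 hζ
  set K : ℝ := 4 / Real.pi * 2 ^ |α + 1| * (h / 2) ^ (-(α + 1) - 2) with hK
  have hK0 : 0 < K := by positivity
  set W : ℝ := 6 * Real.pi / (α + 1 + 1) * 2 ^ (α + 1 + 2) with hW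
  have hW0 : 0 < W := by
    have : 0 < α + 1 + 1 := by linarith
    positivity
  refine ⟨C + K * C * W, by positivity, fun f hf => ?_⟩
  set F : ℂ → ℝ≥0∞ := fun z => ‖f z‖ₑ ^ p * ENNReal.ofReal ((1 - ‖z‖) ^ (α + 1)) with hF
  set N := tentENorm p α ζ f ^ p with hN
  have hinner : ∀ z : ℂ, ‖z‖ ≤ 1 - h / 2 → ‖f z‖ₑ ^ p ≤ ENNReal.ofReal (K * C) * N := by
    intro z hz
    -- The maximum of |f| is attained at some |w| = 1-h/2. The disc of radius h/4 about w, used in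
    -- the sub-mean value inequality, lies in the annulus already controlled.
    have hd : DiffContOnCl ℂ f (ball 0 (1 - h / 2)) :=
      (hf.mono (closure_ball_subset_closedBall.trans
        (closedBall_subset_ball (by linarith)))).diffContOnCl
    obtain ⟨w, hw, hmax⟩ := Complex.exists_mem_frontier_isMaxOn_norm isBounded_ball
      ⟨0, mem_ball_self (by linarith)⟩ hd
    rw [frontier_ball _ (by linarith), mem_sphere_zero_iff_norm] at hw
    have hzw : ‖f z‖ₑ ≤ ‖f w‖ₑ := by
      rw [enorm_le_iff_norm_le]
      refine hmax ?_
      rw [closure_ball _ (by linarith)]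
      simpa using hz
    have h2 := enorm_rpow_le_mul_setLIntegral (a := α + 1) hp hf (z := w) (by linarith)
    rw [show 1 - ‖w‖ = h / 2 by linarith] at h2
    calc _ ≤ ‖f w‖ₑ ^ p := by gcongr
      _ ≤ ENNReal.ofReal K * (N * ENNReal.ofReal C) := by
          refine h2.trans ?_
          gcongr
          refine (lintegral_mono_set fun v hv => ?_).trans (hCf f)
          have h3 := one_sub_norm_comparable (z := w) (w := v)
            (by rwa [show 1 - ‖w‖ = h / 2 by linarith])
          rw [show 1 - ‖w‖ = h / 2 by linarith] at h3
          constructor <;> linarith [h3.1, h3.2]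
      _ = _ := by rw [mul_comm N, ← mul_assoc, ENNReal.ofReal_mul hK0.le]
  have hsub : ball (0 : ℂ) 1 ⊆ {z : ℂ | ‖z‖ < 1 ∧ 1 - ‖z‖ ≤ h} ∪ ball 0 (1 - h / 2) := by
    intro z hz
    rw [mem_ball_zero_iff] at hz
    by_cases hzh : 1 - ‖z‖ ≤ h
    · exact Or.inl ⟨hz, hzh⟩
    · right
      rw [mem_ball_zero_iff]; linarith
  refine (lintegral_mono_set hsub).trans ((lintegral_union_le _ _ _).trans ?_)
  rw [ENNReal.ofReal_add hC.le (by positivity), mul_add]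
  gcongr
  · exact hCf f
  · calc
      _ ≤ ∫⁻ z in ball (0 : ℂ) (1 - h / 2), ENNReal.ofReal (K * C) * N *
          ENNReal.ofReal ((1 - ‖z‖) ^ (α + 1)) := by
        refine setLIntegral_mono' measurableSet_ball fun z hz => ?_
        gcongr
        exact hinner z (by simpa using (mem_ball_zero_iff.1 hz).le)
      _ = ENNReal.ofReal (K * C) * N * ∫⁻ z in ball (0 : ℂ) (1 - h / 2),
          ENNReal.ofReal ((1 - ‖z‖) ^ (α + 1)) := lintegral_const_mul _ (by fun_prop)
      _ ≤ ENNReal.ofReal (K * C) * N * ENNReal.ofReal W := by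
        gcongr
        -- With R = 2 and centre 0 the window is the whole unit disc.
        refine (lintegral_mono_set fun z hz => ?_).trans
          (setLIntegral_one_sub_norm_rpow_le (by linarith) two_pos 0)
        rw [mem_ball_zero_iff] at hz
        have := norm_nonneg z
        refine ⟨?_, ?_, ?_⟩ <;> (try rw [sub_zero]) <;> linarith
      _ = _ := by
        rw [mul_comm _ N, mul_assoc, ← ENNReal.ofReal_mul (by positivity)]

/-- A function in the tent space satisfies Carleson type bounds on all disks centred on the
unit circle. -/
lemma exists_hasTentBound {p α ζ : ℝ} (hp : 1 ≤ p) (hα : -2 < α) (hζ : 1 / 2 < ζ) :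
    ∃ C : ℝ, 0 < C ∧ ∀ f : ℂ → ℂ, DifferentiableOn ℂ f (ball 0 1) →
      HasTentBound p α f (tentENorm p α ζ f ^ p * ENNReal.ofReal C) := by
  have hπ := Real.pi_pos
  -- This is where ζ > 1/2 enters: it makes every u with |u| = 1-h accessible once h is small.
  obtain ⟨h, h0, h1, hh⟩ : ∃ h : ℝ, 0 < h ∧ h < 1 ∧ 1 < ζ * (2 - h) := by
    have hc : ContinuousAt (fun h : ℝ => ζ * (2 - h)) 0 := by fun_prop
    have e1 : ∀ᶠ h in 𝓝[>] (0 : ℝ), 1 < ζ * (2 - h) :=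
      (hc.eventually_const_lt (show (1 : ℝ) < ζ * (2 - 0) by linarith)).filter_mono
        nhdsWithin_le_nhds
    have e2 : ∀ᶠ h in 𝓝[>] (0 : ℝ), h < 1 :=
      (eventually_lt_nhds one_pos).filter_mono nhdsWithin_le_nhds
    obtain ⟨h, a, b, c⟩ := (e1.and (e2.and self_mem_nhdsWithin)).exists
    exact ⟨h, c, b, a⟩
  obtain ⟨C, hC, hCf⟩ := exists_setLIntegral_ball_le ζ hα hp h0 h1 hh
  refine ⟨2 * Real.pi * 2 ^ |α + 1| * 8 + C * (8 / h), by positivity, fun f hf ω hω R hR => ?_⟩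
  rw [mul_assoc, ← ENNReal.ofReal_mul (by positivity)]
  -- A small window lies in one accessible box. For a large one 1 < 8R/h, and the total mass
  -- suffices.
  by_cases hRh : 8 * R ≤ h
  · obtain ⟨θ, rfl⟩ : ∃ θ : ℝ, ω = Complex.exp (θ * Complex.I) := by
      refine ⟨ω.arg, ?_⟩
      have := Complex.norm_mul_exp_arg_mul_I ω
      rw [hω] at this
      simpa using this.symm
    refine (lintegral_mono_set (ball_inter_ball_subset_carlesonBox (by linarith))).trans ?_
    refine (setLIntegral_carlesonBox_le (ζ := ζ) hp f ?_ ?_).trans ?_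
    · rw [norm_one_sub_mul_exp (by linarith)]; linarith
    · rw [norm_one_sub_mul_exp (by linarith)]; nlinarith
    · rw [norm_one_sub_mul_exp (by linarith), sub_sub_cancel]
      gcongr _ * ENNReal.ofReal ?_
      have : 0 < C * (8 / h) * R := by positivity
      nlinarith
  · refine (lintegral_mono_set inter_subset_left).trans ((hCf f hf).trans ?_)
    gcongr
    have h2 : 1 ≤ 8 / h * R := by
      rw [div_mul_eq_mul_div, le_div_iff₀ h0]; linarith
    have : 0 < 2 * Real.pi * 2 ^ |α + 1| * 8 * R := by positivity
    nlinarith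

end TentSpace

/-! ### Far and near parts of the integral defining `cesaro`. -/

namespace TentSpace

lemma one_sub_mul_pos {t r : ℝ} (ht : t ∈ Ico (0 : ℝ) 1) (hr0 : 0 ≤ r) (hr : r < 1) :
    0 < 1 - t * r := by nlinarith [ht.1, ht.2]

/-- On E the quantity 1-tr dominates both ε and 1-t, hence half their sum. The moment estimate then
applies with d = 1, the growth exponent of a Carleson measure. -/
lemma setLIntegral_one_sub_mul_rpow_neg_le {ν : Measure ℝ} [SFinite ν]
    (hsupp : ∀ᵐ t ∂ν, t ∈ Ico (0 : ℝ) 1) {κ : ℝ} (hκ : 0 ≤ κ)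
    (hν : ∀ s : ℝ, 0 < s → ν {t | 1 - t < s} ≤ ENNReal.ofReal κ * ENNReal.ofReal s)
    {β ε r : ℝ} (hβ : 0 < β) (hε : 0 < ε) (hr : r < 1) {E : Set ℝ}
    (hE : MeasurableSet E) (hEε : ∀ t ∈ E, t ∈ Ico (0 : ℝ) 1 → ε ≤ 1 - t * r) :
    ∫⁻ t in E, ENNReal.ofReal ((1 - t * r) ^ (-(1 + β))) ∂ν ≤
      ENNReal.ofReal (2 ^ (1 + β) * ((1 + β) / β) * κ * ε ^ (-β)) := by
  calc _ ≤ ∫⁻ t in E, ENNReal.ofReal (2 ^ (1 + β)) *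
        ENNReal.ofReal ((ε + (1 - t)) ^ (-(1 + β))) ∂ν := by
        refine lintegral_mono_ae ?_
        filter_upwards [ae_restrict_of_ae hsupp, ae_restrict_mem hE] with t ht htE
        rw [← ENNReal.ofReal_mul (by positivity)]
        refine ENNReal.ofReal_le_ofReal ?_
        have h1 := hEε t htE ht
        have h2 : 1 - t ≤ 1 - t * r := by nlinarith [ht.1]
        have h3 : 0 < 1 - t := by linarith [ht.2]
        have h4 : (ε + (1 - t)) / 2 ≤ 1 - t * r := by linarith
        calc _ ≤ ((ε + (1 - t)) / 2) ^ (-(1 + β)) :=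
              Real.rpow_le_rpow_of_nonpos (by positivity) h4 (by linarith)
          _ = _ := by
              rw [Real.div_rpow (by positivity) (by norm_num), Real.rpow_neg (by norm_num : (0 : ℝ) ≤ 2),
                div_inv_eq_mul, mul_comm]
    _ ≤ ENNReal.ofReal (2 ^ (1 + β)) * (ENNReal.ofReal κ *
        ENNReal.ofReal ((1 + β) / (1 + β - 1) * ε ^ (1 - (1 + β)))) := by
        rw [lintegral_const_mul' _ _ ENNReal.ofReal_ne_top]
        gcongr
        refine (setLIntegral_le_lintegral _ _).trans ?_
        refine lintegral_add_rpow_neg_le (by fun_prop) ?_ zero_le_one (by linarith) hε ?_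
        · filter_upwards [hsupp] with t ht
          linarith [ht.2]
        · simpa only [Real.rpow_one] using hν
    _ = _ := by
        rw [← ENNReal.ofReal_mul hκ, ← ENNReal.ofReal_mul (by positivity)]
        congr 1
        rw [show 1 + β - 1 = β by ring, show 1 - (1 + β) = -β by ring]
        ring

/-- A pointwise majorant of `C_μ f` on each circle. -/
noncomputable def radialMajorant (ν : Measure ℝ) (f : ℂ → ℂ) (z : ℂ) : ℝ≥0∞ :=
  ∫⁻ t, ‖f (t * z)‖ₑ * ENNReal.ofReal ((1 - t * ‖z‖)⁻¹) ∂ν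

lemma enorm_cesaro_le (μ : Measure ℝ) (f : ℂ → ℂ) (z : ℂ) :
    ‖cesaro μ f z‖ₑ ≤ radialMajorant (μ.restrict (Ico 0 1)) f z := by
  rw [cesaro]
  split_ifs with hz
  · rw [mem_ball_zero_iff] at hz
    refine (enorm_integral_le_lintegral_enorm _).trans ?_
    rw [radialMajorant]
    refine setLIntegral_mono' measurableSet_Ico fun t ht => ?_
    have hy := one_sub_mul_pos ht (norm_nonneg z) hz
    rw [div_eq_mul_inv, enorm_mul]
    gcongr
    rw [← ofReal_norm, norm_inv]
    gcongr
    have := norm_sub_norm_le (1 : ℂ) (t * z)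
    rwa [norm_one, norm_mul, Complex.norm_real, Real.norm_eq_abs, abs_of_nonneg ht.1] at this
  · simp

lemma norm_ofReal_mul {t : ℝ} (ht : 0 ≤ t) (z : ℂ) : ‖(t : ℂ) * z‖ = t * ‖z‖ := by
  rw [norm_mul, Complex.norm_real, Real.norm_eq_abs, abs_of_nonneg ht]

lemma ofReal_mul_mem_ball {t : ℝ} (ht : t ∈ Ico (0 : ℝ) 1) {z : ℂ} (hz : ‖z‖ < 1) :
    (t : ℂ) * z ∈ ball (0 : ℂ) 1 := by
  rw [mem_ball_zero_iff, norm_ofReal_mul ht.1]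
  nlinarith [ht.1, ht.2, norm_nonneg z]

/-- The growth estimate gives |f(tz)| ≲ (1-t|z|)^(-β), and the kernel adds one more power. For 1-t ≥
R one has 1-t|z| ≥ R, so the ν-integral of (1-t|z|)^(-(1+β)) is O(κ R^(-β)). -/
lemma HasTentBound.setLIntegral_far_rpow_le {p α : ℝ} (hp : 1 ≤ p) (hα : -2 < α) {f : ℂ → ℂ}
    {M : ℝ≥0∞} (hM : HasTentBound p α f M) (hf : DifferentiableOn ℂ f (ball 0 1))
    {ν : Measure ℝ} [SFinite ν]
    (hsupp : ∀ᵐ t ∂ν, t ∈ Ico (0 : ℝ) 1) {κ : ℝ} (hκ : 0 ≤ κ)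
    (hν : ∀ s : ℝ, 0 < s → ν {t | 1 - t < s} ≤ ENNReal.ofReal κ * ENNReal.ofReal s)
    {β : ℝ} (hβ : β = (α + 2) / p) {R : ℝ} (hR : 0 < R) {z : ℂ} (hz : ‖z‖ < 1) :
    (∫⁻ t in {t | 1 - t < R}ᶜ, ‖f (t * z)‖ₑ * ENNReal.ofReal ((1 - t * ‖z‖)⁻¹) ∂ν) ^ p ≤
      M * ENNReal.ofReal (8 / Real.pi * 2 ^ |α + 1| * (2 ^ (1 + β) * ((1 + β) / β)) ^ p * κ ^ p *
        R ^ (-(α + 2))) := by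
  have hπ := Real.pi_pos
  have hp0 : 0 < p := by linarith
  have hβ0 : 0 < β := by rw [hβ]; exact div_pos (by linarith) hp0
  have hβp : β * p = α + 2 := by rw [hβ]; field_simp
  have hE : MeasurableSet {t : ℝ | 1 - t < R}ᶜ :=
    (measurableSet_lt (by fun_prop) (by fun_prop)).compl
  set K : ℝ := 8 / Real.pi * 2 ^ |α + 1| with hK
  have hK0 : 0 < K := by positivity
  set c : ℝ := 2 ^ (1 + β) * ((1 + β) / β) with hc
  have hc0 : 0 < c := by positivity
  have h1 : ∫⁻ t in {t | 1 - t < R}ᶜ, ‖f (t * z)‖ₑ * ENNReal.ofReal ((1 - t * ‖z‖)⁻¹) ∂ν ≤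
      (M * ENNReal.ofReal K) ^ (1 / p) * ENNReal.ofReal (c * κ * R ^ (-β)) := by
    calc _ ≤ ∫⁻ t in {t | 1 - t < R}ᶜ, (M * ENNReal.ofReal K) ^ (1 / p) *
          ENNReal.ofReal ((1 - t * ‖z‖) ^ (-(1 + β))) ∂ν := by
          refine lintegral_mono_ae ?_
          filter_upwards [ae_restrict_of_ae hsupp] with t ht
          have hy := one_sub_mul_pos ht (norm_nonneg z) hz
          have hg := hM.enorm_rpow_le hp hf (mem_ball_zero_iff.1 (ofReal_mul_mem_ball ht hz))
          rw [norm_ofReal_mul ht.1, ← hK] at hg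
          set y := 1 - t * ‖z‖ with hydef
          have hg2 : ‖f (t * z)‖ₑ ≤ (M * ENNReal.ofReal K) ^ (1 / p) *
              ENNReal.ofReal (y ^ (-β)) := by
            rw [← ENNReal.rpow_le_rpow_iff hp0, ENNReal.mul_rpow_of_nonneg _ _ hp0.le,
              ← ENNReal.rpow_mul, one_div, inv_mul_cancel₀ hp0.ne', ENNReal.rpow_one,
              ENNReal.ofReal_rpow_of_pos (by positivity), ← Real.rpow_mul hy.le, mul_assoc,
              ← ENNReal.ofReal_mul hK0.le, neg_mul, hβp]
            exact hg
          calc _ ≤ (M * ENNReal.ofReal K) ^ (1 / p) * ENNReal.ofReal (y ^ (-β)) *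
                ENNReal.ofReal (y⁻¹) := by gcongr
            _ = _ := by
              rw [mul_assoc, ← ENNReal.ofReal_mul (by positivity), ← Real.rpow_neg_one,
                ← Real.rpow_add hy]
              congr 3; ring
      _ ≤ _ := by
          rw [lintegral_const_mul _ (by fun_prop)]
          gcongr
          refine setLIntegral_one_sub_mul_rpow_neg_le hsupp hκ hν hβ0 hR hz hE ?_
          intro t ht ht2
          have ht3 : R ≤ 1 - t := not_lt.1 ht
          nlinarith [ht2.1]
  calc _ ≤ ((M * ENNReal.ofReal K) ^ (1 / p) * ENNReal.ofReal (c * κ * R ^ (-β))) ^ p := by gcongr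
    _ = _ := by
      rw [ENNReal.mul_rpow_of_nonneg _ _ hp0.le, ← ENNReal.rpow_mul, one_div,
        inv_mul_cancel₀ hp0.ne', ENNReal.rpow_one,
        ENNReal.ofReal_rpow_of_nonneg (by positivity) hp0.le, mul_assoc,
        ← ENNReal.ofReal_mul hK0.le, Real.mul_rpow (by positivity) (by positivity),
        Real.mul_rpow (by positivity) (by positivity), ← Real.rpow_mul hR.le, neg_mul, hβp]
      congr 2; ring

/-- The weighted Jensen inequality behind the estimate of the part of `C_μ f` near the boundary. -/
lemma setLIntegral_near_rpow_le {p : ℝ} (hp : 1 ≤ p) {f : ℂ → ℂ}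
    (hf : DifferentiableOn ℂ f (ball 0 1)) {ν : Measure ℝ} [SFinite ν]
    (hsupp : ∀ᵐ t ∂ν, t ∈ Ico (0 : ℝ) 1) {κ : ℝ} (hκ : 0 ≤ κ)
    (hν : ∀ s : ℝ, 0 < s → ν {t | 1 - t < s} ≤ ENNReal.ofReal κ * ENNReal.ofReal s)
    {β : ℝ} (hβ : 0 < β) {E : Set ℝ} (hE : MeasurableSet E) {z : ℂ} (hz : ‖z‖ < 1) :
    (∫⁻ t in E, ‖f (t * z)‖ₑ * ENNReal.ofReal ((1 - t * ‖z‖)⁻¹) ∂ν) ^ p ≤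
      ENNReal.ofReal ((2 ^ (1 + β) * ((1 + β) / β) * κ) ^ (p - 1) *
        (1 - ‖z‖) ^ (-(β * (p - 1)))) *
      ∫⁻ t in E, ‖f (t * z)‖ₑ ^ p * ENNReal.ofReal ((1 - t * ‖z‖) ^ (β * (p - 1) - 1)) ∂ν := by
  have hp0 : 0 < p := by linarith
  have hx : 0 < 1 - ‖z‖ := by linarith
  set D : ℝ → ℝ≥0∞ := fun t => ENNReal.ofReal ((1 - t * ‖z‖) ^ (-(1 + β))) with hD
  have hDm : Measurable D := by fun_prop
  -- The kernel is split as (1-t|z|)^β · (1-t|z|)^(-(1+β)). Jensen is applied to the measure whose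
  -- density is the second factor; its mass is O(κ(1-|z|)^(-β)). The exponent left inside is
  -- βp-(1+β) = β(p-1)-1.
  set ν' := (ν.restrict E).withDensity D with hν'
  have hfm : AEMeasurable (fun t : ℝ => ‖f (t * z)‖ₑ) ν := by
    rw [← Measure.restrict_eq_self_of_ae_mem hsupp]
    refine ContinuousOn.aemeasurable ?_ measurableSet_Ico
    refine ContinuousOn.enorm ?_
    exact hf.continuousOn.comp (by fun_prop) fun t ht => ofReal_mul_mem_ball ht hz
  have hgm : AEMeasurable (fun t : ℝ => ‖f (t * z)‖ₑ * ENNReal.ofReal ((1 - t * ‖z‖) ^ β))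
      (ν.restrict E) := hfm.restrict.mul (by fun_prop)
  have hsE := ae_restrict_of_ae (s := E) hsupp
  have e1 : ∫⁻ t in E, ‖f (t * z)‖ₑ * ENNReal.ofReal ((1 - t * ‖z‖)⁻¹) ∂ν =
      ∫⁻ t, ‖f (t * z)‖ₑ * ENNReal.ofReal ((1 - t * ‖z‖) ^ β) ∂ν' := by
    rw [hν', lintegral_withDensity_eq_lintegral_mul₀ hDm.aemeasurable hgm]
    refine lintegral_congr_ae ?_
    filter_upwards [hsE] with t ht
    have hy := one_sub_mul_pos ht (norm_nonneg z) hz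
    simp only [Pi.mul_apply, hD]
    rw [mul_left_comm, ← ENNReal.ofReal_mul (by positivity), ← Real.rpow_add hy,
      ← Real.rpow_neg_one]
    congr 3; ring
  have e2 : ∫⁻ t, (‖f (t * z)‖ₑ * ENNReal.ofReal ((1 - t * ‖z‖) ^ β)) ^ p ∂ν' =
      ∫⁻ t in E, ‖f (t * z)‖ₑ ^ p * ENNReal.ofReal ((1 - t * ‖z‖) ^ (β * (p - 1) - 1)) ∂ν := by
    rw [hν', lintegral_withDensity_eq_lintegral_mul₀ hDm.aemeasurable (hgm.pow_const p)]
    refine lintegral_congr_ae ?_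
    filter_upwards [hsE] with t ht
    have hy := one_sub_mul_pos ht (norm_nonneg z) hz
    simp only [Pi.mul_apply, hD]
    rw [ENNReal.mul_rpow_of_nonneg _ _ hp0.le, ENNReal.ofReal_rpow_of_pos (by positivity),
      mul_left_comm, ← ENNReal.ofReal_mul (by positivity), ← Real.rpow_mul hy.le,
      ← Real.rpow_add hy]
    congr 3; ring
  have e3 : ν' univ ≤ ENNReal.ofReal (2 ^ (1 + β) * ((1 + β) / β) * κ * (1 - ‖z‖) ^ (-β)) := by
    rw [hν', withDensity_apply _ MeasurableSet.univ, Measure.restrict_univ]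
    refine setLIntegral_one_sub_mul_rpow_neg_le hsupp hκ hν hβ hx hz hE ?_
    intro t _ ht
    nlinarith [ht.1, ht.2, norm_nonneg z]
  rw [e1, ← e2]
  refine (lintegral_rpow_le_measure_univ_mul ν' hp
    (hgm.mono_ac (withDensity_absolutelyContinuous _ _))).trans ?_
  gcongr
  refine (ENNReal.rpow_le_rpow e3 (by linarith)).trans (le_of_eq ?_)
  rw [ENNReal.ofReal_rpow_of_nonneg (by positivity) (by linarith),
    Real.mul_rpow (by positivity) (by positivity), ← Real.rpow_mul hx.le, neg_mul]

end TentSpace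

/-! ### Fubini over shadows and the bound for `cesaro` in terms of the Carleson constant. -/

namespace TentSpace

/-- Points `z` of the disk in a region of Stolz type attached to `w`. -/
def shadow (w : ℂ) : Set ℂ :=
  {z | ‖z‖ < 1 ∧ 1 - ‖z‖ < 3 * (1 - ‖w‖) ∧ ‖z - w‖ < 3 * (1 - ‖w‖)}

lemma measurableSet_shadow_prod : MeasurableSet {q : ℂ × ℂ | q.1 ∈ shadow q.2} := by
  simp only [shadow, ofPred_and]
  exact (measurableSet_lt (by fun_prop) (by fun_prop)).inter
    ((measurableSet_lt (by fun_prop) (by fun_prop)).inter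
      (measurableSet_lt (by fun_prop) (by fun_prop)))

/-- All distances are compared with y = 1-t|z|, which dominates 1-t and 1-|z|, is less than 2R, and
is at most 2(1-|w|) on the disc about tz. The conditions obtained on (z, w) and on (t, w) are
separate, so t can be integrated out for fixed w. -/
lemma mem_of_mem_ball_dilate {ω z w : ℂ} {R t : ℝ} (hω : ‖ω‖ = 1) (hz : ‖z‖ < 1)
    (hzR : ‖z - ω‖ < R) (ht : t ∈ Ico (0 : ℝ) 1) (htR : 1 - t < R)
    (hw : w ∈ ball ((t : ℂ) * z) ((1 - ‖(t : ℂ) * z‖) / 2)) :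
    w ∈ ball (0 : ℂ) 1 ∩ ball ω (3 * R) ∧ z ∈ shadow w ∧ 1 - t < 3 * (1 - ‖w‖) := by
  obtain ⟨h1, h2⟩ := one_sub_norm_comparable hw
  rw [mem_ball, dist_eq_norm] at hw
  rw [norm_ofReal_mul ht.1] at h1 h2 hw
  have hy := one_sub_mul_pos ht (norm_nonneg z) hz
  have hx : 1 - ‖z‖ < R := by
    have := norm_sub_norm_le ω z
    rw [norm_sub_rev, hω] at this
    linarith
  have htz : ‖(t : ℂ) * z - z‖ = (1 - t) * ‖z‖ := by
    have : (t : ℂ) * z - z = ((t - 1 : ℝ) : ℂ) * z := by push_cast; ring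
    rw [this, norm_mul, Complex.norm_real, Real.norm_eq_abs, abs_sub_comm,
      abs_of_pos (by linarith [ht.2])]
  have h3 := norm_sub_le_norm_sub_add_norm_sub w ((t : ℂ) * z) z
  have h4 := norm_sub_le_norm_sub_add_norm_sub w z ω
  have h5 : 0 ≤ (1 - t) * (1 - ‖z‖) := mul_nonneg (by linarith [ht.2]) (by linarith)
  have h6 : 0 ≤ (1 - t) * ‖z‖ := mul_nonneg (by linarith [ht.2]) (norm_nonneg z)
  refine ⟨⟨by rw [mem_ball_zero_iff]; linarith, ?_⟩, ⟨hz, ?_, ?_⟩, ?_⟩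
  · rw [mem_ball, dist_eq_norm]; nlinarith
  · nlinarith
  · rw [norm_sub_rev]; nlinarith
  · nlinarith [mul_nonneg ht.1 (by linarith : 0 ≤ 1 - ‖z‖)]

/-- After |f(tz)|^p is replaced by its mean over a disc about tz and the integrals are swapped, the
t-integral is at most ν{1-t < 3(1-|w|)} ≤ 3κ(1-|w|). This raises the weight exponent from α-1-β to
α-β. -/
lemma setLIntegral_near_le_setLIntegral_shadow {p α : ℝ} (hp : 1 ≤ p) {f : ℂ → ℂ}
    (hfm : Measurable f) (hf : DifferentiableOn ℂ f (ball 0 1)) {ν : Measure ℝ} [SFinite ν]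
    (hsupp : ∀ᵐ t ∂ν, t ∈ Ico (0 : ℝ) 1) {κ : ℝ} (hκ : 0 ≤ κ)
    (hν : ∀ s : ℝ, 0 < s → ν {t | 1 - t < s} ≤ ENNReal.ofReal κ * ENNReal.ofReal s)
    (β : ℝ) {R : ℝ} {ω z : ℂ} (hω : ‖ω‖ = 1) (hz : ‖z‖ < 1) (hzR : ‖z - ω‖ < R) :
    ∫⁻ t in {t | 1 - t < R}, ‖f (t * z)‖ₑ ^ p *
        ENNReal.ofReal ((1 - t * ‖z‖) ^ (α + 1 - β)) ∂ν ≤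
      ENNReal.ofReal (4 / Real.pi * 2 ^ |α - 1 - β| * (3 * κ)) *
      ∫⁻ w in ball 0 1 ∩ ball ω (3 * R), {w | z ∈ shadow w}.indicator
        (fun w => ‖f w‖ₑ ^ p * ENNReal.ofReal ((1 - ‖w‖) ^ (α - β))) w := by
  classical
  have hπ := Real.pi_pos
  -- Chosen so that the factor y^(-a-2) of the area mean cancels the given weight y^(α+1-β).
  set a := α - 1 - β with ha
  set K : ℝ := 4 / Real.pi * 2 ^ |a| with hK
  have hK0 : 0 < K := by positivity
  have hE : MeasurableSet {t : ℝ | 1 - t < R} := measurableSet_lt (by fun_prop) (by fun_prop)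
  have hSm : MeasurableSet {w | z ∈ shadow w} :=
    measurableSet_shadow_prod.preimage (measurable_prodMk_left (x := z))
  set F : ℂ → ℝ≥0∞ := fun w => ‖f w‖ₑ ^ p * ENNReal.ofReal ((1 - ‖w‖) ^ a) with hF
  have hFm : Measurable F := by fun_prop
  set T : Set (ℝ × ℂ) := {q | 1 - q.1 < 3 * (1 - ‖q.2‖)} with hT
  have hTm : MeasurableSet T := measurableSet_lt (by fun_prop) (by fun_prop)
  set Q := ball (0 : ℂ) 1 ∩ ball ω (3 * R) with hQ
  have hQm : MeasurableSet Q := measurableSet_ball.inter measurableSet_ball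
  calc
    _ ≤ ∫⁻ t in {t | 1 - t < R}, ENNReal.ofReal K *
        (∫⁻ w in Q, {w | z ∈ shadow w}.indicator F w * T.indicator 1 (t, w)) ∂ν := by
      refine lintegral_mono_ae ?_
      filter_upwards [ae_restrict_of_ae hsupp, ae_restrict_mem hE] with t ht htR
      have h := enorm_rpow_le_mul_setLIntegral (a := a) hp hf
        (mem_ball_zero_iff.1 (ofReal_mul_mem_ball ht hz))
      have hy := one_sub_mul_pos ht (norm_nonneg z) hz
      have hyn := norm_ofReal_mul ht.1 z
      have hmem := fun w => mem_of_mem_ball_dilate (w := w) hω hz hzR ht htR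
      rw [hyn] at h hmem
      set y := 1 - t * ‖z‖ with hydef
      calc _ ≤ (ENNReal.ofReal (K * y ^ (-a - 2)) * ∫⁻ w in ball ((t : ℂ) * z) (y / 2), F w) *
            ENNReal.ofReal (y ^ (α + 1 - β)) := by gcongr
        _ = ENNReal.ofReal K * ∫⁻ w in ball ((t : ℂ) * z) (y / 2), F w := by
            rw [mul_right_comm, ← ENNReal.ofReal_mul (by positivity), mul_assoc K,
              ← Real.rpow_add hy, show -a - 2 + (α + 1 - β) = 0 by rw [ha]; ring,
              Real.rpow_zero, mul_one]
        _ ≤ _ := by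
            refine mul_le_mul_right ?_ _
            rw [← lintegral_indicator measurableSet_ball, ← lintegral_indicator hQm]
            refine lintegral_mono fun w => ?_
            by_cases hw : w ∈ ball ((t : ℂ) * z) (y / 2)
            · obtain ⟨h1, h2, h3⟩ := hmem w hw
              rw [indicator_of_mem hw, indicator_of_mem h1,
                indicator_of_mem (show w ∈ {w | z ∈ shadow w} from h2),
                indicator_of_mem (show (t, w) ∈ T from h3), Pi.one_apply, mul_one]
            · rw [indicator_of_notMem hw]
              exact zero_le
    _ ≤ ENNReal.ofReal K * ∫⁻ t, (∫⁻ w in Q,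
        {w | z ∈ shadow w}.indicator F w * T.indicator 1 (t, w)) ∂ν := by
      rw [← lintegral_const_mul' _ _ ENNReal.ofReal_ne_top]
      exact setLIntegral_le_lintegral _ _
    _ = ENNReal.ofReal K * ∫⁻ w in Q, {w | z ∈ shadow w}.indicator F w *
        ν {t | 1 - t < 3 * (1 - ‖w‖)} := by
      rw [lintegral_lintegral_swap]
      · congr 1
        refine lintegral_congr fun w => ?_
        have hTw : MeasurableSet {t : ℝ | 1 - t < 3 * (1 - ‖w‖)} :=
          measurableSet_lt (by fun_prop) (by fun_prop)
        have hm1 : Measurable fun t : ℝ => T.indicator (1 : ℝ × ℂ → ℝ≥0∞) (t, w) :=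
          (measurable_one.indicator hTm).comp measurable_prodMk_right
        rw [lintegral_const_mul _ hm1, ← lintegral_indicator_one hTw]
        rfl
      · exact (((hFm.indicator hSm).comp measurable_snd).mul
          (measurable_one.indicator hTm)).aemeasurable
    _ ≤ ENNReal.ofReal K * ∫⁻ w in Q, ENNReal.ofReal (3 * κ) * {w | z ∈ shadow w}.indicator
        (fun w => ‖f w‖ₑ ^ p * ENNReal.ofReal ((1 - ‖w‖) ^ (α - β))) w := by
      gcongr ENNReal.ofReal K * ?_
      refine setLIntegral_mono' hQm fun w hw => ?_
      have hv : 0 < 1 - ‖w‖ := by linarith [mem_ball_zero_iff.1 hw.1]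
      rw [indicator_apply, indicator_apply]
      split_ifs
      · calc _ ≤ F w * (ENNReal.ofReal κ * ENNReal.ofReal (3 * (1 - ‖w‖))) := by
              gcongr
              exact hν _ (by positivity)
          _ = _ := by
              simp only [hF]
              rw [← ENNReal.ofReal_mul hκ, mul_assoc, ← ENNReal.ofReal_mul (by positivity),
                mul_left_comm (ENNReal.ofReal _), ← ENNReal.ofReal_mul (by positivity),
                show α - β = a + 1 by rw [ha]; ring, Real.rpow_add_one hv.ne']
              congr 2; ring
      · simp
    _ = _ := by
      rw [lintegral_const_mul' _ _ ENNReal.ofReal_ne_top, ← mul_assoc,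
        ← ENNReal.ofReal_mul hK0.le]

/-- By Fubini, the integral of (1-|z|)^(β-1) over the shadow of w is O((1-|w|)^(β+1)), where β > 0
ensures convergence. This restores the weight exponent α+1, and the hypothesis on f applies to the
window of radius 3R. -/
lemma HasTentBound.setLIntegral_shadow_le {p α : ℝ} {f : ℂ → ℂ} (hfm : Measurable f)
    {M : ℝ≥0∞} (hM : HasTentBound p α f M) {β : ℝ} (hβ : 0 < β) {R : ℝ} (hR : 0 < R)
    {ω : ℂ} (hω : ‖ω‖ = 1) :
    ∫⁻ z in ball 0 1 ∩ ball ω R, ENNReal.ofReal ((1 - ‖z‖) ^ (β - 1)) *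
      ∫⁻ w in ball 0 1 ∩ ball ω (3 * R), {w | z ∈ shadow w}.indicator
        (fun w => ‖f w‖ₑ ^ p * ENNReal.ofReal ((1 - ‖w‖) ^ (α - β))) w ≤
      M * ENNReal.ofReal (6 * Real.pi / β * 3 ^ (β + 1) * (3 * R)) := by
  classical
  have hπ := Real.pi_pos
  set F : ℂ → ℝ≥0∞ := fun w => ‖f w‖ₑ ^ p * ENNReal.ofReal ((1 - ‖w‖) ^ (α - β)) with hF
  have hFm : Measurable F := by fun_prop
  set Q := ball (0 : ℂ) 1 ∩ ball ω (3 * R) with hQ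
  have hQm : MeasurableSet Q := measurableSet_ball.inter measurableSet_ball
  have hS := measurableSet_shadow_prod
  have hGm : Measurable fun q : ℂ × ℂ => {q : ℂ × ℂ | q.1 ∈ shadow q.2}.indicator
      (fun q => ENNReal.ofReal ((1 - ‖q.1‖) ^ (β - 1)) * F q.2) q :=
    Measurable.indicator (by fun_prop) hS
  calc
    _ = ∫⁻ z in ball 0 1 ∩ ball ω R, ∫⁻ w in Q, {q : ℂ × ℂ | q.1 ∈ shadow q.2}.indicator
        (fun q => ENNReal.ofReal ((1 - ‖q.1‖) ^ (β - 1)) * F q.2) (z, w) := by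
      refine lintegral_congr fun z => ?_
      rw [← lintegral_const_mul' _ _ ENNReal.ofReal_ne_top]
      refine lintegral_congr fun w => ?_
      simp only [indicator_apply, mem_ofPred_eq]
      split_ifs <;> simp
    _ = ∫⁻ w in Q, ∫⁻ z in ball 0 1 ∩ ball ω R, {q : ℂ × ℂ | q.1 ∈ shadow q.2}.indicator
        (fun q => ENNReal.ofReal ((1 - ‖q.1‖) ^ (β - 1)) * F q.2) (z, w) :=
      lintegral_lintegral_swap hGm.aemeasurable
    _ ≤ ∫⁻ w in Q, ENNReal.ofReal (6 * Real.pi / β * 3 ^ (β + 1)) *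
        (‖f w‖ₑ ^ p * ENNReal.ofReal ((1 - ‖w‖) ^ (α + 1))) := by
      refine setLIntegral_mono' hQm fun w hw => ?_
      have hv : 0 < 1 - ‖w‖ := by linarith [mem_ball_zero_iff.1 hw.1]
      have hSw : MeasurableSet (shadow w) := hS.preimage (measurable_prodMk_right (y := w))
      calc
        _ ≤ ∫⁻ z, (shadow w).indicator (fun z => ENNReal.ofReal ((1 - ‖z‖) ^ (β - 1)) * F w) z := by
          refine (setLIntegral_le_lintegral _ _).trans (le_of_eq ?_)
          rfl
        _ = (∫⁻ z in shadow w, ENNReal.ofReal ((1 - ‖z‖) ^ (β - 1))) * F w := by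
          rw [lintegral_indicator hSw, lintegral_mul_const _ (by fun_prop)]
        _ ≤ ENNReal.ofReal (6 * Real.pi / (β - 1 + 1) * (3 * (1 - ‖w‖)) ^ (β - 1 + 2)) * F w := by
          gcongr
          exact setLIntegral_one_sub_norm_rpow_le (by linarith) (by positivity) w
        _ = _ := by
          simp only [hF]
          rw [sub_add_cancel, show β - 1 + 2 = β + 1 by ring,
            Real.mul_rpow (by norm_num) hv.le, mul_left_comm, ← mul_assoc (6 * Real.pi / β),
            ENNReal.ofReal_mul (by positivity), mul_assoc, ← ENNReal.ofReal_mul (by positivity),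
            ← Real.rpow_add hv, mul_left_comm]
          congr 4; ring
    _ ≤ ENNReal.ofReal (6 * Real.pi / β * 3 ^ (β + 1)) * (M * ENNReal.ofReal (3 * R)) := by
      rw [lintegral_const_mul' _ _ ENNReal.ofReal_ne_top]
      gcongr
      exact hM ω hω _ (by positivity)
    _ = _ := by
      rw [mul_left_comm, ← ENNReal.ofReal_mul (by positivity)]

/-- The operators `C_μ` are bounded in terms of the Carleson constant of `μ`. -/
lemma exists_hasTentBound_cesaro {p α : ℝ} (hp : 1 ≤ p) (hα : -2 < α) :
    ∃ C : ℝ, 0 < C ∧ ∀ (μ : Measure ℝ) [SFinite μ] (κ : ℝ), 0 < κ →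
      (∀ s : ℝ, 0 < s → μ.restrict (Ico 0 1) {t | 1 - t < s} ≤
        ENNReal.ofReal κ * ENNReal.ofReal s) →
      ∀ (f : ℂ → ℂ) (M : ℝ≥0∞), Measurable f → DifferentiableOn ℂ f (ball 0 1) →
      HasTentBound p α f M → HasTentBound p α (cesaro μ f) (M * ENNReal.ofReal (C * κ ^ p)) := by
  have hπ := Real.pi_pos
  have hp0 : 0 < p := by linarith
  have hα2 : 0 < α + 2 := by linarith
  set β : ℝ := (α + 2) / p with hβ
  have hβ0 : 0 < β := div_pos hα2 hp0
  have hβp : β * p = α + 2 := by rw [hβ]; field_simp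
  set c : ℝ := 2 ^ (1 + β) * ((1 + β) / β) with hc
  have hc0 : 0 < c := by positivity
  set A : ℝ := 8 / Real.pi * 2 ^ |α + 1| * c ^ p with hA
  set W : ℝ := 6 * Real.pi / (α + 1 + 1) with hW
  have hW0 : 0 < W := by
    have : 0 < α + 1 + 1 := by linarith
    positivity
  set B : ℝ := c ^ (p - 1) * (4 / Real.pi * 2 ^ |α - 1 - β| * 3) *
    (6 * Real.pi / β * 3 ^ (β + 1) * 3) with hB
  have hA0 : 0 < A := by positivity
  have hB0 : 0 < B := by positivity
  refine ⟨2 ^ (p - 1) * (A * W + B), by positivity, ?_⟩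
  intro μ _ κ hκ hν f M hfm hf hM ω hω R hR
  set ν := μ.restrict (Ico (0 : ℝ) 1) with hνdef
  have hsupp : ∀ᵐ t ∂ν, t ∈ Ico (0 : ℝ) 1 := ae_restrict_mem measurableSet_Ico
  have hE : MeasurableSet {t : ℝ | 1 - t < R} := measurableSet_lt (by fun_prop) (by fun_prop)
  set Q := ball (0 : ℂ) 1 ∩ ball ω R with hQ
  have hQm : MeasurableSet Q := measurableSet_ball.inter measurableSet_ball
  set J : ℂ → ℝ≥0∞ := fun z => ∫⁻ w in ball 0 1 ∩ ball ω (3 * R), {w | z ∈ shadow w}.indicator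
        (fun w => ‖f w‖ₑ ^ p * ENNReal.ofReal ((1 - ‖w‖) ^ (α - β))) w with hJ
  have hpt : ∀ z ∈ Q, ‖cesaro μ f z‖ₑ ^ p * ENNReal.ofReal ((1 - ‖z‖) ^ (α + 1)) ≤
      2 ^ (p - 1) * (M * ENNReal.ofReal (A * κ ^ p * R ^ (-(α + 2))) *
        ENNReal.ofReal ((1 - ‖z‖) ^ (α + 1)) +
        ENNReal.ofReal (c ^ (p - 1) * (4 / Real.pi * 2 ^ |α - 1 - β| * 3) * κ ^ p) *
          (ENNReal.ofReal ((1 - ‖z‖) ^ (β - 1)) * J z)) := by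
    rintro z ⟨hz1, hz2⟩
    rw [mem_ball_zero_iff] at hz1
    rw [mem_ball, dist_eq_norm] at hz2
    have hx : 0 < 1 - ‖z‖ := by linarith
    have h1 := enorm_cesaro_le μ f z
    -- The cut is made at the radius R of the window under consideration, not at a scale depending
    -- on z.
    rw [radialMajorant, ← lintegral_add_compl _ hE] at h1
    have hfar := hM.setLIntegral_far_rpow_le hp hα hf hsupp hκ.le hν hβ hR hz1
    have hnear := setLIntegral_near_rpow_le hp hf hsupp hκ.le hν hβ0 hE hz1
    have hnear2 := setLIntegral_near_le_setLIntegral_shadow (α := α) hp hfm hf hsupp hκ.le hν β hω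
      hz1 hz2
    rw [show β * (p - 1) - 1 = α + 1 - β by linarith] at hnear
    replace hnear := hnear.trans (mul_le_mul_right hnear2 _)
    calc _ ≤ (_ + _) ^ p * ENNReal.ofReal ((1 - ‖z‖) ^ (α + 1)) := by gcongr
      _ ≤ (2 ^ (p - 1) * (_ ^ p + _ ^ p)) * ENNReal.ofReal ((1 - ‖z‖) ^ (α + 1)) := by
          gcongr
          exact ENNReal.rpow_add_le_mul_rpow_add_rpow _ _ hp
      _ ≤ _ := mul_le_mul_left (mul_le_mul_right (add_le_add hnear hfar) _) _
      _ = _ := by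
          rw [mul_assoc, add_comm, add_mul]
          congr 2
          rw [← mul_assoc, ← ENNReal.ofReal_mul (by positivity), mul_right_comm,
            ← ENNReal.ofReal_mul (by positivity), ← mul_assoc (ENNReal.ofReal (_ * κ ^ p)),
            ← ENNReal.ofReal_mul (by positivity)]
          congr 2
          rw [Real.mul_rpow hc0.le hκ.le]
          have e1 : (1 - ‖z‖) ^ (-(β * (p - 1))) * (1 - ‖z‖) ^ (α + 1) =
              (1 - ‖z‖) ^ (β - 1) := by
            rw [← Real.rpow_add hx]; congr 1; linarith
          have e2 : κ ^ p = κ ^ (p - 1) * κ := by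
            rw [← Real.rpow_add_one hκ.ne', sub_add_cancel]
          rw [← e1, e2]; ring
  -- The far bound does not depend on z: its factor R^(-(α+2)) meets the weight of the window,
  -- O(R^(α+3)), and leaves one power of R.
  have hW1 : ∫⁻ z in Q, ENNReal.ofReal ((1 - ‖z‖) ^ (α + 1)) ≤
      ENNReal.ofReal (W * R ^ (α + 1 + 2)) := by
    refine (lintegral_mono_set fun z hz => ?_).trans
      (setLIntegral_one_sub_norm_rpow_le (by linarith) hR ω)
    have hz1 := mem_ball_zero_iff.1 hz.1
    have hz2 := hz.2
    rw [mem_ball, dist_eq_norm] at hz2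
    have := norm_sub_norm_le ω z
    rw [norm_sub_rev, hω] at this
    exact ⟨hz1, by linarith, hz2⟩
  refine (setLIntegral_mono' hQm hpt).trans ?_
  have h2t : (2 : ℝ≥0∞) ^ (p - 1) ≠ ∞ := ENNReal.rpow_ne_top_of_nonneg (by linarith) (by simp)
  rw [lintegral_const_mul' _ _ h2t, lintegral_add_left' (by fun_prop),
    lintegral_const_mul _ (by fun_prop), lintegral_const_mul' _ _ ENNReal.ofReal_ne_top]
  calc _ ≤ 2 ^ (p - 1) * (M * ENNReal.ofReal (A * κ ^ p * R ^ (-(α + 2))) *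
        ENNReal.ofReal (W * R ^ (α + 1 + 2)) +
        ENNReal.ofReal (c ^ (p - 1) * (4 / Real.pi * 2 ^ |α - 1 - β| * 3) * κ ^ p) *
        (M * ENNReal.ofReal (6 * Real.pi / β * 3 ^ (β + 1) * (3 * R)))) := by
        gcongr
        exact hM.setLIntegral_shadow_le hfm hβ0 hR hω
    _ = _ := by
        rw [mul_assoc M, ← ENNReal.ofReal_mul (by positivity), mul_left_comm (ENNReal.ofReal _) M,
          ← ENNReal.ofReal_mul (by positivity), ← mul_add,
          ← ENNReal.ofReal_add (by positivity) (by positivity), mul_left_comm,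
          show (2 : ℝ≥0∞) = ENNReal.ofReal 2 by simp, ENNReal.ofReal_rpow_of_pos two_pos,
          ← ENNReal.ofReal_mul (by positivity), mul_assoc M, ← ENNReal.ofReal_mul (by positivity)]
        congr 2
        have e : R ^ (α + 1 + 2) = R ^ (α + 2) * R := by
          rw [← Real.rpow_add_one hR.ne']; congr 1; ring
        have e' : R ^ (-(α + 2)) * R ^ (α + 2) = 1 := by
          rw [← Real.rpow_add hR]; simp
        rw [e]
        linear_combination (2 ^ (p - 1) * A * κ ^ p * W * R) * e'

end TentSpace

/-! ### Analyticity, linearity and norm bounds for `cesaro`; Fatou property of the norm. -/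

namespace TentSpace

lemma exists_bound_of_continuousOn_ball {g : ℂ → ℂ} (hg : ContinuousOn g (ball 0 1)) {r : ℝ}
    (hr : r < 1) : ∃ B : ℝ, ∀ w : ℂ, ‖w‖ ≤ r → ‖g w‖ ≤ B := by
  obtain ⟨B, hB⟩ := (isCompact_closedBall (0 : ℂ) r).exists_bound_of_continuousOn
    (hg.mono (closedBall_subset_ball hr))
  exact ⟨B, fun w hw => hB w (by simpa using hw)⟩

lemma norm_ofReal_mul_le {t : ℝ} (ht : t ∈ Ico (0 : ℝ) 1) (z : ℂ) : ‖(t : ℂ) * z‖ ≤ ‖z‖ := by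
  rw [norm_ofReal_mul ht.1]
  nlinarith [ht.1, ht.2, norm_nonneg z]

lemma continuousOn_comp_ofReal_mul {g : ℂ → ℂ} (hg : ContinuousOn g (ball 0 1)) {z : ℂ}
    (hz : ‖z‖ < 1) : ContinuousOn (fun t : ℝ => g (t * z)) (Ico 0 1) :=
  hg.comp (by fun_prop) fun _ ht => ofReal_mul_mem_ball ht hz

lemma integrableOn_comp_ofReal_mul (μ : Measure ℝ) [IsFiniteMeasure μ] {g : ℂ → ℂ}
    (hg : ContinuousOn g (ball 0 1)) {z : ℂ} (hz : ‖z‖ < 1) :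
    IntegrableOn (fun t : ℝ => g (t * z)) (Ico 0 1) μ := by
  obtain ⟨B, hB⟩ := exists_bound_of_continuousOn_ball hg hz
  refine Integrable.of_bound
    ((continuousOn_comp_ofReal_mul hg hz).aestronglyMeasurable measurableSet_Ico) B ?_
  filter_upwards [ae_restrict_mem measurableSet_Ico] with t ht
  exact hB _ (norm_ofReal_mul_le ht z)

/-- The kernel depends only on tz, so C_μ f has this form with g(w) = f(w)/(1-w). Near z the points
tw stay in a compact disc, where g' is bounded, and differentiation under the integral is allowed.
-/
lemma differentiableOn_integral_comp_ofReal_mul (μ : Measure ℝ) [IsFiniteMeasure μ] {g : ℂ → ℂ}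
    (hg : DifferentiableOn ℂ g (ball 0 1)) :
    DifferentiableOn ℂ (fun z => ∫ t in Ico (0 : ℝ) 1, g (t * z) ∂μ) (ball 0 1) := by
  intro z hz
  rw [mem_ball_zero_iff] at hz
  obtain ⟨r, hzr, hr⟩ := exists_between hz
  have hg' : ContinuousOn (deriv g) (ball 0 1) := (hg.deriv isOpen_ball).continuousOn
  obtain ⟨B, hB⟩ := exists_bound_of_continuousOn_ball hg' hr
  refine DifferentiableAt.differentiableWithinAt ?_
  refine (hasDerivAt_integral_of_dominated_loc_of_deriv_le (μ := μ.restrict (Ico 0 1))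
    (F := fun (z : ℂ) (t : ℝ) => g (t * z)) (F' := fun z t => deriv g (t * z) * t)
    (s := ball 0 r) (bound := fun _ => B) (isOpen_ball.mem_nhds (by simpa using hzr)) ?_ ?_ ?_ ?_ ?_
    ?_).2.differentiableAt
  · filter_upwards [isOpen_ball.mem_nhds (show z ∈ ball (0 : ℂ) r by simpa using hzr)] with w hw
    exact (continuousOn_comp_ofReal_mul hg.continuousOn
      ((mem_ball_zero_iff.1 hw).trans hr)).aestronglyMeasurable measurableSet_Ico
  · exact integrableOn_comp_ofReal_mul μ hg.continuousOn hz
  · exact ((continuousOn_comp_ofReal_mul hg' hz).mul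
      (by fun_prop)).aestronglyMeasurable measurableSet_Ico
  · filter_upwards [ae_restrict_mem measurableSet_Ico] with t ht w hw
    have h1 := hB _ ((norm_ofReal_mul_le ht w).trans (mem_ball_zero_iff.1 hw).le)
    rw [norm_mul, Complex.norm_real, Real.norm_eq_abs, abs_of_nonneg ht.1]
    nlinarith [ht.1, ht.2, norm_nonneg (deriv g (t * w))]
  · exact integrable_const _
  · filter_upwards [ae_restrict_mem measurableSet_Ico] with t ht w hw
    have h1 : HasDerivAt g (deriv g (t * w)) (t * w) :=
      (hg.differentiableAt (isOpen_ball.mem_nhds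
        (ofReal_mul_mem_ball ht ((mem_ball_zero_iff.1 hw).trans hr)))).hasDerivAt
    have h2 : HasDerivAt (fun w : ℂ => (t : ℂ) * w) t w := by
      simpa using (hasDerivAt_id w).const_mul (t : ℂ)
    exact h1.comp w h2

lemma differentiableOn_div_one_sub {f : ℂ → ℂ} (hf : DifferentiableOn ℂ f (ball 0 1)) :
    DifferentiableOn ℂ (fun w => f w / (1 - w)) (ball 0 1) := by
  refine hf.div (by fun_prop) fun w hw h => ?_
  rw [mem_ball_zero_iff, ← sub_eq_zero.1 h, norm_one] at hw
  exact lt_irrefl _ hw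

lemma cesaro_of_mem (μ : Measure ℝ) (f : ℂ → ℂ) {z : ℂ} (hz : z ∈ ball (0 : ℂ) 1) :
    cesaro μ f z = ∫ t in Ico (0 : ℝ) 1, (fun w => f w / (1 - w)) (t * z) ∂μ := if_pos hz

lemma cesaro_of_notMem (μ : Measure ℝ) (f : ℂ → ℂ) {z : ℂ} (hz : z ∉ ball (0 : ℂ) 1) :
    cesaro μ f z = 0 := if_neg hz

lemma differentiableOn_cesaro (μ : Measure ℝ) [IsFiniteMeasure μ] {f : ℂ → ℂ}
    (hf : DifferentiableOn ℂ f (ball 0 1)) : DifferentiableOn ℂ (cesaro μ f) (ball 0 1) :=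
  (differentiableOn_integral_comp_ofReal_mul μ (differentiableOn_div_one_sub hf)).congr
    fun _ hz => cesaro_of_mem μ f hz

lemma cesaro_add (μ : Measure ℝ) [IsFiniteMeasure μ] {f g : ℂ → ℂ}
    (hf : DifferentiableOn ℂ f (ball 0 1)) (hg : DifferentiableOn ℂ g (ball 0 1)) :
    cesaro μ (f + g) = cesaro μ f + cesaro μ g := by
  funext z
  by_cases hz : z ∈ ball (0 : ℂ) 1
  · have hz1 := mem_ball_zero_iff.1 hz
    rw [Pi.add_apply, cesaro_of_mem μ _ hz, cesaro_of_mem μ _ hz, cesaro_of_mem μ _ hz,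
      ← integral_add (integrableOn_comp_ofReal_mul μ (differentiableOn_div_one_sub hf).continuousOn
        hz1) (integrableOn_comp_ofReal_mul μ (differentiableOn_div_one_sub hg).continuousOn hz1)]
    simp [add_div]
  · simp [cesaro_of_notMem μ _ hz]

lemma cesaro_smul (μ : Measure ℝ) (c : ℂ) (f : ℂ → ℂ) : cesaro μ (c • f) = c • cesaro μ f := by
  funext z
  by_cases hz : z ∈ ball (0 : ℂ) 1
  · rw [Pi.smul_apply, cesaro_of_mem μ _ hz, cesaro_of_mem μ _ hz, ← integral_smul]
    simp [mul_div_assoc]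
  · simp [cesaro_of_notMem μ _ hz]

lemma cesaro_add_measure (μ ν : Measure ℝ) [IsFiniteMeasure μ] [IsFiniteMeasure ν] {f : ℂ → ℂ}
    (hf : DifferentiableOn ℂ f (ball 0 1)) :
    cesaro (μ + ν) f = cesaro μ f + cesaro ν f := by
  funext z
  by_cases hz : z ∈ ball (0 : ℂ) 1
  · have hz1 := mem_ball_zero_iff.1 hz
    have hc := (differentiableOn_div_one_sub hf).continuousOn
    rw [Pi.add_apply, cesaro_of_mem _ _ hz, cesaro_of_mem _ _ hz, cesaro_of_mem _ _ hz,
      Measure.restrict_add]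
    exact integral_add_measure (integrableOn_comp_ofReal_mul μ hc hz1)
      (integrableOn_comp_ofReal_mul ν hc hz1)
  · simp [cesaro_of_notMem _ _ hz]

lemma rpow_mul_ofReal_le {p : ℝ} (hp : 0 < p) {a N : ℝ≥0∞} {C : ℝ} (hC : 0 ≤ C)
    (h : a ^ p ≤ N ^ p * ENNReal.ofReal C) : a ≤ ENNReal.ofReal (C ^ (1 / p)) * N := by
  rw [← ENNReal.rpow_le_rpow_iff hp, ENNReal.mul_rpow_of_nonneg _ _ hp.le,
    ENNReal.ofReal_rpow_of_nonneg (by positivity) hp.le, ← Real.rpow_mul hC, one_div,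
    inv_mul_cancel₀ hp.ne', Real.rpow_one, mul_comm]
  exact h

/-- The bound is linear in κ with C independent of μ; compactness comes from applying it to tails of
μ with small κ. -/
lemma exists_tentENorm_cesaro_le {p α ζ : ℝ} (hp : 1 ≤ p) (hα : -2 < α) (hζ : 1 / 2 < ζ) :
    ∃ C : ℝ, 0 < C ∧ ∀ (μ : Measure ℝ) [SFinite μ] (κ : ℝ), 0 < κ →
      (∀ s : ℝ, 0 < s → μ.restrict (Ico 0 1) {t | 1 - t < s} ≤
        ENNReal.ofReal κ * ENNReal.ofReal s) →
      ∀ f : ℂ → ℂ, Measurable f → DifferentiableOn ℂ f (ball 0 1) →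
      tentENorm p α ζ (cesaro μ f) ≤ ENNReal.ofReal (C * κ) * tentENorm p α ζ f := by
  have hp0 : 0 < p := by linarith
  obtain ⟨C₁, hC₁, h₁⟩ := exists_hasTentBound hp hα hζ
  obtain ⟨C₂, hC₂, h₂⟩ := exists_hasTentBound_cesaro hp hα
  refine ⟨(3 * 2 ^ |α + 1| * C₁ * C₂) ^ (1 / p), by positivity, ?_⟩
  intro μ _ κ hκ hμ f hfm hf
  have h := (h₂ μ κ hκ hμ f _ hfm hf (h₁ f hf)).tentENorm_rpow_le ζ hp
  rw [mul_comm, mul_assoc, mul_assoc, ← ENNReal.ofReal_mul (by positivity),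
    ← ENNReal.ofReal_mul (by positivity)] at h
  refine (rpow_mul_ofReal_le hp0 (by positivity) h).trans (le_of_eq ?_)
  congr 2
  rw [show C₁ * (C₂ * κ ^ p * (3 * 2 ^ |α + 1|)) = (3 * 2 ^ |α + 1| * C₁ * C₂) * κ ^ p by ring,
    Real.mul_rpow (by positivity) (by positivity), ← Real.rpow_mul hκ.le,
    mul_one_div_cancel hp0.ne', Real.rpow_one]

lemma exists_tentENorm_le_of_bounded {p α : ℝ} (ζ : ℝ) (hp : 1 ≤ p) (hα : -2 < α) :
    ∃ C : ℝ, 0 < C ∧ ∀ (f : ℂ → ℂ) (B : ℝ), 0 ≤ B → (∀ z ∈ ball (0 : ℂ) 1, ‖f z‖ ≤ B) →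
      tentENorm p α ζ f ≤ ENNReal.ofReal (C * B) := by
  have hp0 : 0 < p := by linarith
  have hπ := Real.pi_pos
  set W : ℝ := 6 * Real.pi / (α + 1 + 1) with hW
  have hW0 : 0 < W := by
    have : 0 < α + 1 + 1 := by linarith
    positivity
  refine ⟨(3 * 2 ^ |α + 1| * (W * 2 ^ (α + 2))) ^ (1 / p), by positivity, fun f B hB hfB => ?_⟩
  have hT : HasTentBound p α f (ENNReal.ofReal (B ^ p * (W * 2 ^ (α + 2)))) := by
    intro ω hω R hR
    calc _ ≤ ∫⁻ z in ball 0 1 ∩ ball ω (min R 2), ENNReal.ofReal (B ^ p) *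
          ENNReal.ofReal ((1 - ‖z‖) ^ (α + 1)) := by
          -- The weight of a window is O(R^(α+3)), which is not O(R) for large R. Since the disc
          -- lies within 2 of ω, the radius may be truncated at 2.
          have hsub : ball (0 : ℂ) 1 ∩ ball ω R ⊆ ball 0 1 ∩ ball ω (min R 2) := by
            rintro z ⟨h1, h2⟩
            refine ⟨h1, ?_⟩
            rw [mem_ball, lt_min_iff]
            refine ⟨h2, ?_⟩
            have := norm_sub_le z ω
            rw [dist_eq_norm]
            linarith [mem_ball_zero_iff.1 h1]
          refine (lintegral_mono_set hsub).trans ?_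
          refine setLIntegral_mono' (measurableSet_ball.inter measurableSet_ball) fun z hz => ?_
          gcongr
          rw [← ENNReal.ofReal_rpow_of_nonneg hB hp0.le]
          gcongr
          rw [← ofReal_norm]
          exact ENNReal.ofReal_le_ofReal (hfB z hz.1)
      _ ≤ ENNReal.ofReal (B ^ p) * ENNReal.ofReal (W * (min R 2) ^ (α + 1 + 2)) := by
          rw [lintegral_const_mul' _ _ ENNReal.ofReal_ne_top]
          gcongr
          refine (lintegral_mono_set fun z hz => ?_).trans
            (setLIntegral_one_sub_norm_rpow_le (by linarith) (by positivity) ω)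
          have hz1 := mem_ball_zero_iff.1 hz.1
          have hz2 := hz.2
          rw [mem_ball, dist_eq_norm] at hz2
          have := norm_sub_norm_le ω z
          rw [norm_sub_rev, hω] at this
          exact ⟨hz1, by linarith, hz2⟩
      _ ≤ _ := by
          rw [← ENNReal.ofReal_mul (by positivity), ← ENNReal.ofReal_mul (by positivity)]
          refine ENNReal.ofReal_le_ofReal ?_
          have hm : 0 < min R 2 := by positivity
          rw [show α + 1 + 2 = α + 2 + 1 by ring, Real.rpow_add_one hm.ne', mul_assoc, mul_assoc]
          gcongr
          · linarith
          · exact min_le_right _ _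
          · exact min_le_left _ _
  have h := hT.tentENorm_rpow_le ζ hp
  rw [← ENNReal.rpow_le_rpow_iff hp0, ENNReal.ofReal_rpow_of_nonneg (by positivity) hp0.le]
  refine h.trans (le_of_eq ?_)
  rw [← ENNReal.ofReal_mul (by positivity), Real.mul_rpow (by positivity) hB,
    ← Real.rpow_mul (by positivity), one_div, inv_mul_cancel₀ hp0.ne', Real.rpow_one]
  congr 1; ring

/-- Fatou's lemma on each box. The sequence is countable, so the exceptional null sets of boundary
points can be discarded together. -/
lemma tentENorm_le_of_tendsto {p α ζ : ℝ} (hp : 1 ≤ p) {f : ℕ → ℂ → ℂ} {g : ℂ → ℂ} {c : ℝ≥0∞}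
    (hfm : ∀ n, Measurable (f n)) (hfg : ∀ z, Tendsto (fun n => f n z) atTop (𝓝 (g z)))
    (hc : ∀ n, tentENorm p α ζ (f n) ≤ c) : tentENorm p α ζ g ≤ c := by
  have hp0 : 0 < p := by linarith
  have hbox : ∀ u : ℂ, ‖u‖ < 1 → ∀ b : ℝ≥0∞, (∀ n, boxAverage p α (f n) u ≤ b) → boxAverage p α g u ≤ b := by
    intro u hu b hb
    have hlim : ∀ z, ‖g z‖ₑ ^ p * ENNReal.ofReal ((1 - ‖z‖ ^ 2) ^ (α + 1)) = liminf (fun n =>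
        ‖f n z‖ₑ ^ p * ENNReal.ofReal ((1 - ‖z‖ ^ 2) ^ (α + 1))) atTop := by
      intro z
      refine (Tendsto.liminf_eq ?_).symm
      refine ENNReal.Tendsto.mul_const ?_ (Or.inr ENNReal.ofReal_ne_top)
      exact ((ENNReal.continuous_rpow_const (y := p)).tendsto _).comp (hfg z).enorm
    have hk : ENNReal.ofReal (1 - ‖u‖ ^ 2) ≠ 0 := by
      rw [Ne, ENNReal.ofReal_eq_zero, not_le]; nlinarith [norm_nonneg u]
    simp only [boxAverage, ENNReal.inv_mul_le_iff hk ENNReal.ofReal_ne_top] at hb ⊢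
    simp_rw [hlim]
    refine (lintegral_liminf_le fun n => ?_).trans
      (liminf_le_of_frequently_le' (Frequently.of_forall hb))
    have := hfm n
    fun_prop
  rw [tentENorm, one_div, ENNReal.rpow_inv_le_iff hp0]
  refine essSup_le_of_ae_le _ ?_
  have hall : ∀ᵐ θ : ℝ ∂(volume.restrict (Ioc (-Real.pi) Real.pi)), ∀ n,
      (⨆ u ∈ approachRegion ζ (Complex.exp (θ * Complex.I)), boxAverage p α (f n) u) ≤ c ^ p := by
    rw [ae_all_iff]
    intro n
    have h := hc n
    rw [tentENorm, one_div, ENNReal.rpow_inv_le_iff hp0] at h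
    filter_upwards [ENNReal.ae_le_essSup (μ := volume.restrict (Ioc (-Real.pi) Real.pi))
      (fun θ : ℝ => ⨆ u ∈ approachRegion ζ (Complex.exp (θ * Complex.I)), boxAverage p α (f n) u)]
      with θ hθ using hθ.trans h
  filter_upwards [hall] with θ hθ
  refine iSup₂_le fun u hu => hbox u hu.1 _ fun n => ?_
  exact (le_iSup₂_of_le (f := fun v _ => boxAverage p α (f n) v) u hu le_rfl).trans (hθ n)

end TentSpace

/-! ### Sufficiency: vanishing Carleson measures give compact operators. -/

namespace TentSpace

namespace AT

variable {p α ζ : ℝ} [hp : Fact (1 ≤ p)]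

lemma differentiableOn (f : AT p α ζ) : DifferentiableOn ℂ f (ball 0 1) := f.2.1

lemma eq_zero (f : AT p α ζ) {z : ℂ} (hz : z ∉ ball (0 : ℂ) 1) : f z = 0 := f.2.2.1 z hz

lemma tentENorm_lt_top (f : AT p α ζ) : tentENorm p α ζ f < ∞ := f.2.2.2

lemma toFun_injective : Function.Injective (toFun : AT p α ζ → ℂ → ℂ) := Subtype.val_injective

@[simp] lemma toFun_sub (f g : AT p α ζ) : (f - g : AT p α ζ).toFun = f.toFun - g.toFun := rfl

@[simp] lemma toFun_zero : (0 : AT p α ζ).toFun = 0 := rfl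

lemma measurable (f : AT p α ζ) : Measurable (f : ℂ → ℂ) := by
  classical
  have : (f : ℂ → ℂ) = (ball (0 : ℂ) 1).piecewise f (fun _ => 0) := by
    funext z
    by_cases hz : z ∈ ball (0 : ℂ) 1
    · rw [piecewise_eq_of_mem _ _ _ hz]
    · rw [piecewise_eq_of_notMem _ _ _ hz, f.eq_zero hz]
  rw [this]
  exact f.differentiableOn.continuousOn.measurable_piecewise continuousOn_const measurableSet_ball

/-- The element of the tent space given by a function that is analytic on the disk. -/
def ofFun (g : ℂ → ℂ) (hg : DifferentiableOn ℂ g (ball 0 1)) (hg0 : ∀ z ∉ ball (0 : ℂ) 1, g z = 0)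
    (hgt : tentENorm p α ζ g < ∞) : AT p α ζ :=
  (⟨g, hg, hg0, hgt⟩ : atSubmodule p α ζ)

@[simp] lemma toFun_ofFun (g : ℂ → ℂ) (hg : DifferentiableOn ℂ g (ball 0 1))
    (hg0 : ∀ z ∉ ball (0 : ℂ) 1, g z = 0) (hgt : tentENorm p α ζ g < ∞) :
    (ofFun g hg hg0 hgt).toFun = g := rfl

lemma ofReal_norm (f : AT p α ζ) : ENNReal.ofReal ‖f‖ = tentENorm p α ζ f :=
  ENNReal.ofReal_toReal f.tentENorm_lt_top.ne

lemma norm_le_of_tentENorm_le {f : AT p α ζ} {c : ℝ} (hc : 0 ≤ c)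
    (h : tentENorm p α ζ f ≤ ENNReal.ofReal c) : ‖f‖ ≤ c :=
  ENNReal.toReal_le_of_le_ofReal hc h

variable [hζ : Fact (1 / 2 < ζ)]

/-- Point evaluations are bounded, with the sharp order of growth at the unit circle. -/
lemma exists_norm_apply_le (hα : -2 < α) :
    ∃ C : ℝ, 0 < C ∧ ∀ (f : AT p α ζ) (z : ℂ), ‖z‖ < 1 →
      ‖f z‖ ≤ C * (1 - ‖z‖) ^ (-((α + 2) / p)) * ‖f‖ := by
  have hπ := Real.pi_pos
  have hp0 : 0 < p := by linarith [hp.out]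
  obtain ⟨C, hC, h⟩ := exists_hasTentBound hp.out hα hζ.out
  refine ⟨(C * (8 / Real.pi * 2 ^ |α + 1|)) ^ (1 / p), by positivity, fun f z hz => ?_⟩
  have hx : 0 < 1 - ‖z‖ := by linarith
  have h1 := (h f f.differentiableOn).enorm_rpow_le hp.out f.differentiableOn hz
  rw [mul_assoc, ← ENNReal.ofReal_mul hC.le] at h1
  have h2 := rpow_mul_ofReal_le hp0 (by positivity) h1
  rw [← f.ofReal_norm, ← ENNReal.ofReal_mul (by positivity), ← _root_.ofReal_norm] at h2
  have h3 := (ENNReal.ofReal_le_ofReal_iff (mul_nonneg (by positivity) (norm_nonneg _))).1 h2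
  refine h3.trans (le_of_eq ?_)
  rw [← mul_assoc C, Real.mul_rpow (by positivity) (by positivity), ← Real.rpow_mul hx.le]
  congr 3
  ring

lemma continuous_apply (hα : -2 < α) (z : ℂ) : Continuous fun f : AT p α ζ => f z := by
  by_cases hz : ‖z‖ < 1
  · obtain ⟨C, hC, h⟩ := exists_norm_apply_le (p := p) (ζ := ζ) hα
    refine continuous_iff_continuousAt.2 fun f => ?_
    rw [ContinuousAt, tendsto_iff_norm_sub_tendsto_zero]
    refine squeeze_zero (fun _ => norm_nonneg _) (fun g => h (g - f) z hz) ?_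
    have : Continuous fun g : AT p α ζ => C * (1 - ‖z‖) ^ (-((α + 2) / p)) * ‖g - f‖ := by
      fun_prop
    simpa using this.tendsto f
  · have : (fun f : AT p α ζ => f z) = fun _ => 0 :=
      funext fun f => f.eq_zero (by simpa using hz)
    rw [this]
    exact continuous_const

end AT

lemma IsVanishingCarleson.exists_measure_Ico_le {μ : Measure ℝ} [IsFiniteMeasure μ]
    (h : IsVanishingCarleson μ) {δ : ℝ} (hδ : 0 < δ) :
    ∃ r : ℝ, 0 ≤ r ∧ r < 1 ∧ ∀ t : ℝ, r < t → t < 1 → μ (Ico t 1) ≤ ENNReal.ofReal (δ * (1 - t)) := by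
  have h1 := h.eventually_lt_const hδ
  obtain ⟨r, hr, hsub⟩ := (mem_nhdsLT_iff_exists_mem_Ico_Ioo_subset zero_lt_one).1 h1
  refine ⟨r, hr.1, hr.2, fun t ht ht1 => ?_⟩
  have h2 : μ.real (Ico t 1) / (1 - t) < δ := hsub ⟨ht, ht1⟩
  rw [div_lt_iff₀ (by linarith)] at h2
  rw [← ofReal_measureReal]
  exact ENNReal.ofReal_le_ofReal h2.le

/-- Cutting off below r' makes the constant δ valid at every scale: when 1-s ≤ r, the whole
restricted measure has mass at most δ(1-r') ≤ δs. -/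
lemma restrict_Ici_distribution_le {μ : Measure ℝ} {δ r : ℝ} (hδ : 0 ≤ δ)
    (h : ∀ t : ℝ, r < t → t < 1 → μ (Ico t 1) ≤ ENNReal.ofReal (δ * (1 - t))) {r' : ℝ}
    (hr' : r < r') (hr1 : r' < 1) (s : ℝ) (hs : 0 < s) :
    (μ.restrict (Ici r')).restrict (Ico 0 1) {t | 1 - t < s} ≤
      ENNReal.ofReal δ * ENNReal.ofReal s := by
  have hE : MeasurableSet {t : ℝ | 1 - t < s} := measurableSet_lt (by fun_prop) (by fun_prop)
  rw [Measure.restrict_apply hE, Measure.restrict_apply (hE.inter measurableSet_Ico),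
    ← ENNReal.ofReal_mul hδ]
  rcases lt_or_ge r (1 - s) with hc | hc
  · have := h (1 - s) hc (by linarith)
    rw [sub_sub_cancel] at this
    refine (measure_mono ?_).trans this
    rintro t ⟨⟨h1, h2⟩, -⟩
    exact ⟨by linarith [show 1 - t < s from h1], h2.2⟩
  · refine (measure_mono (t := Ico r' 1) ?_).trans ((h r' hr' hr1).trans ?_)
    · rintro t ⟨⟨-, h2⟩, h3⟩
      exact ⟨h3, h2.2⟩
    · gcongr
      linarith

/-- A Carleson bound near 1 is global up to the constant, since for s ≥ 1-r the total mass is at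
most μ(ℝ)s/(1-r). -/
lemma distribution_le {μ : Measure ℝ} [IsFiniteMeasure μ] {r : ℝ} (hr : r < 1)
    (h : ∀ t : ℝ, r < t → t < 1 → μ (Ico t 1) ≤ ENNReal.ofReal (1 * (1 - t))) (s : ℝ)
    (hs : 0 < s) :
    μ.restrict (Ico 0 1) {t | 1 - t < s} ≤
      ENNReal.ofReal (1 + μ.real univ / (1 - r)) * ENNReal.ofReal s := by
  have hr0 : 0 < 1 - r := by linarith
  have hE : MeasurableSet {t : ℝ | 1 - t < s} := measurableSet_lt (by fun_prop) (by fun_prop)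
  rw [Measure.restrict_apply hE, ← ENNReal.ofReal_mul (by positivity)]
  have h0 : 0 ≤ μ.real univ / (1 - r) := by positivity
  rcases lt_or_ge r (1 - s) with hc | hc
  · have := h (1 - s) hc (by linarith)
    rw [sub_sub_cancel] at this
    refine (measure_mono ?_).trans (this.trans (ENNReal.ofReal_le_ofReal ?_))
    · rintro t ⟨h1, h2⟩
      exact ⟨by linarith [show 1 - t < s from h1], h2.2⟩
    · nlinarith
  · refine (measure_mono (subset_univ _)).trans ?_
    rw [← ofReal_measureReal (s := univ)]
    refine ENNReal.ofReal_le_ofReal ?_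
    have h1 : μ.real univ / (1 - r) * (1 - r) = μ.real univ := by field_simp
    have h2 : μ.real univ / (1 - r) * (1 - r) ≤ μ.real univ / (1 - r) * s := by
      gcongr
      linarith
    nlinarith

lemma norm_cesaro_restrict_Iio_le (μ : Measure ℝ) [IsFiniteMeasure μ] {f : ℂ → ℂ} {r η : ℝ}
    (hr : r < 1) (hη : 0 ≤ η) (hf : ∀ w : ℂ, ‖w‖ ≤ r → ‖f w‖ ≤ η) {z : ℂ}
    (hz : z ∈ ball (0 : ℂ) 1) :
    ‖cesaro (μ.restrict (Iio r)) f z‖ ≤ η / (1 - r) * μ.real univ := by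
  have hz1 := mem_ball_zero_iff.1 hz
  have hr0 : 0 < 1 - r := by linarith
  rw [cesaro_of_mem _ _ hz]
  refine (norm_integral_le_of_norm_le_const (C := η / (1 - r)) ?_).trans ?_
  · filter_upwards [ae_restrict_mem measurableSet_Ico,
      ae_restrict_of_ae (ae_restrict_mem measurableSet_Iio)] with t ht htr
    replace htr : t < r := htr
    have h1 : ‖(t : ℂ) * z‖ ≤ r := by
      rw [norm_ofReal_mul ht.1]; nlinarith [ht.1, norm_nonneg z]
    rw [norm_div]
    have h2 := norm_sub_norm_le (1 : ℂ) (t * z)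
    rw [norm_one] at h2
    gcongr
    · exact hf _ h1
    · linarith
  · gcongr
    rw [measureReal_restrict_apply_univ]
    refine (measureReal_mono (subset_univ _)).trans ?_
    rw [measureReal_restrict_apply_univ]
    exact measureReal_mono (subset_univ _)

variable {p α ζ : ℝ} [hp : Fact (1 ≤ p)] [hζ : Fact (1 / 2 < ζ)] {μ : Measure ℝ}
  [IsFiniteMeasure μ]

lemma exists_cesaroCLM (hα : -2 < α) {κ : ℝ} (hκ : 0 < κ)
    (hμ : ∀ s : ℝ, 0 < s → μ.restrict (Ico 0 1) {t | 1 - t < s} ≤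
        ENNReal.ofReal κ * ENNReal.ofReal s) :
    ∃ T : AT p α ζ →L[ℂ] AT p α ζ, ∀ f : AT p α ζ, (T f : ℂ → ℂ) = cesaro μ f := by
  obtain ⟨C, hC, h⟩ := exists_tentENorm_cesaro_le hp.out hα hζ.out
  have hb := fun f : AT p α ζ => h μ κ hκ hμ f f.measurable f.differentiableOn
  let L : AT p α ζ →ₗ[ℂ] AT p α ζ :=
    { toFun := fun f => AT.ofFun (cesaro μ f) (differentiableOn_cesaro μ f.differentiableOn)
        (fun z hz => cesaro_of_notMem μ f hz)
        ((hb f).trans_lt (ENNReal.mul_lt_top ENNReal.ofReal_lt_top f.tentENorm_lt_top))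
      map_add' := fun f g => AT.toFun_injective
        (cesaro_add μ f.differentiableOn g.differentiableOn)
      map_smul' := fun c f => AT.toFun_injective (cesaro_smul μ c f) }
  refine ⟨L.mkContinuous (C * κ) fun f => ?_, fun f => rfl⟩
  refine AT.norm_le_of_tentENorm_le (mul_nonneg (by positivity) (norm_nonneg f)) ?_
  rw [ENNReal.ofReal_mul (by positivity)]
  refine (hb f).trans (le_of_eq ?_)
  congr 1
  exact f.ofReal_norm.symm

/-- `C_μ` maps bounded sequences that tend to zero locally uniformly to null sequences. -/
lemma tendsto_cesaro_zero (hα : -2 < α) (h : IsVanishingCarleson μ)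
    {T : AT p α ζ →L[ℂ] AT p α ζ} (hT : ∀ f : AT p α ζ, (T f : ℂ → ℂ) = cesaro μ f)
    {f : ℕ → AT p α ζ} {D : ℝ} (hD : 0 < D) (hfD : ∀ n, ‖f n‖ ≤ D)
    (hf : ∀ r < 1, TendstoUniformlyOn (fun n => (f n : ℂ → ℂ)) 0 atTop (closedBall 0 r)) :
    Tendsto (fun n => T (f n)) atTop (𝓝 0) := by
  obtain ⟨C₁, hC₁, h₁⟩ := exists_tentENorm_cesaro_le hp.out hα hζ.out
  obtain ⟨C₂, hC₂, h₂⟩ := exists_tentENorm_le_of_bounded ζ hp.out hα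
  rw [Metric.tendsto_nhds]
  intro ε hε
  -- With this δ the tail contributes at most C₁δD = ε/4.
  obtain ⟨r, hr0, hr1, hr⟩ := h.exists_measure_Ico_le (δ := ε / (4 * C₁ * D)) (by positivity)
  obtain ⟨r', hr', hr1'⟩ := exists_between hr1
  set m := μ.real univ with hm
  have hm0 : 0 ≤ m := measureReal_nonneg
  have h1r : 0 < 1 - r' := by linarith
  -- Makes the inner part C₂ηm/(1-r') at most ε/4; m + 1 keeps the quotient meaningful when μ = 0.
  set η := ε * (1 - r') / (4 * C₂ * (m + 1)) with hη
  have hη0 : 0 < η := by positivity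
  filter_upwards [Metric.tendstoUniformlyOn_iff.1 (hf r' hr1') η hη0] with n hn
  rw [dist_zero_right]
  have hsplit : μ = μ.restrict (Iio r') + μ.restrict (Ici r') := by
    rw [← compl_Iio, Measure.restrict_add_restrict_compl measurableSet_Iio]
  have e1 : tentENorm p α ζ (cesaro (μ.restrict (Iio r')) (f n)) ≤ ENNReal.ofReal (ε / 4) := by
    refine (h₂ _ (η / (1 - r') * m) (by positivity) fun z hz =>
      norm_cesaro_restrict_Iio_le μ hr1' hη0.le (fun w hw => ?_) hz).trans
        (ENNReal.ofReal_le_ofReal ?_)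
    · have := hn w (by simpa using hw)
      rw [Pi.zero_apply, dist_zero_left] at this
      exact this.le
    · have e : C₂ * (η / (1 - r') * m) = ε / 4 * (m / (m + 1)) := by
        rw [hη]; field_simp
      rw [e]
      exact mul_le_of_le_one_right (by positivity) (div_le_one_of_le₀ (by linarith) (by linarith))
  have e2 : tentENorm p α ζ (cesaro (μ.restrict (Ici r')) (f n)) ≤ ENNReal.ofReal (ε / 4) := by
    refine (h₁ (μ.restrict (Ici r')) _ (by positivity)
      (restrict_Ici_distribution_le (by positivity) hr hr' hr1') (f n) (f n).measurable
      (f n).differentiableOn).trans ?_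
    rw [← (f n).ofReal_norm, ← ENNReal.ofReal_mul (by positivity)]
    refine ENNReal.ofReal_le_ofReal ?_
    calc _ ≤ C₁ * (ε / (4 * C₁ * D)) * D := by gcongr; exact hfD n
      _ = ε / 4 := by field_simp
  have e3 : tentENorm p α ζ (T (f n)) ≤ ENNReal.ofReal (ε / 2) := by
    rw [hT, hsplit, cesaro_add_measure _ _ (f n).differentiableOn]
    refine (tentENorm_add_le p α ζ hp.out (differentiableOn_cesaro _ (f n).differentiableOn)
      (differentiableOn_cesaro _ (f n).differentiableOn)).trans ((add_le_add e1 e2).trans ?_)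
    rw [← ENNReal.ofReal_add (by positivity) (by positivity)]
    exact ENNReal.ofReal_le_ofReal (by linarith)
  have := AT.norm_le_of_tentENorm_le (by positivity) e3
  calc ‖T (f n)‖ ≤ ε / 2 := this
    _ < ε := by linarith

/-- Bounded sequences in the tent space have locally uniformly convergent subsequences, with limit
in the closed ball. -/
lemma AT.exists_subseq_tendsto (hα : -2 < α) {f : ℕ → AT p α ζ} (hf : ∀ n, ‖f n‖ ≤ 1) :
    ∃ (φ : ℕ → ℕ) (g : AT p α ζ), StrictMono φ ∧ ‖g‖ ≤ 1 ∧ ∀ r < 1,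
      TendstoUniformlyOn (fun n => ((f (φ n) - g : AT p α ζ) : ℂ → ℂ)) 0 atTop
        (closedBall 0 r) := by
  classical
  have hp0 : 0 < p := by linarith [hp.out]
  obtain ⟨C, hC, hCf⟩ := AT.exists_norm_apply_le (p := p) (ζ := ζ) hα
  have hβ : 0 ≤ (α + 2) / p := div_nonneg (by linarith) hp0.le
  obtain ⟨φ, hφ, g₀, hg₀, hu⟩ := exists_subseq_tendstoUniformlyOn_closedBall
    (f := fun n => (f n : ℂ → ℂ)) (B := fun r => C * (1 - r) ^ (-((α + 2) / p)))
    (fun n => (f n).differentiableOn) (by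
      intro r hr0 hr1 n z hz
      refine (hCf (f n) z (hz.trans_lt hr1)).trans ?_
      have h1 : (1 - ‖z‖) ^ (-((α + 2) / p)) ≤ (1 - r) ^ (-((α + 2) / p)) :=
        Real.rpow_le_rpow_of_nonpos (by linarith) (by linarith) (by linarith)
      have h2 : 0 ≤ (1 - ‖z‖) ^ (-((α + 2) / p)) := Real.rpow_nonneg (by linarith) _
      calc _ ≤ C * (1 - r) ^ (-((α + 2) / p)) * 1 := by
            refine mul_le_mul ?_ (hf n) (norm_nonneg _) (by positivity)
            gcongr
        _ = _ := mul_one _)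
  -- The limit from Montel's theorem is arbitrary off the disc, whereas elements of the space vanish
  -- there.
  set g : ℂ → ℂ := (ball (0 : ℂ) 1).indicator g₀ with hg
  have hgd : DifferentiableOn ℂ g (ball 0 1) :=
    hg₀.congr fun z hz => indicator_of_mem hz _
  have hlim : ∀ z, Tendsto (fun n => f (φ n) z) atTop (𝓝 (g z)) := by
    intro z
    by_cases hz : z ∈ ball (0 : ℂ) 1
    · rw [hg, indicator_of_mem hz]
      exact (hu ‖z‖ (mem_ball_zero_iff.1 hz)).tendsto_at (by simp)
    · rw [hg, indicator_of_notMem hz]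
      simp only [(f _).eq_zero hz]
      exact tendsto_const_nhds
  have hle : tentENorm p α ζ g ≤ ENNReal.ofReal 1 := by
    refine tentENorm_le_of_tendsto hp.out (fun n => (f (φ n)).measurable) hlim fun n => ?_
    rw [← (f (φ n)).ofReal_norm]
    exact ENNReal.ofReal_le_ofReal (hf _)
  refine ⟨φ, AT.ofFun g hgd (fun z hz => indicator_of_notMem hz _)
    (hle.trans_lt ENNReal.ofReal_lt_top), hφ, AT.norm_le_of_tentENorm_le zero_le_one hle, ?_⟩
  intro r hr
  have h1 := hu r hr
  rw [Metric.tendstoUniformlyOn_iff] at h1 ⊢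
  intro ε hε
  filter_upwards [h1 ε hε] with n hn z hz
  have h2 := hn z hz
  rw [AT.toFun_sub, AT.toFun_ofFun, Pi.zero_apply, dist_zero_left, Pi.sub_apply, hg,
    indicator_of_mem (closedBall_subset_ball hr hz), ← dist_eq_norm, dist_comm]
  exact h2

/-- The limits g stay in the closed unit ball, so the image of that ball is itself sequentially
compact and no closure is needed. -/
lemma IsVanishingCarleson.cesaroCompactOn (hα : -2 < α) (h : IsVanishingCarleson μ) :
    CesaroCompactOn p α ζ μ := by
  obtain ⟨r, hr0, hr1, hr⟩ := h.exists_measure_Ico_le one_pos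
  have h1r : 0 < 1 - r := by linarith
  obtain ⟨T, hT⟩ := exists_cesaroCLM (p := p) (ζ := ζ) hα
    (κ := 1 + μ.real univ / (1 - r)) (by positivity) (distribution_le hr1 hr)
  refine ⟨T, hT, T '' closedBall 0 1, ?_, ?_⟩
  · refine IsSeqCompact.isCompact fun x hx => ?_
    choose f hf hfx using hx
    obtain ⟨φ, g, hφ, hg, hu⟩ := AT.exists_subseq_tendsto hα
      (fun n => by simpa using hf n : ∀ n, ‖f n‖ ≤ 1)
    refine ⟨T g, ⟨g, by simpa using hg, rfl⟩, φ, hφ, ?_⟩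
    have h2 := tendsto_cesaro_zero hα h hT (f := fun n => f (φ n) - g) (D := 2) two_pos
      (fun n => by
        have h3 : ‖f (φ n)‖ ≤ 1 := by simpa using hf (φ n)
        exact (norm_sub_le _ _).trans (by linarith)) hu
    simp only [map_sub] at h2
    have h4 : x ∘ φ = fun n => T (f (φ n)) := funext fun n => (hfx (φ n)).symm
    rw [h4]
    exact tendsto_sub_nhds_zero_iff.1 h2
  · exact mem_of_superset (closedBall_mem_nhds 0 one_pos) (subset_preimage_image T _)

end TentSpace

/-! ### Necessity: test functions concentrating at the point 1. -/

namespace TentSpace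

/-- Test functions that concentrate at the boundary point `1` as `a → 1`. -/
noncomputable def testFun (n : ℕ) (b a : ℝ) : ℂ → ℂ :=
  (ball (0 : ℂ) 1).indicator fun z => (((1 - a) ^ b : ℝ) : ℂ) / (1 - a * z) ^ n

section testFun

variable {a : ℝ} (ha : a ∈ Ioo (0 : ℝ) 1) {z : ℂ}
include ha

lemma one_sub_le_norm_one_sub_mul (hz : ‖z‖ ≤ 1) : 1 - a ≤ ‖1 - a * z‖ := by
  have h := norm_sub_norm_le (1 : ℂ) (a * z)
  rw [norm_one, norm_ofReal_mul ha.1.le] at h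
  nlinarith [ha.1]

lemma one_sub_norm_le_norm_one_sub_mul : 1 - ‖z‖ ≤ ‖1 - a * z‖ := by
  have h := norm_sub_norm_le (1 : ℂ) (a * z)
  rw [norm_one, norm_ofReal_mul ha.1.le] at h
  nlinarith [ha.2, norm_nonneg z]

/-- From z-1 = -(1-az) + (1-a)z and 1-a ≤ |1-az|. It lets |1-az| be replaced by (1-a) + |z-1|, to
which the moment estimate applies. -/
lemma add_norm_one_sub_le (hz : ‖z‖ ≤ 1) : 1 - a + ‖z - 1‖ ≤ 3 * ‖1 - a * z‖ := by
  have h1 := one_sub_le_norm_one_sub_mul ha hz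
  have h2 : ‖z - 1‖ ≤ ‖1 - a * z‖ + (1 - a) * ‖z‖ := by
    have e : z - 1 = -(1 - a * z) + ((1 - a : ℝ) : ℂ) * z := by push_cast; ring
    rw [e]
    refine (norm_add_le _ _).trans ?_
    rw [norm_neg, norm_ofReal_mul (by linarith [ha.2])]
  nlinarith [ha.2]

lemma differentiableOn_testFun (n : ℕ) (b : ℝ) : DifferentiableOn ℂ (testFun n b a) (ball 0 1) := by
  have h : DifferentiableOn ℂ (fun z : ℂ => (((1 - a) ^ b : ℝ) : ℂ) / (1 - a * z) ^ n)
      (ball 0 1) := by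
    refine (differentiableOn_const _).div (by fun_prop) fun z hz => pow_ne_zero _ ?_
    rw [← norm_pos_iff]
    exact lt_of_lt_of_le (by linarith [ha.2])
      (one_sub_le_norm_one_sub_mul ha (mem_ball_zero_iff.1 hz).le)
  exact h.congr fun z hz => indicator_of_mem hz _

lemma norm_testFun (n : ℕ) (b : ℝ) (hz : z ∈ ball (0 : ℂ) 1) :
    ‖testFun n b a z‖ = (1 - a) ^ b / ‖1 - a * z‖ ^ n := by
  have : 0 < 1 - a := by linarith [ha.2]
  rw [testFun, indicator_of_mem hz, norm_div, norm_pow, Complex.norm_real, Real.norm_eq_abs,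
    abs_of_pos (by positivity)]

lemma enorm_testFun_rpow (p : ℝ) (n : ℕ) (b : ℝ) (hz : z ∈ ball (0 : ℂ) 1) :
    ‖testFun n b a z‖ₑ ^ p =
      ENNReal.ofReal ((1 - a) ^ (b * p) * ‖1 - a * z‖ ^ (-(n * p))) := by
  have h1 : 0 < 1 - a := by linarith [ha.2]
  have h2 : 0 < ‖1 - a * z‖ :=
    h1.trans_le (one_sub_le_norm_one_sub_mul ha (mem_ball_zero_iff.1 hz).le)
  rw [← ofReal_norm, norm_testFun ha n b hz, ENNReal.ofReal_rpow_of_pos (by positivity),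
    Real.div_rpow (by positivity) (by positivity), ← Real.rpow_mul h1.le, ← Real.rpow_natCast,
    ← Real.rpow_mul h2.le, Real.rpow_neg h2.le, div_eq_mul_inv]

end testFun

lemma setLIntegral_window_le {γ : ℝ} (hγ : -1 < γ) {ω : ℂ} (hω : ‖ω‖ = 1) {R : ℝ} (hR : 0 < R) :
    ∫⁻ z in ball 0 1 ∩ ball ω R, ENNReal.ofReal ((1 - ‖z‖) ^ γ) ≤
      ENNReal.ofReal (6 * Real.pi / (γ + 1) * R ^ (γ + 2)) := by
  refine (lintegral_mono_set fun z hz => ?_).trans (setLIntegral_one_sub_norm_rpow_le hγ hR ω)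
  have hz1 := mem_ball_zero_iff.1 hz.1
  have hz2 := hz.2
  rw [mem_ball, dist_eq_norm] at hz2
  have := norm_sub_norm_le ω z
  rw [norm_sub_rev, hω] at this
  exact ⟨hz1, by linarith, hz2⟩

/-- A Forelli-Rudin type estimate. -/
lemma lintegral_add_norm_sub_one_rpow_neg_le {γ c ε : ℝ} (hγ : -1 < γ) (hc : γ + 2 < c)
    (hε : 0 < ε) :
    ∫⁻ z in ball (0 : ℂ) 1, ENNReal.ofReal ((1 - ‖z‖) ^ γ) *
      ENNReal.ofReal ((ε + ‖z - 1‖) ^ (-c)) ≤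
      ENNReal.ofReal (6 * Real.pi / (γ + 1) * (c / (c - (γ + 2))) * ε ^ (γ + 2 - c)) := by
  have hπ := Real.pi_pos
  have h1 : 0 < γ + 1 := by linarith
  set D : ℂ → ℝ≥0∞ := fun z => ENNReal.ofReal ((1 - ‖z‖) ^ γ) with hD
  have hDm : Measurable D := by fun_prop
  have h := lintegral_add_rpow_neg_le
    (ν := (volume.restrict (ball (0 : ℂ) 1)).withDensity D) (ρ := fun z => ‖z - 1‖)
    (by fun_prop) (ae_of_all _ fun z => norm_nonneg _) (K := ENNReal.ofReal (6 * Real.pi / (γ + 1)))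
    (c := c) (d := γ + 2) (by linarith) hc hε (by
      intro s hs
      have hE : MeasurableSet {z : ℂ | ‖z - 1‖ < s} := measurableSet_lt (by fun_prop) (by fun_prop)
      rw [withDensity_apply _ hE, Measure.restrict_restrict hE, ← ENNReal.ofReal_mul (by positivity)]
      refine (lintegral_mono_set ?_).trans (setLIntegral_window_le hγ norm_one hs)
      rintro z ⟨h2, h3⟩
      exact ⟨h3, by rw [mem_ball, dist_eq_norm]; exact h2⟩)
  rw [lintegral_withDensity_eq_lintegral_mul _ hDm (by fun_prop),
    ← ENNReal.ofReal_mul (by positivity), ← mul_assoc] at h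
  exact h

/-- Two regimes. For R ≤ 1-a the crude bound |F_a|^p ≤ (1-a)^(-(α+2)) suffices. For R > 1-a the
total mass is already O(1-a) by the Forelli-Rudin estimate, which needs np > α+3. -/
lemma exists_hasTentBound_testFun {p α : ℝ} (hp : 1 ≤ p) (hα : -2 < α) {n : ℕ}
    (hn : α + 5 ≤ n * p) :
    ∃ C : ℝ, 0 < C ∧ ∀ a ∈ Ioo (0 : ℝ) 1,
      HasTentBound p α (testFun n (n - (α + 2) / p) a) (ENNReal.ofReal C) := by
  have hπ := Real.pi_pos
  have hp0 : 0 < p := by linarith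
  have hα2 : 0 < α + 1 + 1 := by linarith
  set W : ℝ := 6 * Real.pi / (α + 1 + 1) with hW
  have hW0 : 0 < W := by positivity
  set c : ℝ := n * p with hc
  have hcd : 0 < c - (α + 1 + 2) := by linarith
  have hc0 : 0 < c := by linarith
  have hbp : (n - (α + 2) / p) * p = c - (α + 2) := by rw [hc]; field_simp
  refine ⟨W + 3 ^ c * (W * (c / (c - (α + 1 + 2)))), by positivity, ?_⟩
  intro a ha ω hω R hR
  have hε : 0 < 1 - a := by linarith [ha.2]
  set ε := 1 - a with hεdef
  have hQm : MeasurableSet (ball (0 : ℂ) 1 ∩ ball ω R) := measurableSet_ball.inter measurableSet_ball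
  rcases le_or_gt R ε with hRε | hRε
  · calc _ ≤ ∫⁻ z in ball 0 1 ∩ ball ω R, ENNReal.ofReal (ε ^ (-(α + 2))) *
          ENNReal.ofReal ((1 - ‖z‖) ^ (α + 1)) := by
          refine setLIntegral_mono' hQm fun z hz => ?_
          rw [enorm_testFun_rpow ha p n _ hz.1, hbp]
          gcongr
          have h1 := one_sub_le_norm_one_sub_mul ha (mem_ball_zero_iff.1 hz.1).le
          calc _ ≤ ε ^ (c - (α + 2)) * ε ^ (-c) := by
                gcongr ε ^ (c - (α + 2)) * ?_
                exact Real.rpow_le_rpow_of_nonpos hε h1 (by linarith)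
            _ = _ := by rw [← Real.rpow_add hε]; congr 1; ring
      _ ≤ ENNReal.ofReal (ε ^ (-(α + 2))) * ENNReal.ofReal (W * R ^ (α + 1 + 2)) := by
          rw [lintegral_const_mul' _ _ ENNReal.ofReal_ne_top]
          gcongr
          exact setLIntegral_window_le (by linarith) hω hR
      _ ≤ _ := by
          rw [← ENNReal.ofReal_mul (by positivity), ← ENNReal.ofReal_mul (by positivity)]
          refine ENNReal.ofReal_le_ofReal ?_
          have h2 : R ^ (α + 1 + 2) = R ^ (α + 2) * R := by
            rw [← Real.rpow_add_one hR.ne']; congr 1; ring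
          have h3 : R ^ (α + 2) ≤ ε ^ (α + 2) := Real.rpow_le_rpow hR.le hRε (by linarith)
          have h4 : ε ^ (-(α + 2)) * ε ^ (α + 2) = 1 := by rw [← Real.rpow_add hε]; simp
          calc _ = ε ^ (-(α + 2)) * R ^ (α + 2) * (W * R) := by rw [h2]; ring
            _ ≤ ε ^ (-(α + 2)) * ε ^ (α + 2) * (W * R) := by gcongr
            _ = W * R := by rw [h4, one_mul]
            _ ≤ _ := by
              gcongr
              exact le_add_of_nonneg_right (by positivity)
  · calc _ ≤ ∫⁻ z in ball (0 : ℂ) 1, ENNReal.ofReal (ε ^ (c - (α + 2)) * 3 ^ c) *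
          (ENNReal.ofReal ((1 - ‖z‖) ^ (α + 1)) * ENNReal.ofReal ((ε + ‖z - 1‖) ^ (-c))) := by
          refine (lintegral_mono_set inter_subset_left).trans ?_
          refine setLIntegral_mono' measurableSet_ball fun z hz => ?_
          have h1 := add_norm_one_sub_le ha (mem_ball_zero_iff.1 hz).le
          have h0 : 0 < ε + ‖z - 1‖ := by positivity
          rw [enorm_testFun_rpow ha p n _ hz, hbp, mul_comm (ENNReal.ofReal ((1 - ‖z‖) ^ (α + 1))),
            ← mul_assoc, ← ENNReal.ofReal_mul (p := ε ^ (c - (α + 2)) * 3 ^ c) (by positivity)]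
          gcongr ENNReal.ofReal ?_ * _
          rw [mul_assoc]
          gcongr
          calc _ ≤ ((ε + ‖z - 1‖) / 3) ^ (-c) :=
                Real.rpow_le_rpow_of_nonpos (by positivity) (by linarith) (by linarith)
            _ = _ := by
                rw [Real.div_rpow h0.le (by norm_num), Real.rpow_neg (by norm_num : (0 : ℝ) ≤ 3),
                  div_inv_eq_mul, mul_comm]
      _ ≤ ENNReal.ofReal (ε ^ (c - (α + 2)) * 3 ^ c) *
          ENNReal.ofReal (W * (c / (c - (α + 1 + 2))) * ε ^ (α + 1 + 2 - c)) := by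
          rw [lintegral_const_mul' _ _ ENNReal.ofReal_ne_top]
          gcongr
          exact lintegral_add_norm_sub_one_rpow_neg_le (by linarith) (by linarith) hε
      _ ≤ _ := by
          rw [← ENNReal.ofReal_mul (by positivity), ← ENNReal.ofReal_mul (by positivity)]
          refine ENNReal.ofReal_le_ofReal ?_
          have h4 : ε ^ (c - (α + 2)) * ε ^ (α + 1 + 2 - c) = ε := by
            rw [← Real.rpow_add hε, show c - (α + 2) + (α + 1 + 2 - c) = 1 by ring, Real.rpow_one]
          calc _ = 3 ^ c * (W * (c / (c - (α + 1 + 2)))) *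
                (ε ^ (c - (α + 2)) * ε ^ (α + 1 + 2 - c)) := by ring
            _ = 3 ^ c * (W * (c / (c - (α + 1 + 2)))) * ε := by rw [h4]
            _ ≤ _ := by
              gcongr
              exact le_add_of_nonneg_left hW0.le

/-- For fixed z only the factor (1-a)^b depends on a, so the values tend to zero as a → 1 when b >
0. -/
lemma norm_cesaro_testFun_le (μ : Measure ℝ) [IsFiniteMeasure μ] {a : ℝ} (ha : a ∈ Ioo (0 : ℝ) 1)
    (n : ℕ) (b : ℝ) {z : ℂ} (hz : z ∈ ball (0 : ℂ) 1) :
    ‖cesaro μ (testFun n b a) z‖ ≤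
      (1 - a) ^ b * (((1 - ‖z‖) ^ n)⁻¹ * (1 - ‖z‖)⁻¹ * μ.real univ) := by
  have hz1 := mem_ball_zero_iff.1 hz
  have hx : 0 < 1 - ‖z‖ := by linarith
  have hε : 0 < 1 - a := by linarith [ha.2]
  rw [cesaro_of_mem _ _ hz]
  refine (norm_integral_le_of_norm_le_const
    (C := (1 - a) ^ b * (((1 - ‖z‖) ^ n)⁻¹ * (1 - ‖z‖)⁻¹)) ?_).trans ?_
  · filter_upwards [ae_restrict_mem measurableSet_Ico] with t ht
    have h1 := norm_ofReal_mul_le ht z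
    have h2 : 1 - ‖z‖ ≤ ‖1 - a * ((t : ℂ) * z)‖ :=
      le_trans (by linarith) (one_sub_norm_le_norm_one_sub_mul ha)
    have h3 : 1 - ‖z‖ ≤ ‖1 - (t : ℂ) * z‖ := by
      have := norm_sub_norm_le (1 : ℂ) (t * z)
      rw [norm_one] at this
      linarith
    rw [norm_div, norm_testFun ha n b (ofReal_mul_mem_ball ht hz1), div_eq_mul_inv, div_eq_mul_inv,
      mul_assoc]
    gcongr
  · rw [measureReal_restrict_apply_univ, mul_assoc]
    gcongr
    · exact measure_ne_top _ _
    · exact subset_univ _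

/-- At z = a the integrand is real and positive, so the integral may be restricted to [a, 1). There
1-ta ≤ 1-a² ≤ 2(1-a) and 1-a²t ≤ 1-a³ ≤ 3(1-a). -/
lemma le_norm_cesaro_testFun (μ : Measure ℝ) [IsFiniteMeasure μ] {a : ℝ} (ha : a ∈ Ioo (0 : ℝ) 1)
    (n : ℕ) (b : ℝ) :
    (1 - a) ^ b / ((3 * (1 - a)) ^ n * (2 * (1 - a))) * μ.real (Ico a 1) ≤
      ‖cesaro μ (testFun n b a) a‖ := by
  have hε : 0 < 1 - a := by linarith [ha.2]
  have han : ‖(a : ℂ)‖ < 1 := by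
    rw [Complex.norm_real, Real.norm_eq_abs, abs_of_pos ha.1]; exact ha.2
  set g : ℝ → ℝ := fun t => (1 - a) ^ b / (1 - a * (t * a)) ^ n / (1 - t * a) with hg
  have hgeq : ∀ t ∈ Ico (0 : ℝ) 1,
      (fun w => testFun n b a w / (1 - w)) ((t : ℂ) * (a : ℂ)) = ((g t : ℝ) : ℂ) := by
    intro t ht
    simp only [testFun]
    rw [indicator_of_mem (ofReal_mul_mem_ball ht han)]
    simp only [hg]
    push_cast
    ring
  have hpos : ∀ t ∈ Ico (0 : ℝ) 1, 0 < 1 - a * (t * a) ∧ 0 < 1 - t * a := by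
    intro t ht
    have h2 := one_sub_mul_pos ht ha.1.le ha.2
    refine ⟨?_, h2⟩
    nlinarith [ha.1, ha.2, mul_nonneg ht.1 ha.1.le]
  have hint : IntegrableOn g (Ico 0 1) μ := by
    have h1 := integrableOn_comp_ofReal_mul μ
      (differentiableOn_div_one_sub (differentiableOn_testFun ha n b)).continuousOn han
    have h2 : IntegrableOn (fun t => ((g t : ℝ) : ℂ)) (Ico 0 1) μ :=
      h1.congr_fun hgeq measurableSet_Ico
    exact h2.re
  rw [cesaro_of_mem _ _ (mem_ball_zero_iff.2 han), setIntegral_congr_fun measurableSet_Ico hgeq,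
    integral_complex_ofReal, Complex.norm_real]
  refine le_trans ?_ (Real.le_norm_self _)
  calc _ ≤ ∫ t in Ico a 1, g t ∂μ := by
        refine setIntegral_ge_of_const_le_real measurableSet_Ico (measure_ne_top _ _) ?_
          (hint.mono_set (Ico_subset_Ico_left ha.1.le))
        intro t ht
        have ht0 : t ∈ Ico (0 : ℝ) 1 := ⟨ha.1.le.trans ht.1, ht.2⟩
        obtain ⟨h1, h2⟩ := hpos t ht0
        have h3 : 1 - t * a ≤ 2 * (1 - a) := by nlinarith [ht.1, ha.1, ha.2]
        have h4 : 1 - a * (t * a) ≤ 3 * (1 - a) := by nlinarith [ht.1, ha.1, ha.2]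
        simp only [hg]
        rw [div_div]
        gcongr
    _ ≤ ∫ t in Ico 0 1, g t ∂μ := by
        refine setIntegral_mono_set hint ?_ (Ico_subset_Ico_left ha.1.le).eventuallyLE
        filter_upwards [ae_restrict_mem measurableSet_Ico] with t ht
        obtain ⟨h1, h2⟩ := hpos t ht
        simp only [hg, Pi.zero_apply]
        positivity

variable {p α ζ : ℝ} [hp : Fact (1 ≤ p)]

lemma exists_bounded_testFun (hα : -2 < α) {n : ℕ} (hn : α + 5 ≤ n * p) :
    ∃ C : ℝ, 0 < C ∧ ∃ F : ℝ → AT p α ζ, ∀ a ∈ Ioo (0 : ℝ) 1,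
      (F a : ℂ → ℂ) = testFun n (n - (α + 2) / p) a ∧ ‖F a‖ ≤ C := by
  have hp0 : 0 < p := by linarith [hp.out]
  obtain ⟨C, hC, h⟩ := exists_hasTentBound_testFun hp.out hα hn
  refine ⟨(3 * 2 ^ |α + 1| * C) ^ (1 / p), by positivity, ?_⟩
  have key : ∀ a : ℝ, ∃ f : AT p α ζ, a ∈ Ioo (0 : ℝ) 1 →
      (f : ℂ → ℂ) = testFun n (n - (α + 2) / p) a ∧ ‖f‖ ≤ (3 * 2 ^ |α + 1| * C) ^ (1 / p) := by
    intro a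
    by_cases ha : a ∈ Ioo (0 : ℝ) 1
    · have h1 := (h a ha).tentENorm_rpow_le ζ hp.out
      rw [← ENNReal.ofReal_mul (by positivity)] at h1
      have h2 : tentENorm p α ζ (testFun n (n - (α + 2) / p) a) ≤
          ENNReal.ofReal ((3 * 2 ^ |α + 1| * C) ^ (1 / p)) := by
        rw [← ENNReal.ofReal_rpow_of_nonneg (by positivity) (by positivity), one_div,
          ENNReal.le_rpow_inv_iff hp0]
        exact h1
      exact ⟨AT.ofFun _ (differentiableOn_testFun ha n _) (fun z hz => indicator_of_notMem hz _)
        (h2.trans_lt ENNReal.ofReal_lt_top), fun _ =>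
        ⟨rfl, AT.norm_le_of_tentENorm_le (by positivity) h2⟩⟩
    · exact ⟨0, fun h => absurd h ha⟩
  choose F hF using key
  exact ⟨F, fun a ha => hF a ha⟩

lemma CesaroCompactOn.isVanishingCarleson [Fact (1 / 2 < ζ)] {μ : Measure ℝ} [IsFiniteMeasure μ]
    (hα : -2 < α) (h : CesaroCompactOn p α ζ μ) :
    IsVanishingCarleson μ := by
  obtain ⟨T, hT, hTc⟩ := h
  have hp0 : 0 < p := by linarith [hp.out]
  -- An integer exponent avoids branches of the power; α+5 leaves room for both np > α+3 and b > 0.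
  obtain ⟨n, hn⟩ : ∃ n : ℕ, (α + 5) / p ≤ n := exists_nat_ge _
  rw [div_le_iff₀ hp0] at hn
  set b : ℝ := n - (α + 2) / p with hb
  have hb0 : 0 < b := by
    rw [hb, sub_pos, div_lt_iff₀ hp0]; linarith
  obtain ⟨C, hC, F, hF⟩ := exists_bounded_testFun (ζ := ζ) hα hn
  have hnear : ∀ᶠ a in 𝓝[<] (1 : ℝ), a ∈ Ioo (0 : ℝ) 1 := Ioo_mem_nhdsLT zero_lt_one
  obtain ⟨K, hK, hTK⟩ := IsCompactOperator.image_closedBall_subset_compact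
    (f := (T : AT p α ζ →ₗ[ℂ] AT p α ζ)) hTc C
  have hpow : Tendsto (fun a : ℝ => (1 - a) ^ b) (𝓝[<] 1) (𝓝 0) := by
    have h1 : ContinuousAt (fun a : ℝ => (1 - a) ^ b) 1 :=
      (by fun_prop : ContinuousAt (fun a : ℝ => 1 - a) 1).rpow_const (Or.inr hb0.le)
    have h2 := h1.tendsto
    simp only [sub_self, Real.zero_rpow hb0.ne'] at h2
    exact h2.mono_left nhdsWithin_le_nhds
  -- The values T(F_a) eventually lie in a compact set, and evaluations are continuous in norm.
  -- Pointwise convergence to zero therefore forces every cluster point to be 0.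
  have hTF : Tendsto (fun a => T (F a)) (𝓝[<] 1) (𝓝 0) := by
    refine hK.tendsto_nhds_of_unique_mapClusterPt ?_ fun y _ hy => ?_
    · filter_upwards [hnear] with a ha
      exact hTK ⟨F a, by simpa using (hF a ha).2, rfl⟩
    · refine AT.toFun_injective (funext fun z => ?_)
      rw [AT.toFun_zero, Pi.zero_apply]
      by_cases hz : z ∈ ball (0 : ℂ) 1
      · have h1 : Tendsto (fun a => T (F a) z) (𝓝[<] 1) (𝓝 0) := by
          have h3 := hpow.mul_const (((1 - ‖z‖) ^ n)⁻¹ * (1 - ‖z‖)⁻¹ * μ.real univ)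
          rw [zero_mul] at h3
          refine squeeze_zero_norm' ?_ h3
          filter_upwards [hnear] with a ha
          rw [hT, (hF a ha).1]
          exact norm_cesaro_testFun_le μ ha n b hz
        have h2 : MapClusterPt (y z) (𝓝[<] (1 : ℝ)) (fun a => T (F a) z) :=
          hy.continuousAt_comp (f := fun f : AT p α ζ => f z)
            (AT.continuous_apply hα z).continuousAt
        exact eq_of_nhds_neBot (h2.clusterPt.mono h1).neBot
      · exact y.eq_zero hz
  obtain ⟨C', hC', hev⟩ := AT.exists_norm_apply_le (p := p) (ζ := ζ) hα
  have hlim : Tendsto (fun a => 2 * 3 ^ n * C' * ‖T (F a)‖) (𝓝[<] 1) (𝓝 0) := by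
    simpa using hTF.norm.const_mul (2 * 3 ^ n * C')
  refine squeeze_zero' ?_ ?_ hlim
  · filter_upwards [hnear] with a ha
    exact div_nonneg measureReal_nonneg (by linarith [ha.2])
  · filter_upwards [hnear] with a ha
    have hε : 0 < 1 - a := by linarith [ha.2]
    have han : ‖(a : ℂ)‖ = a := by
      rw [Complex.norm_real, Real.norm_eq_abs, abs_of_pos ha.1]
    have h1 := le_norm_cesaro_testFun μ ha n b
    have h2 := hev (T (F a)) a (by rw [han]; exact ha.2)
    rw [hT, (hF a ha).1, han] at h2
    have h3 := h1.trans h2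
    -- The choice of b makes the lower bound carry the same power (1-a)^(-(α+2)/p) as the growth
    -- estimate; cancelling it leaves μ([a,1))/(1-a).
    have e : (1 - a) ^ b / ((3 * (1 - a)) ^ n * (2 * (1 - a))) =
        (1 - a) ^ (-((α + 2) / p)) / (2 * 3 ^ n * (1 - a)) := by
      rw [hb, sub_eq_add_neg (n : ℝ), Real.rpow_add hε, Real.rpow_natCast, mul_pow]
      field_simp
    rw [e] at h3
    have hpos : 0 < (1 - a) ^ (-((α + 2) / p)) := by positivity
    set q := (1 - a) ^ (-((α + 2) / p)) with hq
    have h4 : q * (μ.real (Ico a 1) / (1 - a)) ≤ q * (2 * 3 ^ n * C' * ‖T (F a)‖) := by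
      have h5 : q / (2 * 3 ^ n * (1 - a)) * μ.real (Ico a 1) * (2 * 3 ^ n) ≤
          C' * q * ‖T (F a)‖ * (2 * 3 ^ n) := by gcongr
      calc _ = q / (2 * 3 ^ n * (1 - a)) * μ.real (Ico a 1) * (2 * 3 ^ n) := by field_simp
        _ ≤ _ := h5
        _ = _ := by ring
    exact le_of_mul_le_mul_left h4 hpos

end TentSpace

theorem mainTheorem2 (p α ζ : ℝ) [Fact (1 ≤ p)] (hα : -2 < α) [Fact (1 / 2 < ζ)]
    (μ : Measure ℝ) [IsFiniteMeasure μ] (hμ : μ (Ico (0 : ℝ) 1)ᶜ = 0) :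
    TentSpace.CesaroCompactOn p α ζ μ ↔ TentSpace.IsVanishingCarleson μ :=
  ⟨fun h => h.isVanishingCarleson hα, fun h => h.cesaroCompactOn hα⟩
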